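/- Let $k$ be an algebraically closed field of characteristic different from $2$, let $\lambda_1,\lambda_2\in k\setminus\{0,1\}$, and let $C_i$ ($i=1,2$) be the elliptic curve $y_i^2=x_i(x_i-1)(x_i-\lambda_i)$. Let $X=\mathrm{Km}(C_1\times C_2)$ be the Kummer surface, i.e. the minimal resolution of the quotient of $C_1\times C_2$ by the inversion, and let $\pi:X\to\mathbf P^1\times\mathbf P^1$ be the morphism of degree two induced by $(x_1,x_2)$. Explicitly, $X$ is the nonsingular surface of all $((x_1:z_1),(x_2:z_2),(t:s))$ with $$x_1z_1(x_1-z_1)(x_1-\lambda_1z_1)\,t^2=x_2z_2(x_2-z_2)(x_2-\lambda_2z_2)\,s^2$$ in the $\mathbf P^1$-bundle over $\mathbf P^1\times\mathbf P^1$ in which $(x_1,z_1,x_2,z_2,t,s)$ and $(\alpha x_1,\alpha z_1,\beta x_2,\beta z_2,\beta^2\gamma t,\alpha^2\gamma s)$ are the same point for $\alpha,\beta,\gamma\in k^\times$; the map from $C_1\times C_2$ is given by $(t:s)=(y_2:y_1)$, and $\pi$ forgets $(t:s)$. For $0\le i,j\le 3$ let $R_{ij}=(p_i,p'_j)\in\mathbf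 P^1\times\mathbf P^1$, where $(p_0,p_1,p_2,p_3)=(\infty,0,1,\lambda_1)$ and $(p'_0,p'_1,p'_2,p'_3)=(\infty,0,1,\lambda_2)$; these are the images under $\pi$ of the sixteen exceptional curves $A_{ij}$ of the resolution. Let $L\subset\mathbf P^1\times\mathbf P^1$ be a $(1,1)$-curve, i.e. a curve with an equation $a x_1x_2+b x_1z_2+c z_1x_2+d z_1z_2=0$, where $a,b,c,d\in k$ are not all zero. Let $\tilde L\subset X$ be the curve $\pi^{-1}(L)$ with the exceptional curves $A_{ij}$ left out, i.e. the Zariski closure in $X$ of $\pi^{-1}(L\setminus\{R_{ij}\})$. 1. If $L$ passes through exactly three of the sixteen points $R_{ij}$, then $\tilde L$ is a nonsingular irreducible curve of genus $0$. 2. If $L$ passes through exactly two of the sixteen points $R_{ij}$, then $\tilde L$ is a nonsingular irreducible curve of genus $1$. -/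

import Mathlib

open scoped LinearAlgebra.Projectivization

noncomputable section

namespace KummerPencil

/-! ## Genus of a function field -/

/-- The Kähler differentials of a field extension `K/k` that are regular at every place, that is,
those lying in the image of `Ω[O⁄k]` in `Ω[K⁄k]` (the `O`-span of the `d f` with `f ∈ O`) for every
valuation ring `k ⊆ O ⊆ K`.  If `k` is algebraically closed and `K` is the function field of a
smooth projective curve `C` over `k`, this is the space `H⁰(C, Ω¹)` of global differentials. -/
def regularDifferentials (k K : Type*) [Field k] [Field K] [Algebra k K] :
    Submodule k (KaehlerDifferential k K) where
  carrier := {ω | ∀ O : ValuationSubring K, (∀ c : k, algebraMap k K c ∈ O) →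
    ω ∈ Submodule.span O.toSubring (KaehlerDifferential.D k K '' (O : Set K))}
  zero_mem' := fun _ _ => Submodule.zero_mem _
  add_mem' := fun ha hb O hO => Submodule.add_mem _ (ha O hO) (hb O hO)
  smul_mem' := fun c ω hω O hO => by
    have h : c • ω = (⟨algebraMap k K c, hO c⟩ : O.toSubring) • ω := by
      rw [← algebraMap_smul K c ω]
      rfl
    rw [h]
    exact Submodule.smul_mem _ _ (hω O hO)

/-- The genus of a function field of one variable `K/k`, where `k` is algebraically closed: the
dimension of the space of regular differentials.  It is a cardinal, so that the value `n : ℕ` means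
that the dimension is finite and equal to `n`. -/
def genus (k K : Type*) [Field k] [Field K] [Algebra k K] : Cardinal :=
  Module.rank k (regularDifferentials k K)

variable {k : Type*} [Field k]

/-! ## The elliptic curves -/

/-- The elliptic curve `y² = x (x - 1) (x - l)` in Legendre form. -/
def legendre (l : k) : WeierstrassCurve.Affine k := ⟨0, -(1 + l), 0, l, 0⟩

/-- The quartic form `x z (x - z) (x - l z)`.  The projective model of `legendre l` in the weighted
projective plane with weights `1, 1, 2` is `y² = x z (x - z) (x - l z)`. -/
def quartic (l x z : k) : k := x * z * (x - z) * (x - l * z)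

/-- Homogeneous coordinates `(x, z)` of the image in `ℙ¹` of a point of `legendre l`: these are
`(x, 1)` for a finite point `(x, y)`, and `(1, 0)` for the origin. -/
def xzCoord {l : k} : (legendre l).Point → Fin 2 → k
  | .zero => ![1, 0]
  | .some x _ _ => ![x, 1]

/-- The third weighted homogeneous coordinate, going with `xzCoord`. -/
def yCoord {l : k} : (legendre l).Point → k
  | .zero => 0
  | .some _ y _ => y

theorem xzCoord_ne_zero {l : k} (P : (legendre l).Point) : xzCoord P ≠ 0 := by
  intro h
  cases P with
  | zero => simpa [xzCoord] using congrFun h 0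
  | some x y hP => simpa [xzCoord] using congrFun h 1

/-- The projection of degree two from the elliptic curve to `ℙ¹`. -/
def proj {l : k} (P : (legendre l).Point) : ℙ k (Fin 2 → k) :=
  Projectivization.mk k (xzCoord P) (xzCoord_ne_zero P)

theorem yCoord_sq {l : k} (P : (legendre l).Point) :
    yCoord P ^ 2 = quartic l (xzCoord P 0) (xzCoord P 1) := by
  cases P with
  | zero => simp [yCoord, quartic, xzCoord]
  | some x y hP =>
    have h := ((legendre l).equation_iff x y).1 hP.1
    simp only [legendre] at h
    simp only [yCoord, quartic, xzCoord, Matrix.cons_val_zero, Matrix.cons_val_one]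
    linear_combination h

/-- Homogeneous coordinates of the points `∞, 0, 1, l` of `ℙ¹`. -/
def branchVec (l : k) : Fin 4 → Fin 2 → k := ![![1, 0], ![0, 1], ![1, 1], ![l, 1]]

theorem branchVec_ne_zero (l : k) (i : Fin 4) : branchVec l i ≠ 0 := by
  intro h
  fin_cases i
  · simpa [branchVec] using congrFun h 0
  · simpa [branchVec] using congrFun h 1
  · simpa [branchVec] using congrFun h 1
  · simpa [branchVec] using congrFun h 1

/-- The points `∞, 0, 1, l` of `ℙ¹`, the images of the four points of order dividing two. -/
def branchPoint (l : k) (i : Fin 4) : ℙ k (Fin 2 → k) :=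
  Projectivization.mk k (branchVec l i) (branchVec_ne_zero l i)

/-- The sixteen points `R i j` of `ℙ¹ × ℙ¹`, for the two curves `legendre l₁` and `legendre l₂`. -/
def R (l₁ l₂ : k) (ij : Fin 4 × Fin 4) : ℙ k (Fin 2 → k) × ℙ k (Fin 2 → k) :=
  (branchPoint l₁ ij.1, branchPoint l₂ ij.2)

/-! ## The Kummer surface

`X = Km(C₁ × C₂)`, for `Cᵢ = legendre lᵢ`, is constructed as the nonsingular surface
`q₁(x₁, z₁) t² = q₂(x₂, z₂) s²`, where `qᵢ` is the quartic form of `Cᵢ`, in the `ℙ¹`-bundle over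
`ℙ¹ × ℙ¹` with homogeneous coordinates `((x₁ : z₁), (x₂ : z₂), (t : s))` modulo the three-dimensional
torus acting by `(α x₁, α z₁, β x₂, β z₂, β² γ t, α² γ s)`.  The rational map from `C₁ × C₂` is given
by `(t : s) = (y₂ : y₁)`.  It is proved below that `X` is nonsingular, and that this rational map
identifies the quotient by `-1` of the complement of the sixteen points of order dividing two with
the complement of the sixteen curves `A i j = π⁻¹(R i j)`, each of them a line `ℙ¹`; so `X` is the
minimal resolution of `(C₁ × C₂)/{±1}`. -/

/-- The polynomial `q₁(x₁, z₁) t² - q₂(x₂, z₂) s²` in the homogeneous coordinates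
`x₁, z₁, x₂, z₂, t, s`, in this order. -/
def kummerPoly (l₁ l₂ : k) : MvPolynomial (Fin 6) k :=
  .X 0 * .X 1 * (.X 0 - .X 1) * (.X 0 - .C l₁ * .X 1) * .X 4 ^ 2 -
    .X 2 * .X 3 * (.X 2 - .X 3) * (.X 2 - .C l₂ * .X 3) * .X 5 ^ 2

/-- `v = (x₁, z₁, x₂, z₂, t, s)` are homogeneous coordinates of a point of the Kummer surface. -/
structure IsCoord (l₁ l₂ : k) (v : Fin 6 → k) : Prop where
  left : ![v 0, v 1] ≠ 0
  right : ![v 2, v 3] ≠ 0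
  fibre : ![v 4, v 5] ≠ 0
  eq : quartic l₁ (v 0) (v 1) * v 4 ^ 2 = quartic l₂ (v 2) (v 3) * v 5 ^ 2

/-- The action of the three-dimensional torus on homogeneous coordinates. -/
def scale (a b c : kˣ) (v : Fin 6 → k) : Fin 6 → k :=
  ![a * v 0, a * v 1, b * v 2, b * v 3, b ^ 2 * c * v 4, a ^ 2 * c * v 5]

/-- Two vectors of homogeneous coordinates define the same point if they differ by the torus. -/
def coordSetoid (l₁ l₂ : k) : Setoid {v : Fin 6 → k // IsCoord l₁ l₂ v} where
  r v w := ∃ a b c : kˣ, w.1 = scale a b c v.1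
  iseqv :=
    { refl := fun v => ⟨1, 1, 1, by ext i; fin_cases i <;> simp [scale]⟩
      symm := by
        rintro v w ⟨a, b, c, h⟩
        refine ⟨a⁻¹, b⁻¹, c⁻¹, ?_⟩
        rw [h]
        ext i
        fin_cases i <;> simp [scale] <;> field_simp
      trans := by
        rintro u v w ⟨a, b, c, h⟩ ⟨a', b', c', h'⟩
        refine ⟨a' * a, b' * b, c' * c, ?_⟩
        rw [h', h]
        ext i
        fin_cases i <;> simp [scale] <;> ring }

/-- The Kummer surface `X = Km(C₁ × C₂)` of the product of two elliptic curves in Legendre form. -/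
def KummerSurface (l₁ l₂ : k) : Type _ := Quotient (coordSetoid l₁ l₂)

variable {l₁ l₂ : k}

/-- The point of the Kummer surface with given homogeneous coordinates. -/
def KummerSurface.mk (v : Fin 6 → k) (hv : IsCoord l₁ l₂ v) : KummerSurface l₁ l₂ :=
  Quotient.mk (coordSetoid l₁ l₂) ⟨v, hv⟩

/-- The double cover `π : X → ℙ¹ × ℙ¹`, sending `((x₁ : z₁), (x₂ : z₂), (t : s))` to
`((x₁ : z₁), (x₂ : z₂))`. -/
def doubleCover (l₁ l₂ : k) :
    KummerSurface l₁ l₂ → ℙ k (Fin 2 → k) × ℙ k (Fin 2 → k) :=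
  Quotient.lift
    (fun v => (Projectivization.mk k ![v.1 0, v.1 1] v.2.left,
      Projectivization.mk k ![v.1 2, v.1 3] v.2.right))
    (by
      rintro v w ⟨a, b, c, h⟩
      refine Prod.ext ?_ ?_
      · refine ((Projectivization.mk_eq_mk_iff k _ _ _ _).2 ⟨a, ?_⟩).symm
        ext i
        fin_cases i <;> simp [h, scale, Units.smul_def]
      · refine ((Projectivization.mk_eq_mk_iff k _ _ _ _).2 ⟨b, ?_⟩).symm
        ext i
        fin_cases i <;> simp [h, scale, Units.smul_def])

/-! ## The Kummer surface as a resolution of the quotient by the inversion -/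

theorem quartic_eq_zero_iff (l x z : k) :
    quartic l x z = 0 ↔ x = 0 ∨ z = 0 ∨ x = z ∨ x = l * z := by
  simp [quartic, sub_eq_zero, or_assoc]

theorem isElliptic_legendre (h2 : (2 : k) ≠ 0) {l : k} (h0 : l ≠ 0) (h1 : l ≠ 1) :
    (legendre l).IsElliptic := by
  refine ⟨?_⟩
  have h : (legendre l).Δ = 2 ^ 4 * l ^ 2 * (l - 1) ^ 2 := by
    simp only [legendre, WeierstrassCurve.Δ, WeierstrassCurve.b₂, WeierstrassCurve.b₄,
      WeierstrassCurve.b₆, WeierstrassCurve.b₈]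
    ring
  rw [h, isUnit_iff_ne_zero]
  exact mul_ne_zero (mul_ne_zero (pow_ne_zero _ h2) (pow_ne_zero _ h0))
    (pow_ne_zero _ (sub_ne_zero.2 h1))

theorem xzCoord_neg {l : k} (P : (legendre l).Point) : xzCoord (-P) = xzCoord P := by
  cases P with
  | zero => rfl
  | some x y hP => rfl

theorem yCoord_neg {l : k} (P : (legendre l).Point) : yCoord (-P) = -yCoord P := by
  cases P with
  | zero => exact neg_zero.symm
  | some x y hP =>
    rw [WeierstrassCurve.Affine.Point.neg_some]
    simp [yCoord, WeierstrassCurve.Affine.negY, legendre]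

theorem point_ext {l : k} {P Q : (legendre l).Point} (h1 : xzCoord P = xzCoord Q)
    (h2 : yCoord P = yCoord Q) : P = Q := by
  cases P with
  | zero =>
    cases Q with
    | zero => rfl
    | some x y hQ => simpa [xzCoord] using congrFun h1 1
  | some x y hP =>
    cases Q with
    | zero => simpa [xzCoord] using congrFun h1 1
    | some x' y' hQ =>
      have hx : x = x' := by simpa [xzCoord] using congrFun h1 0
      have hy : y = y' := h2
      subst hx hy
      rfl

/-- The points of order dividing two are those with vanishing `y`-coordinate. -/
theorem neg_eq_iff (h2 : (2 : k) ≠ 0) {l : k} (P : (legendre l).Point) :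
    -P = P ↔ yCoord P = 0 := by
  constructor
  · intro h
    have h' : -yCoord P = yCoord P := by rw [← yCoord_neg, h]
    have h'' : 2 * yCoord P = 0 := by linear_combination -h'
    exact (mul_eq_zero.1 h'').resolve_left h2
  · intro h
    exact point_ext (xzCoord_neg P) (by rw [yCoord_neg, h, neg_zero])

theorem mk_mem_range_branchPoint (l : k) (u : Fin 2 → k) (hu : u ≠ 0) :
    Projectivization.mk k u hu ∈ Set.range (branchPoint l) ↔ quartic l (u 0) (u 1) = 0 := by
  have hu' : u 0 ≠ 0 ∨ u 1 ≠ 0 := by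
    by_contra! h
    exact hu (by ext i; fin_cases i <;> simp [h.1, h.2])
  rw [quartic_eq_zero_iff]
  constructor
  · rintro ⟨i, hi⟩
    obtain ⟨a, ha⟩ := (Projectivization.mk_eq_mk_iff' k _ _ _ _).1 hi.symm
    rw [← ha]
    fin_cases i <;> simp [branchVec, mul_comm]
  · intro h
    have key : ∀ i, (∃ a : k, a • branchVec l i = u) →
        Projectivization.mk k u hu ∈ Set.range (branchPoint l) := fun i hi =>
      ⟨i, ((Projectivization.mk_eq_mk_iff' k _ _ _ _).2 hi).symm⟩
    rcases h with h | h | h | h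
    · exact key 1 ⟨u 1, by ext i; fin_cases i <;> simp [branchVec, h]⟩
    · exact key 0 ⟨u 0, by ext i; fin_cases i <;> simp [branchVec, h]⟩
    · exact key 2 ⟨u 1, by ext i; fin_cases i <;> simp [branchVec, h]⟩
    · exact key 3 ⟨u 1, by ext i; fin_cases i <;> simp [branchVec, h, mul_comm]⟩

/-- The four points `branchPoint l i` are the images of the points of order dividing two. -/
theorem proj_mem_range_iff (h2 : (2 : k) ≠ 0) {l : k} (P : (legendre l).Point) :
    proj P ∈ Set.range (branchPoint l) ↔ -P = P := by
  rw [neg_eq_iff h2, proj, mk_mem_range_branchPoint, ← yCoord_sq]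
  exact pow_eq_zero_iff two_ne_zero

theorem isCoord_kummerMap (P : (legendre l₁).Point) (Q : (legendre l₂).Point)
    (h : ¬ (yCoord P = 0 ∧ yCoord Q = 0)) :
    IsCoord l₁ l₂ ![xzCoord P 0, xzCoord P 1, xzCoord Q 0, xzCoord Q 1, yCoord Q, yCoord P] where
  left := by
    intro h0
    refine xzCoord_ne_zero P (funext fun i => ?_)
    have := congrFun h0 i
    fin_cases i <;> simpa using this
  right := by
    intro h0
    refine xzCoord_ne_zero Q (funext fun i => ?_)
    have := congrFun h0 i
    fin_cases i <;> simpa using this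
  fibre := by
    intro h0
    exact h ⟨by simpa using congrFun h0 1, by simpa using congrFun h0 0⟩
  eq := by
    have h1 := yCoord_sq P
    have h3 := yCoord_sq Q
    simp only [Matrix.cons_val]
    rw [← h1, ← h3]
    ring

/-- The rational map from `C₁ × C₂` to the Kummer surface, given by `(t : s) = (y₂ : y₁)`. -/
def kummerMap (P : (legendre l₁).Point) (Q : (legendre l₂).Point)
    (h : ¬ (yCoord P = 0 ∧ yCoord Q = 0)) : KummerSurface l₁ l₂ :=
  KummerSurface.mk _ (isCoord_kummerMap P Q h)

/-- The composite of the rational map with `π` is the product of the two projections. -/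
theorem doubleCover_kummerMap (P : (legendre l₁).Point) (Q : (legendre l₂).Point)
    (h : ¬ (yCoord P = 0 ∧ yCoord Q = 0)) :
    doubleCover l₁ l₂ (kummerMap P Q h) = (proj P, proj Q) := by
  refine Prod.ext ?_ ?_
  · refine (Projectivization.mk_eq_mk_iff' k _ _ _ _).2 ⟨1, ?_⟩
    ext i
    fin_cases i <;> simp
  · refine (Projectivization.mk_eq_mk_iff' k _ _ _ _).2 ⟨1, ?_⟩
    ext i
    fin_cases i <;> simp

theorem xzCoord_eq_of_scale {l : k} {P P' : (legendre l).Point} {a : k} (ha : a ≠ 0)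
    (h0 : xzCoord P' 0 = a * xzCoord P 0) (h1 : xzCoord P' 1 = a * xzCoord P 1) :
    a = 1 ∧ xzCoord P' = xzCoord P := by
  have key : a = 1 := by
    cases P with
    | zero =>
      cases P' with
      | zero => simpa [xzCoord] using h0.symm
      | some x y hP => simp [xzCoord] at h1
    | some x y hP =>
      cases P' with
      | zero =>
        exact absurd (by simpa [xzCoord] using h1.symm) ha
      | some x' y' hP' => simpa [xzCoord] using h1.symm
  subst key
  refine ⟨rfl, funext fun i => ?_⟩
  fin_cases i
  · simpa using h0
  · simpa using h1

/-- The fibres of the rational map are the orbits of the inversion. -/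
theorem kummerMap_eq_iff (P P' : (legendre l₁).Point) (Q Q' : (legendre l₂).Point)
    (h : ¬ (yCoord P = 0 ∧ yCoord Q = 0)) (h' : ¬ (yCoord P' = 0 ∧ yCoord Q' = 0)) :
    kummerMap P Q h = kummerMap P' Q' h' ↔ (P' = P ∧ Q' = Q) ∨ (P' = -P ∧ Q' = -Q) := by
  constructor
  · intro he
    obtain ⟨a, b, c, e⟩ := Quotient.exact he
    have e0 : xzCoord P' 0 = a * xzCoord P 0 := by simpa [scale] using congrFun e 0
    have e1 : xzCoord P' 1 = a * xzCoord P 1 := by simpa [scale] using congrFun e 1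
    have e2 : xzCoord Q' 0 = b * xzCoord Q 0 := by simpa [scale] using congrFun e 2
    have e3 : xzCoord Q' 1 = b * xzCoord Q 1 := by simpa [scale] using congrFun e 3
    have e4 : yCoord Q' = b ^ 2 * c * yCoord Q := by simpa [scale] using congrFun e 4
    have e5 : yCoord P' = a ^ 2 * c * yCoord P := by simpa [scale] using congrFun e 5
    obtain ⟨ha, hP⟩ := xzCoord_eq_of_scale a.ne_zero e0 e1
    obtain ⟨hb, hQ⟩ := xzCoord_eq_of_scale b.ne_zero e2 e3
    rw [hb, one_pow, one_mul] at e4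
    rw [ha, one_pow, one_mul] at e5
    have sP : yCoord P' ^ 2 = yCoord P ^ 2 := by rw [yCoord_sq, yCoord_sq, hP]
    have sQ : yCoord Q' ^ 2 = yCoord Q ^ 2 := by rw [yCoord_sq, yCoord_sq, hQ]
    have hc : (c : k) ^ 2 = 1 := by
      rw [e5] at sP
      rw [e4] at sQ
      by_cases hy : yCoord P = 0
      · have hy' : yCoord Q ≠ 0 := fun hz => h ⟨hy, hz⟩
        exact mul_right_cancel₀ (pow_ne_zero 2 hy') (by linear_combination sQ)
      · exact mul_right_cancel₀ (pow_ne_zero 2 hy) (by linear_combination sP)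
    rcases sq_eq_one_iff.1 hc with hc | hc
    · exact Or.inl ⟨point_ext hP (by rw [e5, hc, one_mul]), point_ext hQ (by rw [e4, hc, one_mul])⟩
    · refine Or.inr ⟨point_ext (hP.trans (xzCoord_neg P).symm) ?_,
        point_ext (hQ.trans (xzCoord_neg Q).symm) ?_⟩
      · rw [e5, hc, yCoord_neg, neg_one_mul]
      · rw [e4, hc, yCoord_neg, neg_one_mul]
  · rintro (⟨rfl, rfl⟩ | ⟨rfl, rfl⟩)
    · rfl
    · refine Quotient.sound ⟨1, 1, -1, ?_⟩
      ext i
      fin_cases i <;> simp [scale, xzCoord_neg, yCoord_neg]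

theorem exists_point [IsAlgClosed k] (h2 : (2 : k) ≠ 0) {l : k} (h0 : l ≠ 0) (h1 : l ≠ 1)
    (u : Fin 2 → k) (hu : u ≠ 0) : ∃ (P : (legendre l).Point) (a : kˣ),
      u 0 = a * xzCoord P 0 ∧ u 1 = a * xzCoord P 1 := by
  have := isElliptic_legendre h2 h0 h1
  by_cases hz : u 1 = 0
  · have hx : u 0 ≠ 0 := fun hx => hu (by ext i; fin_cases i <;> simp [hx, hz])
    exact ⟨.zero, Units.mk0 _ hx, by simp [xzCoord], by simp [xzCoord, hz]⟩
  · obtain ⟨y, hy⟩ := IsAlgClosed.exists_pow_nat_eq (quartic l (u 0 / u 1) 1) two_pos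
    have he : (legendre l).Equation (u 0 / u 1) y := by
      rw [WeierstrassCurve.Affine.equation_iff]
      simp only [legendre]
      rw [quartic] at hy
      linear_combination hy
    refine ⟨.some _ _ (WeierstrassCurve.Affine.equation_iff_nonsingular.1 he),
      Units.mk0 _ hz, ?_, ?_⟩
    · simp only [xzCoord, Units.val_mk0, Matrix.cons_val_zero]
      field_simp
    · simp [xzCoord]

/-- The two partial derivatives of the quartic form have no common zero with it. -/
theorem quartic_separable {l x z : k} (h0 : l ≠ 0) (h1 : l ≠ 1) (hu : ![x, z] ≠ 0)
    (h : quartic l x z = 0)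
    (hx : z * (x - z) * (x - l * z) + x * z * (x - l * z) + x * z * (x - z) = 0)
    (hz : x * (x - z) * (x - l * z) - x * z * (x - l * z) - l * x * z * (x - z) = 0) : False := by
  have key : x = 0 ∧ z = 0 := by
    rcases (quartic_eq_zero_iff l x z).1 h with rfl | rfl | rfl | rfl
    · have e : l * z ^ 3 = 0 := by linear_combination hx
      exact ⟨rfl, by simpa [h0] using e⟩
    · have e : x ^ 3 = 0 := by linear_combination hz
      exact ⟨by simpa using e, rfl⟩
    · have e : (1 - l) * x ^ 3 = 0 := by linear_combination hx
      have e' : x = 0 := by simpa [sub_eq_zero, h1.symm] using e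
      exact ⟨e', e'⟩
    · have e : l * (l - 1) * z ^ 3 = 0 := by linear_combination hx
      have e' : z = 0 := by simpa [sub_eq_zero, h0, h1] using e
      exact ⟨by rw [e', mul_zero], e'⟩
  exact hu (by ext i; fin_cases i <;> simp [key.1, key.2])

theorem quartic_mul (l a x z : k) : quartic l (a * x) (a * z) = a ^ 4 * quartic l x z := by
  simp only [quartic]
  ring

/-- The image of the rational map is the complement of the curves `π⁻¹(R i j)`. -/
theorem exists_kummerMap_iff [IsAlgClosed k] (h2 : (2 : k) ≠ 0) (h₁ : l₁ ≠ 0 ∧ l₁ ≠ 1)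
    (h₂ : l₂ ≠ 0 ∧ l₂ ≠ 1) (x : KummerSurface l₁ l₂) :
    (∃ P Q h, kummerMap P Q h = x) ↔ doubleCover l₁ l₂ x ∉ Set.range (R l₁ l₂) := by
  constructor
  · rintro ⟨P, Q, h, rfl⟩ ⟨⟨i, j⟩, hij⟩
    rw [doubleCover_kummerMap] at hij
    refine h ⟨(neg_eq_iff h2 P).1 ((proj_mem_range_iff h2 P).1 ⟨i, congrArg Prod.fst hij⟩),
      (neg_eq_iff h2 Q).1 ((proj_mem_range_iff h2 Q).1 ⟨j, congrArg Prod.snd hij⟩)⟩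
  · induction x using Quotient.inductionOn with
    | h v =>
    obtain ⟨v, hv⟩ := v
    intro hx
    obtain ⟨P, a, hP0, hP1⟩ := exists_point h2 h₁.1 h₁.2 _ hv.left
    obtain ⟨Q, b, hQ0, hQ1⟩ := exists_point h2 h₂.1 h₂.2 _ hv.right
    simp only [Matrix.cons_val_zero, Matrix.cons_val_one] at hP0 hP1 hQ0 hQ1
    have hq : ¬ (quartic l₁ (v 0) (v 1) = 0 ∧ quartic l₂ (v 2) (v 3) = 0) := by
      rintro ⟨q1, q2⟩
      obtain ⟨i, hi⟩ := (mk_mem_range_branchPoint l₁ _ hv.left).2 (by simpa using q1)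
      obtain ⟨j, hj⟩ := (mk_mem_range_branchPoint l₂ _ hv.right).2 (by simpa using q2)
      exact hx ⟨(i, j), Prod.ext hi hj⟩
    have e := hv.eq
    rw [hP0, hP1, hQ0, hQ1, quartic_mul, quartic_mul, ← yCoord_sq, ← yCoord_sq] at e hq
    have hy : ¬ (yCoord P = 0 ∧ yCoord Q = 0) := fun hy => hq (by simp [hy.1, hy.2])
    have ha := a.ne_zero
    have hb := b.ne_zero
    -- after a change of sign of `P`, the two points `(t : s)` and `(y₂ : y₁)` agree
    have key : ∃ P' : (legendre l₁).Point, xzCoord P' = xzCoord P ∧ yCoord P' ^ 2 = yCoord P ^ 2 ∧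
        (a : k) ^ 2 * yCoord P' * v 4 = (b : k) ^ 2 * yCoord Q * v 5 := by
      have h' : ((a : k) ^ 2 * yCoord P * v 4) ^ 2 = ((b : k) ^ 2 * yCoord Q * v 5) ^ 2 := by
        linear_combination e
      rcases sq_eq_sq_iff_eq_or_eq_neg.1 h' with h' | h'
      · exact ⟨P, rfl, rfl, h'⟩
      · refine ⟨-P, xzCoord_neg P, by rw [yCoord_neg, neg_sq], ?_⟩
        rw [yCoord_neg]
        linear_combination -h'
    obtain ⟨P', hP', hsq, hk⟩ := key
    have hy' : ¬ (yCoord P' = 0 ∧ yCoord Q = 0) := by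
      rintro ⟨z1, z2⟩
      rw [z1] at hsq
      exact hy ⟨by simpa using hsq.symm, z2⟩
    have hf : v 4 ≠ 0 ∨ v 5 ≠ 0 := by
      by_contra! h
      exact hv.fibre (by ext i; fin_cases i <;> simp [h.1, h.2])
    refine ⟨P', Q, hy', ?_⟩
    have hc : ∃ c : kˣ, v 4 = b ^ 2 * c * yCoord Q ∧ v 5 = a ^ 2 * c * yCoord P' := by
      by_cases hyP : yCoord P' = 0
      · have hyQ : yCoord Q ≠ 0 := fun hz => hy' ⟨hyP, hz⟩
        have h5 : v 5 = 0 := by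
          rw [hyP, mul_zero, zero_mul] at hk
          exact (mul_eq_zero.1 hk.symm).resolve_left (mul_ne_zero (pow_ne_zero _ hb) hyQ)
        have h4 : v 4 ≠ 0 := hf.resolve_right (not_not.2 h5)
        refine ⟨Units.mk0 (v 4 / (b ^ 2 * yCoord Q))
          (div_ne_zero h4 (mul_ne_zero (pow_ne_zero _ hb) hyQ)), ?_, ?_⟩
        · simp only [Units.val_mk0]
          field_simp
        · rw [h5, hyP, mul_zero]
      · have h5 : v 5 ≠ 0 := by
          intro h5
          rw [h5, mul_zero] at hk
          exact (hf.resolve_right (not_not.2 h5))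
            ((mul_eq_zero.1 hk).resolve_left (mul_ne_zero (pow_ne_zero _ ha) hyP))
        refine ⟨Units.mk0 (v 5 / (a ^ 2 * yCoord P'))
          (div_ne_zero h5 (mul_ne_zero (pow_ne_zero _ ha) hyP)), ?_, ?_⟩
        · simp only [Units.val_mk0]
          field_simp
          linear_combination hk
        · simp only [Units.val_mk0]
          field_simp
    obtain ⟨c, h4, h5⟩ := hc
    refine Quotient.sound ⟨a, b, c, ?_⟩
    ext i
    fin_cases i
    · simpa [scale, hP'] using hP0
    · simpa [scale, hP'] using hP1
    · simpa [scale] using hQ0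
    · simpa [scale] using hQ1
    · simpa [scale] using h4
    · simpa [scale] using h5

theorem isCoord_exceptional (i j : Fin 4) (u : Fin 2 → k) (hu : u ≠ 0) : IsCoord l₁ l₂
    ![branchVec l₁ i 0, branchVec l₁ i 1, branchVec l₂ j 0, branchVec l₂ j 1, u 0, u 1] where
  left := by
    intro h0
    refine branchVec_ne_zero l₁ i (funext fun n => ?_)
    have := congrFun h0 n
    fin_cases n <;> simpa using this
  right := by
    intro h0
    refine branchVec_ne_zero l₂ j (funext fun n => ?_)
    have := congrFun h0 n
    fin_cases n <;> simpa using this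
  fibre := by
    intro h0
    refine hu (funext fun n => ?_)
    have := congrFun h0 n
    fin_cases n <;> simpa using this
  eq := by
    have h1 := (mk_mem_range_branchPoint l₁ _ (branchVec_ne_zero l₁ i)).1 ⟨i, rfl⟩
    have h2 := (mk_mem_range_branchPoint l₂ _ (branchVec_ne_zero l₂ j)).1 ⟨j, rfl⟩
    simp only [Matrix.cons_val]
    rw [h1, h2, zero_mul, zero_mul]

/-- The fibre of `π` at `R i j` is the line formed by all the points `(t : s)`. -/
theorem doubleCover_eq_R_iff (x : KummerSurface l₁ l₂) (i j : Fin 4) :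
    doubleCover l₁ l₂ x = R l₁ l₂ (i, j) ↔ ∃ (u : Fin 2 → k) (hu : u ≠ 0),
      x = KummerSurface.mk _ (isCoord_exceptional i j u hu) := by
  constructor
  · induction x using Quotient.inductionOn with
    | h v =>
    obtain ⟨v, hv⟩ := v
    intro h
    obtain ⟨a, ha⟩ := (Projectivization.mk_eq_mk_iff k _ _ _ _).1 (congrArg Prod.fst h)
    obtain ⟨b, hb⟩ := (Projectivization.mk_eq_mk_iff k _ _ _ _).1 (congrArg Prod.snd h)
    have hu : ![(a : k) ^ 2 * v 4, (b : k) ^ 2 * v 5] ≠ 0 := by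
      intro h0
      have e0 := congrFun h0 0
      have e1 := congrFun h0 1
      simp only [Matrix.cons_val_zero, Matrix.cons_val_one, Pi.zero_apply] at e0 e1
      refine hv.fibre (funext fun n => ?_)
      fin_cases n
      · exact (mul_eq_zero.1 e0).resolve_left (pow_ne_zero _ a.ne_zero)
      · exact (mul_eq_zero.1 e1).resolve_left (pow_ne_zero _ b.ne_zero)
    refine ⟨_, hu, Quotient.sound (s := coordSetoid l₁ l₂) ?_⟩
    refine ⟨a⁻¹, b⁻¹, a ^ 2 * b ^ 2, ?_⟩
    have a0 := congrFun ha 0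
    have a1 := congrFun ha 1
    have b0 := congrFun hb 0
    have b1 := congrFun hb 1
    simp only [Units.smul_def, Pi.smul_apply, smul_eq_mul, Matrix.cons_val_zero,
      Matrix.cons_val_one] at a0 a1 b0 b1
    ext n
    fin_cases n
    · simp [scale, ← a0]
    · simp [scale, ← a1]
    · simp [scale, ← b0]
    · simp [scale, ← b1]
    · simp [scale]
      field_simp
      simp
    · simp [scale]
  · rintro ⟨u, hu, rfl⟩
    refine Prod.ext ?_ ?_
    · refine (Projectivization.mk_eq_mk_iff' k _ _ _ _).2 ⟨1, ?_⟩
      ext n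
      fin_cases n <;> simp
    · refine (Projectivization.mk_eq_mk_iff' k _ _ _ _).2 ⟨1, ?_⟩
      ext n
      fin_cases n <;> simp

theorem eval_kummerPoly (v : Fin 6 → k) : MvPolynomial.eval v (kummerPoly l₁ l₂) =
    quartic l₁ (v 0) (v 1) * v 4 ^ 2 - quartic l₂ (v 2) (v 3) * v 5 ^ 2 := by
  simp [kummerPoly, quartic]

/-- The Kummer surface is nonsingular: the gradient of its equation vanishes nowhere. -/
theorem kummerSurface_nonsingular (h2 : (2 : k) ≠ 0) (h₁ : l₁ ≠ 0 ∧ l₁ ≠ 1)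
    (h₂ : l₂ ≠ 0 ∧ l₂ ≠ 1) (v : Fin 6 → k) (hv : IsCoord l₁ l₂ v) :
    ∃ i, MvPolynomial.eval v (MvPolynomial.pderiv i (kummerPoly l₁ l₂)) ≠ 0 := by
  by_contra! hd
  have d0 := hd 0
  have d1 := hd 1
  have d2 := hd 2
  have d3 := hd 3
  have d4 := hd 4
  have d5 := hd 5
  simp [kummerPoly, MvPolynomial.pderiv_X, Derivation.leibniz,
    Derivation.leibniz_pow] at d0 d1 d2 d3 d4 d5
  have hf : v 4 ≠ 0 ∨ v 5 ≠ 0 := by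
    by_contra! h
    exact hv.fibre (by ext i; fin_cases i <;> simp [h.1, h.2])
  rcases hf with hf | hf
  · refine quartic_separable h₁.1 h₁.2 hv.left ?_ ?_ ?_
    · simpa [quartic, h2, hf] using d4
    · linear_combination d0.resolve_left hf
    · linear_combination d1.resolve_left hf
  · refine quartic_separable h₂.1 h₂.2 hv.right ?_ ?_ ?_
    · simpa [quartic, h2, hf] using d5
    · linear_combination d2.resolve_left hf
    · linear_combination d3.resolve_left hf

/-! ## Curves on the Kummer surface -/

/-- All the homogeneous coordinates of the points of a subset of the Kummer surface. -/
def cone (Z : Set (KummerSurface l₁ l₂)) : Set (Fin 6 → k) :=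
  {v | ∃ hv : IsCoord l₁ l₂ v, KummerSurface.mk v hv ∈ Z}

/-- The ideal of a subset of the Kummer surface in the ring of homogeneous coordinates. -/
def idealOf (Z : Set (KummerSurface l₁ l₂)) : Ideal (MvPolynomial (Fin 6) k) :=
  MvPolynomial.vanishingIdeal k (cone Z)

/-- The closure for the Zariski topology of a subset of the Kummer surface. -/
def zariskiClosure (Z : Set (KummerSurface l₁ l₂)) : Set (KummerSurface l₁ l₂) :=
  {x | ∃ (v : Fin 6 → k) (hv : IsCoord l₁ l₂ v),
    KummerSurface.mk v hv = x ∧ v ∈ MvPolynomial.zeroLocus k (idealOf Z)}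

/-- The multidegrees of the homogeneous coordinates `x₁, z₁, x₂, z₂, t, s`: the weights of the action
of the torus. -/
def weight : Fin 6 → Fin 3 → ℕ :=
  ![![1, 0, 0], ![1, 0, 0], ![0, 1, 0], ![0, 1, 0], ![0, 2, 1], ![2, 0, 1]]

/-- The function field of the closed subvariety with prime ideal `P`: the quotients `f / g` of
multihomogeneous polynomials of the same multidegree, with `g ∉ P`, in the field of fractions of the
ring of homogeneous coordinates modulo `P`. -/
def functionField (P : Ideal (MvPolynomial (Fin 6) k)) [P.IsPrime] :
    IntermediateField k P.ResidueField where
  carrier := {r | ∃ (d : Fin 3 → ℕ) (f g : MvPolynomial (Fin 6) k),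
    f.IsWeightedHomogeneous weight d ∧ g.IsWeightedHomogeneous weight d ∧ g ∉ P ∧
      r = algebraMap _ P.ResidueField f / algebraMap _ P.ResidueField g}
  mul_mem' := by
    rintro _ _ ⟨d, f, g, hf, hg, hgP, rfl⟩ ⟨d', f', g', hf', hg', hgP', rfl⟩
    refine ⟨d + d', f * f', g * g', hf.mul hf', hg.mul hg', ?_, ?_⟩
    · exact fun h => (‹P.IsPrime›.mem_or_mem h).elim hgP hgP'
    · rw [map_mul, map_mul, div_mul_div_comm]
  add_mem' := by
    rintro _ _ ⟨d, f, g, hf, hg, hgP, rfl⟩ ⟨d', f', g', hf', hg', hgP', rfl⟩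
    refine ⟨d + d', f * g' + g * f', g * g', (hf.mul hg').add (hg.mul hf'), hg.mul hg', ?_, ?_⟩
    · exact fun h => (‹P.IsPrime›.mem_or_mem h).elim hgP hgP'
    · have h1 : algebraMap _ P.ResidueField g ≠ 0 := by simpa using hgP
      have h2 : algebraMap _ P.ResidueField g' ≠ 0 := by simpa using hgP'
      rw [map_add, map_mul, map_mul, map_mul, div_add_div _ _ h1 h2]
  algebraMap_mem' := fun c => by
    refine ⟨0, .C c, 1, MvPolynomial.isWeightedHomogeneous_C _ _,
      MvPolynomial.isWeightedHomogeneous_one _ _, ?_, ?_⟩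
    · exact (Ideal.ne_top_iff_one P).1 ‹P.IsPrime›.ne_top
    · rw [map_one, div_one, IsScalarTower.algebraMap_apply k (MvPolynomial (Fin 6) k)]
      rfl
  inv_mem' := by
    rintro _ ⟨d, f, g, hf, hg, hgP, rfl⟩
    by_cases hfP : f ∈ P
    · refine ⟨d, f, g, hf, hg, hgP, ?_⟩
      have h : algebraMap _ P.ResidueField f = 0 := by simpa using hfP
      rw [h, zero_div, inv_zero]
    · exact ⟨d, g, f, hg, hf, hfP, inv_div _ _⟩

/-- The subset `Z` of the Kummer surface is a nonsingular irreducible closed curve of genus `g`.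
The cone over a curve has dimension `1 + 3` in the six-dimensional space of homogeneous coordinates,
so that the Jacobian criterion asks for rank `6 - 4 = 2` at every point. -/
structure IsCurveOfGenus (Z : Set (KummerSurface l₁ l₂)) (g : ℕ) : Prop where
  closed : zariskiClosure Z = Z
  nonsingular : ∀ v ∈ cone Z, Module.finrank k (Submodule.span k
    ((fun p : MvPolynomial (Fin 6) k => fun i => MvPolynomial.eval v (MvPolynomial.pderiv i p)) ''
      (idealOf Z : Set (MvPolynomial (Fin 6) k)))) = 2
  curve_of_genus : ∃ _ : (idealOf Z).IsPrime,
    Algebra.trdeg k (functionField (idealOf Z)) = 1 ∧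
      genus k (functionField (idealOf Z)) = g

/-! ## Curves of bidegree `(1,1)` -/

/-- `L` is a curve in `ℙ¹ × ℙ¹` with a bihomogeneous equation
`a x₁ x₂ + b x₁ z₂ + c z₁ x₂ + d z₁ z₂ = 0`, where `a, b, c, d` are not all zero. -/
def IsOneOneCurve (L : Set (ℙ k (Fin 2 → k) × ℙ k (Fin 2 → k))) : Prop :=
  ∃ a b c d : k, ¬ (a = 0 ∧ b = 0 ∧ c = 0 ∧ d = 0) ∧
    ∀ (u v : Fin 2 → k) (hu : u ≠ 0) (hv : v ≠ 0),
      (Projectivization.mk k u hu, Projectivization.mk k v hv) ∈ L ↔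
        a * u 0 * v 0 + b * u 0 * v 1 + c * u 1 * v 0 + d * u 1 * v 1 = 0

/-- The curve `π⁻¹(L)` on the Kummer surface, without the exceptional curves `π⁻¹(R i j)` that the
full inverse image contains: the closure of the inverse image of the part of `L` outside of the
sixteen points `R i j` (strict transform). -/
def pullbackCurve (l₁ l₂ : k) (L : Set (ℙ k (Fin 2 → k) × ℙ k (Fin 2 → k))) :
    Set (KummerSurface l₁ l₂) :=
  zariskiClosure (doubleCover l₁ l₂ ⁻¹' (L \ Set.range (R l₁ l₂)))

end KummerPencil

end

/-!
A nondegenerate curve `L` of bidegree `(1, 1)` is the graph of an isomorphism `m` between the two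
projective lines, and `R i j` lies on `L` when `m` takes the `i`-th branch point of the first
double cover to the `j`-th branch point of the second one. In a coordinate `u = (u₀ : u₁)` on `L`
the two quartic forms become `G A` and `G B`, where `G` is the product of the linear forms
belonging to the points `R i j` on `L`, and where `A` and `B` have simple zeros and no common one.
Away from the exceptional curves the equation of the Kummer surface over `L` is `A t² = B s²` (up
to a twist of `t`), and this is the equation of the strict transform. The degenerate curves, which
are unions of a horizontal and a vertical line, contain no point `R i j` or at least four of them.

* If `L` contains three of the points, `A` and `B` are linear, and in suitable coordinates they are
  `u₁` and `u₀`: the function field is generated by `w` with `w² = u₀ / u₁`, so it is rational.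
* If `L` contains two of the points, `A` and `B` are quadratic, and in suitable coordinates they
  are `u₀ u₁` and `u₀² - e u₀ u₁ + u₁²` with `e² ≠ 4`: with `x = u₀ / u₁`, `w² = B / A` and
  `y = x w` the function field is that of the elliptic curve `y² = x (x² - e x + 1)`.

The structure `LineParam` collects the data of such a parametrization. It is constructed in
`IsOneOneCurve.exists_lineParam_of_ncard_eq_three` and
`IsOneOneCurve.exists_lineParam_of_ncard_eq_two`. By Hilbert's Nullstellensatz the ideal of the
strict transform is the preimage of the prime ideal generated by `A T² - B s²` in a polynomial ring
of parameters (`LineParam.mem_idealOf_iff`). Nonsingularity follows by the chain rule from that of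
the surface of parameters (`LineParam.finrank_span_gradient`), and generators of the function field
are found in `LineParam.exists_generators_of_algHom`.

The genus of the two function fields is computed from the definition, without Riemann–Roch. The
differentials of `K / k` form a line with basis `dx`, because `K` is formally étale over `k[x]`. If
`O` is a valuation ring whose centre on a smooth affine chart `R` is locally generated by one
element, then `O` is a localization of `R` (`exists_mul_mem_of_mem_valuationSubring`), so that it
is preserved by every derivation that preserves `R`. On the cubic curve there is a derivation
`y d/dx` that preserves the coordinate rings of both of the charts with coordinates `x` and `1 / x`;
hence the coefficient of a regular differential with respect to `dx / y` lies in every valuation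
ring, and is a constant. Conversely, `dx / y` is regular since the cubic has no double root. On the
line, the two charts show that the coefficient `f` of a regular differential `f dw` and also `w² f`
are constants, which forces `f = 0`.
-/

namespace KummerPencil

section FunctionField

open Polynomial
open scoped KaehlerDifferential

/-! ### Differentials and constants of a function field -/

theorem isSeparable_of_adjoin_sqrt {F K : Type*} [Field F] [Field K] [Algebra F K]
    (h2 : (2 : F) ≠ 0) {s : Set K} (hs : ∀ y ∈ s, y ≠ 0 ∧ ∃ a : F, y ^ 2 = algebraMap F K a)
    (htop : IntermediateField.adjoin F s = ⊤) : Algebra.IsSeparable F K := by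
  have h : Algebra.IsSeparable F (IntermediateField.adjoin F s) := by
    rw [IntermediateField.isSeparable_adjoin_iff_isSeparable]
    intro y hy
    obtain ⟨hy0, a, hp⟩ := hs y hy
    have ha : a ≠ 0 := by
      rintro rfl
      rw [map_zero] at hp
      exact hy0 ((pow_eq_zero_iff two_ne_zero).1 hp)
    have hsepa : (X ^ 2 - C a : F[X]).Separable :=
      separable_X_pow_sub_C a (by simpa using h2) ha
    exact hsepa.of_dvd (minpoly.dvd _ _ (by simp [hp]))
  rw [htop] at h
  exact Algebra.IsSeparable.of_algHom F _
      (IntermediateField.topEquiv (F := F) (E := K)).symm.toAlgHom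

theorem adjoin_top_of_adjoin_insert {k F K : Type*} [Field k] [Field F] [Field K] [Algebra k K]
    [Algebra k F] [Algebra F K] [IsScalarTower k F K] {x : K} {s : Set K}
    (hx : x ∈ Set.range (algebraMap F K))
    (htop : IntermediateField.adjoin k (insert x s) = ⊤) : IntermediateField.adjoin F s = ⊤ := by
  have h : IntermediateField.adjoin k (insert x s) ≤
      (IntermediateField.adjoin F s).restrictScalars k := by
    rw [IntermediateField.adjoin_le_iff, Set.insert_subset_iff]
    obtain ⟨a, rfl⟩ := hx
    exact ⟨IntermediateField.adjoin.algebraMap_mem F s a, IntermediateField.subset_adjoin F s⟩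
  rw [htop, top_le_iff] at h
  exact (IntermediateField.restrictScalars_eq_top_iff (K := k)).1 h

/-- A separable extension of `k(x)` is formally étale over `k[x]`, so that its differentials come
from those of `k[x]` by extension of scalars. -/
theorem trdeg_eq_one_and_exists_kaehlerEquiv_of_tower {k F K : Type*} [Field k] [Field F] [Field K]
    [Algebra k K] [Algebra k[X] F] [IsFractionRing k[X] F] [Algebra F K] [Algebra k[X] K]
    [IsScalarTower k[X] F K] [IsScalarTower k k[X] K] [Algebra.IsSeparable F K] :
    Algebra.trdeg k K = 1 ∧ ∃ E : Ω[K⁄k] ≃ₗ[K] K,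
      E (KaehlerDifferential.D k K (algebraMap k[X] K X)) = 1 := by
  have hinj : FaithfulSMul k[X] K := by
    rw [faithfulSMul_iff_algebraMap_injective, IsScalarTower.algebraMap_eq k[X] F K]
    exact (algebraMap F K).injective.comp (IsFractionRing.injective k[X] F)
  constructor
  · have : Algebra.IsAlgebraic k[X] K :=
      (IsFractionRing.comap_isAlgebraic_iff (A := k[X]) (K := F) (C := K)).2 inferInstance
    have h := lift_trdeg_add_eq k k[X] K
    rw [Polynomial.trdeg_of_isDomain, trdeg_eq_zero] at h
    simpa using h.symm
  · have : Algebra.FormallyEtale k[X] F := .of_isLocalization (nonZeroDivisors k[X])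
    have : Algebra.FormallyEtale F K := .of_isSeparable _ _
    have : Algebra.FormallyEtale k[X] K := .comp _ F _
    refine ⟨(KaehlerDifferential.tensorKaehlerEquivOfFormallyEtale k k[X] K).symm ≪≫ₗ
      (KaehlerDifferential.polynomialEquiv k).baseChange k[X] K _ _ ≪≫ₗ
      TensorProduct.AlgebraTensorModule.rid k[X] K K, ?_⟩
    have e := KaehlerDifferential.tensorKaehlerEquivOfFormallyEtale_symm_D_algebraMap k k[X] K X
    simp [e, KaehlerDifferential.polynomialEquiv_D]

/-- If `K` arises from the rational function field `k(x)` by adjoining square roots of polynomials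
in `x`, then `dx` is a basis of the differentials of `K/k`: the extension `K/k(x)` is separable, so
that `K` is formally étale over the polynomial ring `k[x]`. -/
theorem trdeg_eq_one_and_exists_kaehlerEquiv {k K : Type*} [Field k] [Field K] [Algebra k K]
    (h2 : (2 : k) ≠ 0) {x : K} (hx : Transcendental k x) {s : Set K}
    (hs : ∀ y ∈ s, y ≠ 0 ∧ ∃ p : k[X], y ^ 2 = aeval x p)
    (htop : IntermediateField.adjoin k (insert x s) = ⊤) :
    Algebra.trdeg k K = 1 ∧
      ∃ E : Ω[K⁄k] ≃ₗ[K] K, E (KaehlerDifferential.D k K x) = 1 := by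
  let : Algebra k[X] K := (aeval x).toAlgebra
  have halg : ∀ p : k[X], algebraMap k[X] K p = aeval x p := fun p => rfl
  have : IsScalarTower k k[X] K := .of_algebraMap_eq fun c => by
    rw [halg, ← Polynomial.C_eq_algebraMap, aeval_C]
  have : FaithfulSMul k[X] K :=
    (faithfulSMul_iff_algebraMap_injective _ _).2 (transcendental_iff_injective.1 hx)
  let : Algebra (FractionRing k[X]) K := FractionRing.liftAlgebra k[X] K
  have : IsScalarTower k[X] (FractionRing k[X]) K := FractionRing.isScalarTower_liftAlgebra k[X] K
  have : IsScalarTower k (FractionRing k[X]) K := .of_algebraMap_eq fun c => by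
    rw [IsScalarTower.algebraMap_apply k k[X] (FractionRing k[X]),
      ← IsScalarTower.algebraMap_apply k[X] (FractionRing k[X]) K,
      ← IsScalarTower.algebraMap_apply k k[X] K]
  have hX : ∀ p : k[X], aeval x p =
      algebraMap (FractionRing k[X]) K (algebraMap k[X] (FractionRing k[X]) p) := fun p => by
    rw [← halg, ← IsScalarTower.algebraMap_apply]
  have h2F : (2 : FractionRing k[X]) ≠ 0 := by
    have := (algebraMap k (FractionRing k[X])).injective.ne h2
    rwa [map_ofNat, map_zero] at this
  have : Algebra.IsSeparable (FractionRing k[X]) K := by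
    refine isSeparable_of_adjoin_sqrt h2F (s := s) (fun y hy => ?_)
      (adjoin_top_of_adjoin_insert (k := k) ⟨_, (hX X).symm.trans (aeval_X x)⟩ htop)
    obtain ⟨hy0, p, hp⟩ := hs y hy
    exact ⟨hy0, _, hp.trans (hX p)⟩
  have h := trdeg_eq_one_and_exists_kaehlerEquiv_of_tower (k := k) (F := FractionRing k[X]) (K := K)
  rwa [halg, aeval_X] at h

/-- An element lying in all the valuation rings of `K/k` is a constant. -/
theorem mem_range_of_forall_mem_valuationSubring {k K : Type*} [Field k] [IsAlgClosed k] [Field K]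
    [Algebra k K] {h : K}
    (hh : ∀ O : ValuationSubring K, (∀ c : k, algebraMap k K c ∈ O) → h ∈ O) :
    ∃ c : k, algebraMap k K c = h := by
  have hmem : h ∈ (integralClosure (Subring.closure (Set.range (algebraMap k K))) K).toSubring := by
    rw [← iInf_valuationSubring_superset, Subring.mem_iInf]
    rintro ⟨O, hO⟩
    exact hh O fun c => hO ⟨c, rfl⟩
  rw [← RingHom.coe_range, Subring.closure_eq] at hmem
  have hint : IsIntegral (algebraMap k K).range h := hmem
  let : Algebra k (algebraMap k K).range := (algebraMap k K).rangeRestrict.toAlgebra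
  have : IsScalarTower k (algebraMap k K).range K := .of_algebraMap_eq fun _ => rfl
  have : Algebra.IsIntegral k (algebraMap k K).range :=
    Algebra.isIntegral_of_surjective (algebraMap k K).rangeRestrict_surjective
  have hk : IsIntegral k h := isIntegral_trans h hint
  exact minpoly.mem_range_of_degree_eq_one k h
    (IsAlgClosed.degree_eq_one_of_irreducible k (minpoly.irreducible hk))

/-! ### Derivations and valuation rings -/

/-- In a Noetherian subring `R` of a valuation ring `O` whose centre on `R` is locally generated by
`π`, every nonzero element is locally a power of `π` up to a unit. -/
theorem exists_mul_eq_pow_mul {K : Type*} [Field K] {R : Subring K} [IsNoetherianRing R]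
    {O : ValuationSubring K} (hRO : R ≤ O.toSubring) {π : K} (hπR : π ∈ R)
    (hπ : O.valuation π < 1)
    (hloc : ∀ r ∈ R, O.valuation r < 1 →
      ∃ s ∈ R, ∃ r' ∈ R, O.valuation s = 1 ∧ s * r = π * r')
    {r : K} (hr : r ∈ R) (hr0 : r ≠ 0) :
    ∃ n : ℕ, ∃ s ∈ R, ∃ r' ∈ R, O.valuation s = 1 ∧ O.valuation r' = 1 ∧ s * r = π ^ n * r' := by
  let P : Ideal R := (IsLocalRing.maximalIdeal O).comap (Subring.inclusion hRO)
  have hP : ∀ a : R, a ∈ P ↔ O.valuation (a : K) < 1 := fun a =>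
    (O.valuation_lt_one_iff ⟨(a : K), hRO a.2⟩)
  have hP' : ∀ a : R, a ∉ P ↔ O.valuation (a : K) = 1 := fun a => by
    rw [hP, not_lt]
    exact ⟨fun h => le_antisymm ((O.valuation_le_one_iff _).2 (hRO a.2)) h, fun h => h.ge⟩
  have hPp : P.IsPrime := Ideal.IsPrime.comap _
  have hnz : P.primeCompl ≤ nonZeroDivisors R := P.primeCompl_le_nonZeroDivisors
  have : IsDomain (Localization.AtPrime P) := IsLocalization.isDomain_localization hnz
  have : IsNoetherianRing (Localization.AtPrime P) :=
    IsLocalization.isNoetherianRing P.primeCompl _ inferInstance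
  have hinj : Function.Injective (algebraMap R (Localization.AtPrime P)) :=
    IsLocalization.injective _ hnz
  set ϖ : Localization.AtPrime P := algebraMap R _ ⟨π, hπR⟩ with hϖ
  have hu : ¬ IsUnit ϖ := by
    rw [IsLocalization.AtPrime.isUnit_to_map_iff _ P]
    exact fun h => h ((hP _).2 hπ)
  obtain ⟨b, hb, hnb⟩ := (FiniteMultiplicity.of_not_isUnit hu
    (b := algebraMap R _ ⟨r, hr⟩) (by
      rw [Ne, ← map_zero (algebraMap R (Localization.AtPrime P)), hinj.eq_iff]
      exact fun h => hr0 (congrArg Subtype.val h))).exists_eq_pow_mul_and_not_dvd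
  generalize multiplicity ϖ _ = n at hb
  obtain ⟨r₁, s₁, rfl⟩ := IsLocalization.exists_mk'_eq P.primeCompl b
  have hr₁ : r₁ ∉ P := by
    intro h
    obtain ⟨s, hs, r', hr', hvs, e⟩ := hloc r₁ r₁.2 ((hP _).1 h)
    apply hnb
    have hsu : IsUnit (algebraMap R (Localization.AtPrime P) ⟨s, hs⟩) :=
      (IsLocalization.AtPrime.isUnit_to_map_iff _ P _).2 ((hP' _).2 hvs)
    have hd : ϖ ∣ algebraMap R (Localization.AtPrime P) ⟨s, hs⟩ *
        IsLocalization.mk' (Localization.AtPrime P) r₁ s₁ := by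
      refine ⟨IsLocalization.mk' (Localization.AtPrime P) ⟨r', hr'⟩ s₁, ?_⟩
      rw [hϖ, IsLocalization.mul_mk'_eq_mk'_of_mul, IsLocalization.mul_mk'_eq_mk'_of_mul]
      congr 1
      exact Subtype.ext e
    exact (hsu.dvd_mul_left).1 hd
  refine ⟨n, s₁, s₁.1.2, r₁, r₁.2, (hP' _).1 s₁.2, (hP' _).1 hr₁, ?_⟩
  have e : (s₁ : R) * ⟨r, hr⟩ = ⟨π, hπR⟩ ^ n * r₁ := by
    apply hinj
    rw [map_mul, hb, map_mul, map_pow, mul_left_comm, mul_comm (algebraMap R _ (s₁ : R)),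
      IsLocalization.mk'_spec]
  exact congrArg Subtype.val e

/-- Under the same assumption, `O` is the localization of `R` at its centre as soon as `R` has the
same field of fractions. -/
theorem exists_mul_mem_of_mem_valuationSubring {K : Type*} [Field K] {R : Subring K}
    [IsNoetherianRing R] (hfrac : ∀ h : K, ∃ s ∈ R, s ≠ 0 ∧ s * h ∈ R)
    {O : ValuationSubring K} (hRO : R ≤ O.toSubring) {π : K} (hπR : π ∈ R)
    (hπ : O.valuation π < 1)
    (hloc : ∀ r ∈ R, O.valuation r < 1 →
      ∃ s ∈ R, ∃ r' ∈ R, O.valuation s = 1 ∧ s * r = π * r')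
    {h : K} (hh : h ∈ O) : ∃ s ∈ R, O.valuation s = 1 ∧ s * h ∈ R := by
  by_cases h0 : h = 0
  · exact ⟨1, R.one_mem, map_one _, by rw [h0, mul_zero]; exact R.zero_mem⟩
  obtain ⟨s, hs, hs0, hsh⟩ := hfrac h
  obtain ⟨n, a, ha, b, hb, va, vb, e⟩ :=
    exists_mul_eq_pow_mul hRO hπR hπ hloc hsh (mul_ne_zero hs0 h0)
  obtain ⟨m, c, hc, d, hd, vc, vd, f⟩ := exists_mul_eq_pow_mul hRO hπR hπ hloc hs hs0
  have hc0 : c ≠ 0 := by rintro rfl; simp at vc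
  have hπm : π ^ m ≠ 0 := by
    intro hz
    rw [hz, zero_mul] at f
    exact mul_ne_zero hc0 hs0 f
  -- both sides are `a c s h`
  have key : π ^ m * (a * d * h) = π ^ n * (c * b) := by linear_combination c * e - a * h * f
  have hmn : m ≤ n := by
    by_contra! hlt
    obtain ⟨j, rfl⟩ := Nat.exists_eq_add_of_lt hlt
    have hπn : π ^ n ≠ 0 := fun hz => hπm (by rw [add_assoc, pow_add, hz, zero_mul])
    have key' : π ^ (j + 1) * (a * d * h) = c * b := by
      apply mul_left_cancel₀ hπn
      rw [← key]
      ring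
    have hv := congrArg O.valuation key'
    rw [map_mul, map_mul, map_mul, map_mul, va, vb, vc, vd, one_mul, one_mul, map_pow] at hv
    have h1 : O.valuation π ^ (j + 1) < 1 := pow_lt_one₀ zero_le hπ (Nat.succ_ne_zero j)
    have h3 : O.valuation π ^ (j + 1) * O.valuation h < 1 :=
      mul_lt_one_of_lt_of_le h1 ((O.valuation_le_one_iff h).2 hh)
    exact h3.ne hv
  obtain ⟨j, rfl⟩ := Nat.exists_eq_add_of_le hmn
  refine ⟨a * d, R.mul_mem ha hd, by rw [map_mul, va, vd, one_mul], ?_⟩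
  have : a * d * h = π ^ j * (c * b) := by
    apply mul_left_cancel₀ hπm
    rw [key]
    ring
  rw [this]
  exact R.mul_mem (R.pow_mem hπR j) (R.mul_mem hc hb)

/-- A derivation that preserves `R` preserves every localization of `R`. -/
theorem derivation_mem_valuationSubring {k K : Type*} [Field k] [Field K] [Algebra k K]
    {R : Subring K} {O : ValuationSubring K} (hRO : R ≤ O.toSubring)
    (D : Derivation k K K) (hD : ∀ r ∈ R, D r ∈ R) {h s : K} (hs : s ∈ R)
    (vs : O.valuation s = 1) (hsh : s * h ∈ R) : D h ∈ O := by
  have hs0 : s ≠ 0 := by rintro rfl; simp at vs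
  have hinv : s⁻¹ ∈ O := by rw [← O.valuation_le_one_iff, map_inv₀, vs, inv_one]
  have hh : h ∈ O := by
    have := O.mul_mem _ _ hinv (hRO hsh)
    rwa [inv_mul_cancel_left₀ hs0] at this
  have e : D h = s⁻¹ * (D (s * h) - h * D s) := by
    rw [Derivation.leibniz, smul_eq_mul, smul_eq_mul]
    field_simp
    ring
  rw [e]
  exact O.mul_mem _ _ hinv (O.sub_mem (hRO (hD _ hsh)) (O.mul_mem _ _ hh (hRO (hD _ hs))))

section Chart

variable {k K : Type*} [Field k] [Field K] [Algebra k K]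

theorem valuation_aeval_eq_one [IsAlgClosed k] {x : K} {O : ValuationSubring K}
    (hk : ∀ c : k, algebraMap k K c ∈ O) (hx : ∀ a : k, O.valuation (x - algebraMap k K a) = 1)
    {p : k[X]} (hp : p ≠ 0) : O.valuation (aeval x p) = 1 := by
  have hc : ∀ c : k, c ≠ 0 → O.valuation (algebraMap k K c) = 1 := fun c hc => by
    refine le_antisymm ((O.valuation_le_one_iff _).2 (hk c)) ?_
    have h := (O.valuation_le_one_iff _).2 (hk c⁻¹)
    rw [map_inv₀, map_inv₀] at h
    exact (inv_le_one₀ (by simpa [zero_lt_iff] using hc)).1 h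
  rw [(IsAlgClosed.splits p).eq_prod_roots, map_mul, aeval_C, map_mul,
    hc _ (leadingCoeff_ne_zero.2 hp), one_mul, map_multiset_prod, map_multiset_prod,
    Multiset.map_map, Multiset.map_map]
  refine Multiset.prod_eq_one fun v hv => ?_
  obtain ⟨a, -, rfl⟩ := Multiset.mem_map.1 hv
  simpa using hx a

/-- A valuation ring of `K/k` whose centre is not a point of the `x`-line is trivial. -/
theorem mem_valuationSubring_of_forall_not_lt [IsAlgClosed k] {x : K} {s : Set K}
    (hs : ∀ y ∈ s, ∃ p : k[X], y ^ 2 = aeval x p)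
    (htop : IntermediateField.adjoin k (insert x s) = ⊤) {O : ValuationSubring K}
    (hk : ∀ c : k, algebraMap k K c ∈ O) (hxO : x ∈ O)
    (hx : ∀ a : k, ¬ O.valuation (x - algebraMap k K a) < 1) (h : K) : h ∈ O := by
  have hx' : ∀ a : k, O.valuation (x - algebraMap k K a) = 1 := fun a =>
    le_antisymm ((O.valuation_le_one_iff _).2 (O.sub_mem hxO (hk a))) (not_lt.1 (hx a))
  have hF : (IntermediateField.adjoin k {x}).toSubfield.toSubring ≤ O.toSubring := by
    intro f hf
    obtain ⟨p, q, rfl⟩ := (IntermediateField.mem_adjoin_simple_iff k f).1 hf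
    by_cases hp : p = 0
    · rw [hp, map_zero, zero_div]; exact O.zero_mem
    by_cases hq : q = 0
    · rw [hq, map_zero, div_zero]; exact O.zero_mem
    refine (O.valuation_le_one_iff _).1 ?_
    rw [map_div₀, valuation_aeval_eq_one hk hx' hp, valuation_aeval_eq_one hk hx' hq, div_one]
  have htopF : IntermediateField.adjoin (IntermediateField.adjoin k {x}) s = ⊤ :=
    adjoin_top_of_adjoin_insert
      ⟨⟨x, IntermediateField.mem_adjoin_simple_self k x⟩, rfl⟩ htop
  have halg : Algebra.IsAlgebraic (IntermediateField.adjoin k {x})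
      (IntermediateField.adjoin (IntermediateField.adjoin k {x}) s) := by
    refine IntermediateField.isAlgebraic_adjoin fun y hy => ?_
    obtain ⟨p, hp⟩ := hs y hy
    refine IsIntegral.of_pow two_pos ?_
    rw [hp]
    have hmem : aeval x p ∈ IntermediateField.adjoin k {x} :=
      (IntermediateField.mem_adjoin_simple_iff k _).2 ⟨p, 1, by simp⟩
    exact isIntegral_algebraMap (x := (⟨_, hmem⟩ : IntermediateField.adjoin k {x}))
  have hmem : h ∈ IntermediateField.adjoin (IntermediateField.adjoin k {x}) s :=
    htopF ▸ IntermediateField.mem_top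
  have hint : IsIntegral (IntermediateField.adjoin k {x}) h :=
    (halg.isAlgebraic ⟨h, hmem⟩).isIntegral.map
      (IntermediateField.val (IntermediateField.adjoin (IntermediateField.adjoin k {x}) s))
  have hO : IsIntegral O h :=
    hint.map_of_comp_eq (Subring.inclusion hF : IntermediateField.adjoin k {x} →+* O)
      (RingHom.id K) rfl
  obtain ⟨z, hz⟩ := IsIntegrallyClosed.isIntegral_iff.1 hO
  exact hz ▸ z.2

/-- Let `R = k[s]` be a finitely generated `k`-algebra in `K` with field of fractions `K`.  If the
centre on `R` of a valuation ring `O` is locally principal, a derivation that preserves `R`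
preserves `O`. -/
theorem derivation_mem_of_locally_principal {s : Set K} (hfin : s.Finite)
    (htop : IntermediateField.adjoin k s = ⊤) (D : Derivation k K K)
    (hD : ∀ a ∈ s, D a ∈ Algebra.adjoin k s) {O : ValuationSubring K}
    (hk : ∀ c : k, algebraMap k K c ∈ O) (hsO : ∀ a ∈ s, a ∈ O) {π : K}
    (hπR : π ∈ Algebra.adjoin k s) (hπ : O.valuation π < 1)
    (hloc : ∀ r ∈ Algebra.adjoin k s, O.valuation r < 1 →
      ∃ t ∈ Algebra.adjoin k s, ∃ r' ∈ Algebra.adjoin k s, O.valuation t = 1 ∧ t * r = π * r')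
    {h : K} (hh : h ∈ O) : D h ∈ O := by
  have hnoeth : IsNoetherianRing (Algebra.adjoin k s).toSubring :=
    isNoetherianRing_of_fg (S := Algebra.adjoin k s) (Subalgebra.fg_def.2 ⟨s, hfin, rfl⟩)
  have hRO : (Algebra.adjoin k s).toSubring ≤ O.toSubring := by
    intro r hr
    refine Algebra.adjoin_induction (p := fun r _ => r ∈ O) hsO hk
      (fun _ _ _ _ => O.add_mem _ _) (fun _ _ _ _ => O.mul_mem _ _) hr
  have hfrac : ∀ h : K, ∃ t ∈ (Algebra.adjoin k s).toSubring, t ≠ 0 ∧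
      t * h ∈ (Algebra.adjoin k s).toSubring := by
    intro h
    obtain ⟨r, hr, t, ht, rfl⟩ :=
      IntermediateField.mem_adjoin_iff_div.1 (htop ▸ IntermediateField.mem_top (x := h))
    by_cases ht0 : t = 0
    · refine ⟨1, Subring.one_mem _, one_ne_zero, ?_⟩
      rw [ht0, div_zero, mul_zero]
      exact Subring.zero_mem _
    · exact ⟨t, ht, ht0, by rw [mul_div_cancel₀ _ ht0]; exact hr⟩
  have hDR : ∀ r ∈ (Algebra.adjoin k s).toSubring, D r ∈ (Algebra.adjoin k s).toSubring := by
    intro r hr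
    refine Algebra.adjoin_induction (p := fun r _ => D r ∈ Algebra.adjoin k s) hD ?_ ?_ ?_ hr
    · intro c
      rw [D.map_algebraMap]
      exact zero_mem _
    · intro a b _ _ ha hb
      rw [map_add]
      exact add_mem ha hb
    · intro a b ha hb hDa hDb
      rw [D.leibniz]
      exact add_mem (mul_mem ha hDb) (mul_mem hb hDa)
  obtain ⟨t, ht, vt, hth⟩ := exists_mul_mem_of_mem_valuationSubring hfrac hRO hπR hπ hloc hh
  exact derivation_mem_valuationSubring hRO D hDR ht vt hth

/-- Modulo the ideal generated by `x - a` and `y - b`, every function on an affine plane curve is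
constant. -/
theorem exists_eq_add_of_mem_adjoin_pair {x y : K} (a b : k) {r : K}
    (hr : r ∈ Algebra.adjoin k {x, y}) :
    ∃ c : k, ∃ r₁ ∈ Algebra.adjoin k {x, y}, ∃ r₂ ∈ Algebra.adjoin k {x, y},
      r = algebraMap k K c + (x - algebraMap k K a) * r₁ + (y - algebraMap k K b) * r₂ := by
  induction hr using Algebra.adjoin_induction with
  | mem z hz =>
    rcases hz with rfl | rfl
    · exact ⟨a, 1, one_mem _, 0, zero_mem _, by ring⟩
    · exact ⟨b, 0, zero_mem _, 1, one_mem _, by ring⟩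
  | algebraMap c => exact ⟨c, 0, zero_mem _, 0, zero_mem _, by ring⟩
  | add z w _ _ hz hw =>
    obtain ⟨c, r₁, h₁, r₂, h₂, rfl⟩ := hz
    obtain ⟨c', r₁', h₁', r₂', h₂', rfl⟩ := hw
    exact ⟨c + c', r₁ + r₁', add_mem h₁ h₁', r₂ + r₂', add_mem h₂ h₂', by rw [map_add]; ring⟩
  | mul z w _ hw' hz hw =>
    obtain ⟨c, r₁, h₁, r₂, h₂, rfl⟩ := hz
    obtain ⟨c', r₁', h₁', r₂', h₂', e⟩ := hw
    refine ⟨c * c', r₁ * w + algebraMap k K c * r₁', ?_, r₂ * w + algebraMap k K c * r₂', ?_, ?_⟩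
    · exact add_mem (mul_mem h₁ hw') (mul_mem (Subalgebra.algebraMap_mem _ c) h₁')
    · exact add_mem (mul_mem h₂ hw') (mul_mem (Subalgebra.algebraMap_mem _ c) h₂')
    · rw [map_mul]
      linear_combination algebraMap k K c * e

theorem eq_zero_of_valuation_lt_one {O : ValuationSubring K} (hk : ∀ c : k, algebraMap k K c ∈ O)
    {c : k} (hc : O.valuation (algebraMap k K c) < 1) : c = 0 := by
  by_contra h0
  have h := (O.valuation_le_one_iff _).2 (hk c⁻¹)
  have := mul_lt_one_of_lt_of_le hc h
  rw [← map_mul, ← map_mul, mul_inv_cancel₀ h0, map_one, map_one] at this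
  exact this.false

end Chart

/-! ### The genus of the line and of a cubic curve -/

section Charts

variable {k K : Type*} [Field k] [IsAlgClosed k] [Field K] [Algebra k K]

/-- On the affine line, the derivation `d/dw` preserves all valuation rings containing `w`. -/
theorem derivation_mem_of_line {w : K} (htop : IntermediateField.adjoin k {w} = ⊤)
    (D : Derivation k K K) (hD : D w = 1) {O : ValuationSubring K}
    (hk : ∀ c : k, algebraMap k K c ∈ O) (hw : w ∈ O) {h : K} (hh : h ∈ O) : D h ∈ O := by
  by_cases hc : ∃ a : k, O.valuation (w - algebraMap k K a) < 1
  · obtain ⟨a, ha⟩ := hc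
    have hwR : w ∈ Algebra.adjoin k {w} := Algebra.self_mem_adjoin_singleton k w
    refine derivation_mem_of_locally_principal (Set.finite_singleton w) htop D ?_ hk ?_
      (sub_mem hwR (Subalgebra.algebraMap_mem _ a)) ha ?_ hh
    · rintro _ rfl
      rw [hD]
      exact one_mem _
    · rintro _ rfl
      exact hw
    · intro r hr hv
      rw [← Set.pair_eq_singleton w] at hr
      obtain ⟨c, r₁, h₁, r₂, h₂, rfl⟩ := exists_eq_add_of_mem_adjoin_pair a a hr
      rw [Set.pair_eq_singleton w] at h₁ h₂
      have hRO : ∀ r ∈ Algebra.adjoin k {w}, r ∈ O := fun r hr =>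
        Algebra.adjoin_induction (p := fun r _ => r ∈ O) (by rintro _ rfl; exact hw) hk
          (fun _ _ _ _ => O.add_mem _ _) (fun _ _ _ _ => O.mul_mem _ _) hr
      have hv' : O.valuation ((w - algebraMap k K a) * (r₁ + r₂)) < 1 := by
        rw [map_mul]
        exact mul_lt_one_of_lt_of_le ha ((O.valuation_le_one_iff _).2 (hRO _ (add_mem h₁ h₂)))
      have hc : O.valuation (algebraMap k K c) < 1 := by
        have := O.valuation.map_sub_lt hv hv'
        convert this using 2
        ring
      refine ⟨1, one_mem _, r₁ + r₂, add_mem h₁ h₂, map_one _, ?_⟩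
      rw [eq_zero_of_valuation_lt_one hk hc, map_zero]
      ring
  · push Not at hc
    refine mem_valuationSubring_of_forall_not_lt (s := ∅) (by simp) (x := w) ?_ hk hw
      (fun a => not_lt.2 (hc a)) _
    simpa using htop

theorem valuation_lt_one_of_mul {O : ValuationSubring K} {a b : K} (ha : O.valuation a < 1)
    (hb : b ∈ O) : O.valuation (a * b) < 1 := by
  rw [map_mul]
  exact mul_lt_one_of_lt_of_le ha ((O.valuation_le_one_iff _).2 hb)

/-- On the affine elliptic curve `y² = x (x² - e x + 1)`, the derivation dual to the differential
`dx / y` preserves all valuation rings containing `x`. -/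
theorem derivation_mem_of_cubic (h2 : (2 : k) ≠ 0) {e : k} (he : e ^ 2 ≠ 4) {x y : K} (hy : y ≠ 0)
    (hxy : y ^ 2 = x * (x ^ 2 - algebraMap k K e * x + 1))
    (htop : IntermediateField.adjoin k {x, y} = ⊤)
    (D : Derivation k K K) (hD : D x = y) {O : ValuationSubring K}
    (hk : ∀ c : k, algebraMap k K c ∈ O) (hx : x ∈ O) {h : K} (hh : h ∈ O) : D h ∈ O := by
  have h2K : (2 : K) ≠ 0 := by
    have := (algebraMap k K).injective.ne h2
    rwa [map_ofNat, map_zero] at this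
  have hyO : y ∈ O := by
    have : y ^ 2 ∈ O := by
      rw [hxy]
      exact O.mul_mem _ _ hx
        (O.add_mem _ _ (O.sub_mem (pow_mem hx 2) (O.mul_mem _ _ (hk e) hx)) O.one_mem)
    rw [← O.valuation_le_one_iff, map_pow] at this
    exact (O.valuation_le_one_iff _).1 ((pow_le_one_iff two_ne_zero).1 this)
  by_cases hc : ∃ a : k, O.valuation (x - algebraMap k K a) < 1
  · obtain ⟨a, ha⟩ := hc
    set R := Algebra.adjoin k {x, y}
    have hxR : x ∈ R := Algebra.subset_adjoin (by simp)
    have hyR : y ∈ R := Algebra.subset_adjoin (by simp)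
    have hcR : ∀ c : k, algebraMap k K c ∈ R := fun c => Subalgebra.algebraMap_mem _ c
    have hDy : D y = algebraMap k K (1 / 2) *
        (3 * x ^ 2 - 2 * algebraMap k K e * x + 1) := by
      have hd := congrArg D hxy
      simp only [Derivation.leibniz, Derivation.leibniz_pow, map_add, map_sub, hD,
        Derivation.map_algebraMap, Derivation.map_one_eq_zero, smul_eq_mul, nsmul_eq_mul] at hd
      rw [map_div₀, map_one, map_ofNat]
      field_simp
      apply mul_left_cancel₀ hy
      push_cast at hd
      linear_combination hd
    have hDR : ∀ z ∈ ({x, y} : Set K), D z ∈ R := by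
      rintro _ (rfl | rfl)
      · rw [hD]; exact hyR
      · rw [hDy]
        have h3 : (3 : K) = algebraMap k K 3 := by rw [map_ofNat]
        have h2' : (2 : K) = algebraMap k K 2 := by rw [map_ofNat]
        rw [h3, h2']
        exact mul_mem (hcR _) (add_mem (sub_mem (mul_mem (hcR _) (pow_mem hxR 2))
          (mul_mem (mul_mem (hcR _) (hcR _)) hxR)) (one_mem _))
    have hsO : ∀ z ∈ ({x, y} : Set K), z ∈ O := by
      rintro _ (rfl | rfl)
      exacts [hx, hyO]
    have hRO : ∀ r ∈ R, r ∈ O := fun r hr =>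
      Algebra.adjoin_induction (p := fun r _ => r ∈ O) hsO hk
        (fun _ _ _ _ => O.add_mem _ _) (fun _ _ _ _ => O.mul_mem _ _) hr
    -- `(a, b)` is the centre of `O`
    obtain ⟨b₀, hb₀⟩ := IsAlgClosed.exists_pow_nat_eq (a * (a ^ 2 - e * a + 1)) two_pos
    set Q : K := x ^ 2 + algebraMap k K a * x + algebraMap k K (a ^ 2) -
      algebraMap k K e * (x + algebraMap k K a) + 1 with hQ
    have hQR : Q ∈ R := add_mem (sub_mem (add_mem (add_mem (pow_mem hxR 2)
      (mul_mem (hcR _) hxR)) (hcR _)) (mul_mem (hcR _) (add_mem hxR (hcR _)))) (one_mem _)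
    have hfac : ∀ b : k, b ^ 2 = a * (a ^ 2 - e * a + 1) →
        (y - algebraMap k K b) * (y + algebraMap k K b) = (x - algebraMap k K a) * Q := by
      intro b hb
      have hb' := congrArg (algebraMap k K) hb
      simp only [map_mul, map_add, map_sub, map_pow, map_one] at hb'
      rw [hQ, map_pow]
      linear_combination hxy - hb'
    have hb : ∃ b : k, b ^ 2 = a * (a ^ 2 - e * a + 1) ∧
        O.valuation (y - algebraMap k K b) < 1 := by
      have h1 := valuation_lt_one_of_mul ha (hRO _ hQR)
      rw [← hfac b₀ hb₀, map_mul] at h1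
      by_contra! hcon
      have e1 := hcon b₀ hb₀
      have e2 := hcon (-b₀) (by rw [neg_sq, hb₀])
      rw [map_neg, sub_neg_eq_add] at e2
      exact absurd (one_le_mul e1 e2) (not_le.2 h1)
    obtain ⟨b, hb, hvb⟩ := hb
    have hdecomp : ∀ r ∈ R, O.valuation r < 1 → ∃ r₁ ∈ R, ∃ r₂ ∈ R,
        r = (x - algebraMap k K a) * r₁ + (y - algebraMap k K b) * r₂ := by
      intro r hr hv
      obtain ⟨c, r₁, h₁, r₂, h₂, rfl⟩ := exists_eq_add_of_mem_adjoin_pair a b hr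
      refine ⟨r₁, h₁, r₂, h₂, ?_⟩
      have hc : O.valuation (algebraMap k K c) < 1 := by
        have := O.valuation.map_sub_lt (O.valuation.map_sub_lt hv
          (valuation_lt_one_of_mul ha (hRO _ h₁))) (valuation_lt_one_of_mul hvb (hRO _ h₂))
        convert this using 2
        ring
      rw [eq_zero_of_valuation_lt_one hk hc, map_zero, zero_add]
    by_cases hb0 : b = 0
    · -- at a branch point `y` is a local parameter
      subst hb0
      rw [map_zero, sub_zero] at hvb
      refine derivation_mem_of_locally_principal (by simp) htop D hDR hk hsO hyR hvb ?_ hh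
      intro r hr hv
      obtain ⟨r₁, h₁, r₂, h₂, rfl⟩ := hdecomp r hr hv
      refine ⟨Q, hQR, y * r₁ + Q * r₂, add_mem (mul_mem hyR h₁) (mul_mem hQR h₂), ?_, ?_⟩
      · refine le_antisymm ((O.valuation_le_one_iff _).2 (hRO _ hQR)) (not_lt.1 fun hlt => ?_)
        -- the value of `Q` at `x = a` is the derivative of the cubic
        have hQa : O.valuation (algebraMap k K (3 * a ^ 2 - 2 * e * a + 1)) < 1 := by
          have := O.valuation.map_sub_lt hlt (valuation_lt_one_of_mul ha
            (O.add_mem _ _ hx (O.sub_mem (hk (2 * a)) (hk e))))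
          convert this using 2
          simp only [map_mul, map_add, map_sub, map_pow, map_one, map_ofNat, hQ]
          ring
        have hz := eq_zero_of_valuation_lt_one hk hQa
        apply he
        rw [zero_pow two_ne_zero] at hb
        rcases mul_eq_zero.1 hb.symm with h0 | h0
        · exfalso
          simp [h0] at hz
        · -- the two equations force a double root of `a² - e a + 1`
          have hq : 2 * a - e = 0 := by
            have ha0 : a ≠ 0 := by rintro rfl; simp at h0
            apply mul_left_cancel₀ ha0
            linear_combination hz - h0
          linear_combination (-4) * h0 - (e - 2 * a) * hq
      · have := hfac 0 hb
        rw [map_zero, sub_zero, add_zero] at this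
        rw [map_zero, sub_zero]
        linear_combination (-r₁) * this
    · refine derivation_mem_of_locally_principal (by simp) htop D hDR hk hsO
        (sub_mem hxR (hcR a)) ha ?_ hh
      intro r hr hv
      obtain ⟨r₁, h₁, r₂, h₂, rfl⟩ := hdecomp r hr hv
      have hsR : y + algebraMap k K b ∈ R := add_mem hyR (hcR b)
      refine ⟨y + algebraMap k K b, hsR, (y + algebraMap k K b) * r₁ + Q * r₂,
        add_mem (mul_mem hsR h₁) (mul_mem hQR h₂), ?_, ?_⟩
      · refine le_antisymm ((O.valuation_le_one_iff _).2 (hRO _ hsR)) (not_lt.1 fun hlt => ?_)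
        have hbb : O.valuation (algebraMap k K (2 * b)) < 1 := by
          have := O.valuation.map_sub_lt hlt hvb
          convert this using 2
          rw [map_mul, map_ofNat]
          ring
        exact mul_ne_zero h2 hb0 (eq_zero_of_valuation_lt_one hk hbb)
      · linear_combination r₂ * hfac b hb
  · push Not at hc
    refine mem_valuationSubring_of_forall_not_lt (s := {y}) ?_ htop hk hx
      (fun a => not_lt.2 (hc a)) _
    rintro _ rfl
    exact ⟨X * (X ^ 2 - C e * X + 1), by simp [hxy]⟩

end Charts

section Genus

variable {k K : Type*} [Field k] [Field K] [Algebra k K]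

/-- A linear form on the differentials that maps `d O` into `O` maps regular differentials to
elements of `O`. -/
theorem mem_of_mem_regularDifferentials {E : Ω[K⁄k] →ₗ[K] K} {O : ValuationSubring K}
    (hk : ∀ c : k, algebraMap k K c ∈ O) (hE : ∀ h ∈ O, E (KaehlerDifferential.D k K h) ∈ O)
    {ω : Ω[K⁄k]} (hω : ω ∈ regularDifferentials k K) : E ω ∈ O := by
  refine Submodule.span_induction (p := fun ω _ => E ω ∈ O) ?_ ?_ ?_ ?_ (hω O hk)
  · rintro _ ⟨h, hh, rfl⟩
    exact hE h hh
  · rw [map_zero]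
    exact O.zero_mem
  · intro a b _ _ ha hb
    rw [map_add]
    exact O.add_mem _ _ ha hb
  · intro r a _ ha
    have : r • a = (r : K) • a := rfl
    rw [this, map_smul, smul_eq_mul]
    exact O.mul_mem _ _ r.2 ha

/-- A purely transcendental function field of one variable has genus `0`. -/
theorem genus_eq_zero_of_adjoin_singleton [IsAlgClosed k] (h2 : (2 : k) ≠ 0) {w : K}
    (hw : Transcendental k w) (htop : IntermediateField.adjoin k {w} = ⊤) :
    Algebra.trdeg k K = 1 ∧ genus k K = (0 : ℕ) := by
  obtain ⟨htr, E, hE⟩ := trdeg_eq_one_and_exists_kaehlerEquiv h2 hw (s := ∅) (by simp)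
    (by simpa using htop)
  refine ⟨htr, ?_⟩
  have hw0 : w ≠ 0 := fun h => hw (h ▸ isAlgebraic_zero)
  let D : Derivation k K K := E.toLinearMap.compDer (KaehlerDifferential.D k K)
  have hD : ∀ h, D h = E (KaehlerDifferential.D k K h) := fun _ => rfl
  -- near `w = ∞` the derivative with respect to the local parameter `1 / w` is `-w² d/dw`
  have hD' : ((-w ^ 2) • D) w⁻¹ = 1 := by
    rw [Derivation.smul_apply, Derivation.leibniz_inv, hD, hE]
    simp
    field_simp
  have htop' : IntermediateField.adjoin k {w⁻¹} = ⊤ := by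
    rw [eq_top_iff, ← htop, IntermediateField.adjoin_simple_le_iff]
    simpa using inv_mem (IntermediateField.mem_adjoin_simple_self k w⁻¹)
  have hbot : regularDifferentials k K = ⊥ := by
    rw [eq_bot_iff]
    intro ω hω
    have key : ∀ O : ValuationSubring K, (∀ c : k, algebraMap k K c ∈ O) →
        E ω ∈ O ∧ w ^ 2 * E ω ∈ O := by
      intro O hk
      rcases O.mem_or_inv_mem w with hwO | hwO
      · have h : E ω ∈ O := mem_of_mem_regularDifferentials (E := E.toLinearMap) hk
          (fun h hh => derivation_mem_of_line htop D hE hk hwO hh) hω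
        exact ⟨h, O.mul_mem _ _ (pow_mem hwO 2) h⟩
      · have h : -w ^ 2 * E ω ∈ O :=
          mem_of_mem_regularDifferentials (E := (-w ^ 2) • E.toLinearMap) hk
            (fun h hh => derivation_mem_of_line htop' _ hD' hk hwO hh) hω
        have h' : w ^ 2 * E ω ∈ O := by
          have := O.neg_mem _ h
          rwa [neg_mul, neg_neg] at this
        refine ⟨?_, h'⟩
        have := O.mul_mem _ _ (pow_mem hwO 2) h'
        rwa [← mul_assoc, inv_pow, inv_mul_cancel₀ (pow_ne_zero 2 hw0), one_mul] at this
    obtain ⟨c, hc⟩ := mem_range_of_forall_mem_valuationSubring fun O hk => (key O hk).1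
    obtain ⟨c', hc'⟩ := mem_range_of_forall_mem_valuationSubring fun O hk => (key O hk).2
    rw [Submodule.mem_bot, ← E.map_eq_zero_iff, ← hc, map_eq_zero]
    by_contra hc0
    refine hw ⟨C c * X ^ 2 - C c', ?_, ?_⟩
    · intro h
      have := congrArg (fun p => p.coeff 2) h
      simp [hc0] at this
    · rw [map_sub, map_mul, map_pow, aeval_C, aeval_C, aeval_X, hc, hc']
      ring
  rw [genus, hbot]
  simp

/-- At a valuation ring containing `x`, the differential `dx / y` of the elliptic curve
`y² = x (x² - e x + 1)` is a combination of `dx` and `dy` with coefficients in the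
ring, as the cubic has no double root. -/
theorem kaehlerEquiv_symm_inv_mem_span {e : k} (he : e ^ 2 ≠ 4) {x y : K} (hy : y ≠ 0)
    (hxy : y ^ 2 = x * (x ^ 2 - algebraMap k K e * x + 1))
    (E : Ω[K⁄k] ≃ₗ[K] K) {u : K} (hE : E (KaehlerDifferential.D k K x) = u)
    {O : ValuationSubring K} (hk : ∀ c : k, algebraMap k K c ∈ O) (hx : x ∈ O) :
    E.symm (u / y) ∈ Submodule.span O.toSubring (KaehlerDifferential.D k K '' (O : Set K)) := by
  set e' := algebraMap k K e with he'
  have hΔ : algebraMap k K (e ^ 2 - 4) ≠ 0 := by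
    rw [Ne, map_eq_zero, sub_eq_zero]
    exact he
  have hyO : y ∈ O := by
    have : y ^ 2 ∈ O := by
      rw [hxy]
      exact O.mul_mem _ _ hx
        (O.add_mem _ _ (O.sub_mem (pow_mem hx 2) (O.mul_mem _ _ (hk e) hx)) O.one_mem)
    rw [← O.valuation_le_one_iff, map_pow] at this
    exact (O.valuation_le_one_iff _).1 ((pow_le_one_iff two_ne_zero).1 this)
  have hDy : 2 * y * E (KaehlerDifferential.D k K y) = (3 * x ^ 2 - 2 * e' * x + 1) * u := by
    have hd := congrArg (fun z => E (KaehlerDifferential.D k K z)) hxy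
    simp only [Derivation.leibniz, Derivation.leibniz_pow, map_add, map_sub, hE, he',
      Derivation.map_algebraMap, Derivation.map_one_eq_zero, smul_eq_mul, nsmul_eq_mul, map_smul,
      map_nsmul, map_zero] at hd
    push_cast at hd
    linear_combination hd
  -- Bézout coefficients of the cubic and its derivative
  have h2O : (2 : K) ∈ O := ofNat_mem O 2
  have h4O : (4 : K) ∈ O := ofNat_mem O 4
  have hqO : 2 * x - e' ∈ O := O.sub_mem (O.mul_mem _ _ h2O hx) (hk e)
  have hxeO : e' - x ∈ O := O.sub_mem (hk e) hx
  set a := (2 * x - e') ^ 2 - 4 - (e' - x) * (2 * x - e') with ha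
  have haO : a ∈ O :=
    O.sub_mem (O.sub_mem (pow_mem hqO 2) h4O) (O.mul_mem _ _ hxeO hqO)
  have hcubO : x ^ 2 - e' * x + 1 ∈ O :=
    O.add_mem _ _ (O.sub_mem (pow_mem hx 2) (O.mul_mem _ _ (hk e) hx)) O.one_mem
  set b := (e' - x) * (2 * x - e') + a * (x ^ 2 - e' * x + 1) with hb
  have hbO : b ∈ O := O.add_mem _ _ (O.mul_mem _ _ hxeO hqO) (O.mul_mem _ _ haO hcubO)
  set c := a * (e' - x - (2 * x - e')) with hc
  have hcO : c ∈ O := O.mul_mem _ _ haO (O.sub_mem hxeO hqO)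
  have hbez : c * y ^ 2 + b * (3 * x ^ 2 - 2 * e' * x + 1) = e' ^ 2 - 4 := by
    rw [hxy, hc, hb, ha]
    ring
  have hinvO : (algebraMap k K (e ^ 2 - 4))⁻¹ ∈ O := by
    rw [← map_inv₀]
    exact hk _
  have h1 : c * y * (algebraMap k K (e ^ 2 - 4))⁻¹ ∈ O :=
    O.mul_mem _ _ (O.mul_mem _ _ hcO hyO) hinvO
  have h3 : 2 * b * (algebraMap k K (e ^ 2 - 4))⁻¹ ∈ O :=
    O.mul_mem _ _ (O.mul_mem _ _ h2O hbO) hinvO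
  have hω : E.symm (u / y) =
      (⟨_, h1⟩ : O.toSubring) • KaehlerDifferential.D k K x +
        (⟨_, h3⟩ : O.toSubring) • KaehlerDifferential.D k K y := by
    rw [LinearEquiv.symm_apply_eq]
    change _ = E ((c * y * (algebraMap k K (e ^ 2 - 4))⁻¹) • KaehlerDifferential.D k K x +
      (2 * b * (algebraMap k K (e ^ 2 - 4))⁻¹) • KaehlerDifferential.D k K y)
    rw [map_add, map_smul, map_smul, hE, smul_eq_mul, smul_eq_mul]
    field_simp
    rw [map_sub, map_pow, map_ofNat, ← he']
    linear_combination (-u) * hbez - b * hDy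
  rw [hω]
  exact Submodule.add_mem _ (Submodule.smul_mem _ _ (Submodule.subset_span ⟨x, hx, rfl⟩))
    (Submodule.smul_mem _ _ (Submodule.subset_span ⟨y, hyO, rfl⟩))

/-- The function field of the elliptic curve `y² = x (x² - e x + 1)` has genus `1`: its regular
differentials are the constant multiples of `dx / y`. -/
theorem genus_eq_one_of_adjoin_pair [IsAlgClosed k] (h2 : (2 : k) ≠ 0) {e : k} (he : e ^ 2 ≠ 4)
    {x y : K} (hxt : Transcendental k x) (hxy : y ^ 2 = x * (x ^ 2 - algebraMap k K e * x + 1))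
    (htop : IntermediateField.adjoin k {x, y} = ⊤) :
    Algebra.trdeg k K = 1 ∧ genus k K = (1 : ℕ) := by
  have hx0 : x ≠ 0 := fun h => hxt (h ▸ isAlgebraic_zero)
  have hy : y ≠ 0 := by
    rintro rfl
    rw [zero_pow two_ne_zero] at hxy
    refine hxt ⟨X * (X ^ 2 - C e * X + 1), ?_, by simp [← hxy]⟩
    intro h
    have := congrArg (fun p => p.eval 1 - p.eval (-1)) h
    simp at this
    have h3 : (2 : k) * 2 = 0 := by linear_combination this
    exact mul_ne_zero h2 h2 h3
  obtain ⟨htr, E, hE⟩ := trdeg_eq_one_and_exists_kaehlerEquiv h2 hxt (s := {y}) (by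
    intro z hz
    rw [Set.mem_singleton_iff.1 hz]
    exact ⟨hy, X * (X ^ 2 - C e * X + 1), by simp [hxy]⟩) htop
  refine ⟨htr, ?_⟩
  let D : Derivation k K K := y • E.toLinearMap.compDer (KaehlerDifferential.D k K)
  have hD : ∀ h, D h = y * E (KaehlerDifferential.D k K h) := fun _ => rfl
  have hDx : D x = y := by rw [hD, hE, mul_one]
  -- the curve has the same equation in the coordinates `1 / x` and `y / x²`
  have hy' : y / x ^ 2 ≠ 0 := div_ne_zero hy (pow_ne_zero 2 hx0)
  have hxy' : (y / x ^ 2) ^ 2 = x⁻¹ * (x⁻¹ ^ 2 - algebraMap k K e * x⁻¹ + 1) := by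
    rw [div_pow, hxy]
    field_simp
    ring
  have hDx' : (-D) x⁻¹ = y / x ^ 2 := by
    rw [Derivation.neg_apply, Derivation.leibniz_inv, hDx]
    simp
    field_simp
  have htop' : IntermediateField.adjoin k {x⁻¹, y / x ^ 2} = ⊤ := by
    rw [eq_top_iff, ← htop, IntermediateField.adjoin_le_iff]
    have hxm : x ∈ IntermediateField.adjoin k {x⁻¹, y / x ^ 2} := by
      have : x⁻¹ ∈ IntermediateField.adjoin k {x⁻¹, y / x ^ 2} :=
        IntermediateField.subset_adjoin _ _ (by simp)
      simpa using inv_mem this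
    refine Set.insert_subset hxm (Set.singleton_subset_iff.2 ?_)
    · have : y / x ^ 2 ∈ IntermediateField.adjoin k {x⁻¹, y / x ^ 2} :=
        IntermediateField.subset_adjoin _ _ (by simp)
      have := mul_mem this (pow_mem hxm 2)
      rwa [div_mul_cancel₀ _ (pow_ne_zero 2 hx0)] at this
  rw [genus, Nat.cast_one, rank_submodule_eq_one_iff]
  refine ⟨E.symm y⁻¹, fun O hk => ?_, ?_, fun ω hω => ?_⟩
  · rcases O.mem_or_inv_mem x with hx | hx
    · have := kaehlerEquiv_symm_inv_mem_span he hy hxy E hE hk hx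
      rwa [one_div] at this
    · have hE' : E (KaehlerDifferential.D k K x⁻¹) = -(x⁻¹ ^ 2) := by
        rw [Derivation.leibniz_inv, map_smul, hE, smul_eq_mul, mul_one]
      have := kaehlerEquiv_symm_inv_mem_span he hy' hxy' E hE' hk hx
      have e : -(x⁻¹ ^ 2) / (y / x ^ 2) = -y⁻¹ := by field_simp
      rw [e, map_neg] at this
      simpa using Submodule.neg_mem _ this
  · rw [Ne, E.symm.map_eq_zero_iff]
    exact inv_ne_zero hy
  · have key : ∀ O : ValuationSubring K, (∀ c : k, algebraMap k K c ∈ O) → y * E ω ∈ O := by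
      intro O hk
      refine mem_of_mem_regularDifferentials (E := y • E.toLinearMap) hk (fun h hh => ?_) hω
      rcases O.mem_or_inv_mem x with hx | hx
      · exact derivation_mem_of_cubic h2 he hy hxy htop D hDx hk hx hh
      · have := derivation_mem_of_cubic h2 he hy' hxy' htop' (-D) hDx' hk hx hh
        have := O.neg_mem _ this
        rwa [Derivation.neg_apply, neg_neg] at this
    obtain ⟨c, hc⟩ := mem_range_of_forall_mem_valuationSubring key
    refine Submodule.mem_span_singleton.2 ⟨c, ?_⟩
    apply E.injective
    rw [← algebraMap_smul K c, map_smul, E.apply_symm_apply, hc, smul_eq_mul]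
    field_simp

end Genus

end FunctionField

noncomputable section

open MvPolynomial

/-! ### Zariski closure -/

section Closure

variable {k : Type*} [Field k] {l₁ l₂ : k}

theorem isCoord_scale {v : Fin 6 → k} (hv : IsCoord l₁ l₂ v) (a b c : kˣ) :
    IsCoord l₁ l₂ (scale a b c v) where
  left h := by
    refine hv.left (funext fun n => ?_)
    have := congrFun h n
    fin_cases n <;> simpa [scale] using this
  right h := by
    refine hv.right (funext fun n => ?_)
    have := congrFun h n
    fin_cases n <;> simpa [scale] using this
  fibre h := by
    refine hv.fibre (funext fun n => ?_)
    have := congrFun h n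
    fin_cases n <;> simpa [scale] using this
  eq := by
    have := hv.eq
    simp only [scale, Matrix.cons_val, quartic_mul]
    linear_combination (a * b : k) ^ 4 * c ^ 2 * this

theorem mk_scale {v : Fin 6 → k} (hv : IsCoord l₁ l₂ v) (a b c : kˣ) :
    KummerSurface.mk _ (isCoord_scale hv a b c) = KummerSurface.mk v hv :=
  (Quotient.sound (s := coordSetoid l₁ l₂) ⟨a, b, c, rfl⟩).symm

/-- The polynomial map given by the action of an element of the torus. -/
def scaleHom (a b c : kˣ) : MvPolynomial (Fin 6) k →ₐ[k] MvPolynomial (Fin 6) k :=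
  aeval ![C (a : k) * X 0, C (a : k) * X 1, C (b : k) * X 2, C (b : k) * X 3,
    C ((b : k) ^ 2 * c) * X 4, C ((a : k) ^ 2 * c) * X 5]

theorem eval_scaleHom (a b c : kˣ) (v : Fin 6 → k) (f : MvPolynomial (Fin 6) k) :
    eval v (scaleHom a b c f) = eval (scale a b c v) f := by
  change (aeval v) (aeval _ f) = aeval _ f
  rw [← AlgHom.comp_apply]
  congr 1
  ext i
  fin_cases i <;> simp [scale]

/-- The closure of `Z` was defined by the existence of one vector of homogeneous coordinates at
which the ideal of `Z` vanishes; as the ideal is stable under the torus, it then vanishes at all of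
them. -/
theorem eval_eq_zero_of_mk_mem_zariskiClosure {Z : Set (KummerSurface l₁ l₂)} {v : Fin 6 → k}
    {hv : IsCoord l₁ l₂ v} (h : KummerSurface.mk v hv ∈ zariskiClosure Z)
    {f : MvPolynomial (Fin 6) k} (hf : f ∈ idealOf Z) : eval v f = 0 := by
  obtain ⟨w, hw, e, hw0⟩ := h
  obtain ⟨a, b, c, e⟩ := Quotient.exact e
  rw [show v = scale a b c w from e, ← eval_scaleHom]
  refine hw0 _ ?_
  rintro u ⟨hu, hmem⟩
  change eval u _ = 0
  rw [eval_scaleHom]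
  exact hf _ ⟨isCoord_scale hu a b c, by rwa [mk_scale]⟩

theorem subset_zariskiClosure (Z : Set (KummerSurface l₁ l₂)) : Z ⊆ zariskiClosure Z := by
  intro x hx
  induction x using Quotient.inductionOn with
  | h v => exact ⟨v.1, v.2, rfl, fun f hf => hf _ ⟨v.2, hx⟩⟩

theorem idealOf_zariskiClosure (Z : Set (KummerSurface l₁ l₂)) :
    idealOf (zariskiClosure Z) = idealOf Z := by
  refine le_antisymm (vanishingIdeal_anti_mono ?_) ?_
  · rintro v ⟨hv, h⟩
    exact ⟨hv, subset_zariskiClosure Z h⟩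
  · rintro f hf v ⟨hv, h⟩
    exact eval_eq_zero_of_mk_mem_zariskiClosure h hf

theorem zariskiClosure_zariskiClosure (Z : Set (KummerSurface l₁ l₂)) :
    zariskiClosure (zariskiClosure Z) = zariskiClosure Z := by
  change {x | ∃ (v : Fin 6 → k) (hv : IsCoord l₁ l₂ v), KummerSurface.mk v hv = x ∧
    v ∈ zeroLocus k (idealOf (zariskiClosure Z))} = _
  rw [idealOf_zariskiClosure]
  rfl

end Closure

/-! ### Parametrization -/

section Param

variable {k : Type*} [Field k]

/-- The linear map with matrix `M`, on vectors with entries in a `k`-algebra. -/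
def lin (M : Matrix (Fin 2) (Fin 2) k) {S : Type*} [CommRing S] [Algebra k S] (u : Fin 2 → S) :
    Fin 2 → S :=
  fun i => algebraMap k S (M i 0) * u 0 + algebraMap k S (M i 1) * u 1

theorem lin_lin {M N : Matrix (Fin 2) (Fin 2) k} (h : N * M = 1) {S : Type*} [CommRing S]
    [Algebra k S] (u : Fin 2 → S) : lin N (lin M u) = u := by
  have h' : ∀ i j, algebraMap k S (N i 0) * algebraMap k S (M 0 j) +
      algebraMap k S (N i 1) * algebraMap k S (M 1 j) =
        algebraMap k S ((1 : Matrix (Fin 2) (Fin 2) k) i j) := fun i j => by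
    rw [← h, Matrix.mul_apply, Fin.sum_univ_two]
    simp
  ext i
  fin_cases i
  · have h0 := h' 0 0
    have h1 := h' 0 1
    simp [lin] at h0 h1 ⊢
    linear_combination u 0 * h0 + u 1 * h1
  · have h0 := h' 1 0
    have h1 := h' 1 1
    simp [lin] at h0 h1 ⊢
    linear_combination u 0 * h0 + u 1 * h1

theorem lin_smul (M : Matrix (Fin 2) (Fin 2) k) {S : Type*} [CommRing S] [Algebra k S] (c : S)
    (u : Fin 2 → S) : lin M (c • u) = c • lin M u := by
  ext i
  simp [lin]
  ring

theorem lin_ne_zero {M N : Matrix (Fin 2) (Fin 2) k} (h : N * M = 1) {u : Fin 2 → k}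
    (hu : u ≠ 0) : lin M u ≠ 0 := by
  intro h0
  apply hu
  rw [← lin_lin h u, h0]
  ext i
  simp [lin]

theorem map_lin (M : Matrix (Fin 2) (Fin 2) k) {S T : Type*} [CommRing S] [Algebra k S]
    [CommRing T] [Algebra k T] (φ : S →ₐ[k] T) (u : Fin 2 → S) (i : Fin 2) :
    φ (lin M u i) = lin M (fun j => φ (u j)) i := by
  simp [lin]

theorem exists_smul_of_cross {u v : Fin 2 → k} (hu : u ≠ 0) (h : u 0 * v 1 = u 1 * v 0) :
    ∃ c : k, v = c • u := by
  by_cases h0 : u 0 = 0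
  · have h1 : u 1 ≠ 0 := fun h1 => hu (by ext i; fin_cases i <;> simp [h0, h1])
    refine ⟨v 1 / u 1, ?_⟩
    rw [h0, zero_mul] at h
    ext i
    fin_cases i
    · simp [h0, (mul_eq_zero.1 h.symm).resolve_left h1]
    · simp [h1]
  · refine ⟨v 0 / u 0, ?_⟩
    ext i
    fin_cases i
    · simp [h0]
    · simp only [Fin.mk_one, Pi.smul_apply, smul_eq_mul]
      field_simp
      linear_combination h

/-- The polynomial `A(u₀, u₁) T² - B(u₀, u₁) s²` in the five variables `s, u₀, u₁, T, b`, in this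
order. -/
def curvePoly (A B : MvPolynomial (Fin 2) k) : MvPolynomial (Fin 5) k :=
  rename ![1, 2] A * X 3 ^ 2 - rename ![1, 2] B * X 0 ^ 2

/-- A parametrization of a nondegenerate curve `L` of bidegree `(1, 1)` by the projective line, with
coordinates `u` such that `(x₁, z₁) = M₁ u` and `(x₂, z₂) = M₂ u`.  The two quartic forms become
`G A` and `G B`, where `G` is the form that vanishes at the points `R i j` of `L`.  The remaining
factors `A` and `B` have only simple zeros, and no common ones. -/
structure LineParam (l₁ l₂ : k) (L : Set (ℙ k (Fin 2 → k) × ℙ k (Fin 2 → k))) where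
  (M₁ M₂ N₁ N₂ : Matrix (Fin 2) (Fin 2) k)
  (A B : MvPolynomial (Fin 2) k)
  (G : (Fin 2 → k) → k)
  inv₁ : N₁ * M₁ = 1
  inv₂ : N₂ * M₂ = 1
  mem_iff : ∀ (u v : Fin 2 → k) (hu : u ≠ 0) (hv : v ≠ 0),
    (Projectivization.mk k u hu, Projectivization.mk k v hv) ∈ L ↔
      lin N₁ u 0 * lin N₂ v 1 = lin N₁ u 1 * lin N₂ v 0
  quartic₁ : ∀ u, quartic l₁ (lin M₁ u 0) (lin M₁ u 1) = G u * eval u A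
  quartic₂ : ∀ u, quartic l₂ (lin M₂ u 0) (lin M₂ u 1) = G u * eval u B
  coprime : ∀ u, eval u A = 0 → eval u B = 0 → u = 0
  simple₁ : ∀ u, u ≠ 0 → eval u A = 0 → ∃ i, eval u (pderiv i A) ≠ 0
  simple₂ : ∀ u, u ≠ 0 → eval u B = 0 → ∃ i, eval u (pderiv i B) ≠ 0
  prime : Prime (curvePoly A B)

/-- The five parameters `s, u₀, u₁, T, b` give the point with coordinates
`(x₁, z₁) = M₁ u`, `(x₂, z₂) = b M₂ u`, `(t, s) = (b² T, s)`. -/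
def paramMap (M₁ M₂ : Matrix (Fin 2) (Fin 2) k) {S : Type*} [CommRing S] [Algebra k S]
    (w : Fin 5 → S) : Fin 6 → S :=
  ![lin M₁ ![w 1, w 2] 0, lin M₁ ![w 1, w 2] 1, w 4 * lin M₂ ![w 1, w 2] 0,
    w 4 * lin M₂ ![w 1, w 2] 1, w 4 ^ 2 * w 3, w 0]

/-- The homomorphism of polynomial rings given by `paramMap`. -/
def paramHom (M₁ M₂ : Matrix (Fin 2) (Fin 2) k) :
    MvPolynomial (Fin 6) k →ₐ[k] MvPolynomial (Fin 5) k :=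
  aeval (paramMap M₁ M₂ X)

theorem eval_paramHom (M₁ M₂ : Matrix (Fin 2) (Fin 2) k) (w : Fin 5 → k)
    (f : MvPolynomial (Fin 6) k) :
    eval w (paramHom M₁ M₂ f) = eval (paramMap M₁ M₂ w) f := by
  change (aeval w) (aeval _ f) = aeval _ f
  rw [← AlgHom.comp_apply]
  congr 1
  ext i
  fin_cases i <;> simp [paramMap, lin]

theorem eval_curvePoly (A B : MvPolynomial (Fin 2) k) (w : Fin 5 → k) :
    eval w (curvePoly A B) =
      eval ![w 1, w 2] A * w 3 ^ 2 - eval ![w 1, w 2] B * w 0 ^ 2 := by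
  have : w ∘ ![1, 2] = ![w 1, w 2] := by
    ext i; fin_cases i <;> rfl
  simp [curvePoly, eval_rename, this]

end Param

/-! ### The ideal of the strict transform -/

namespace LineParam

variable {k : Type*} [Field k] {l₁ l₂ : k} {L : Set (ℙ k (Fin 2 → k) × ℙ k (Fin 2 → k))}
  (d : LineParam l₁ l₂ L)

/-- Every point of the Kummer surface over `L` is given by some values of the parameters. -/
theorem exists_paramMap_eq {v : Fin 6 → k} (hv : IsCoord l₁ l₂ v)
    (h : lin d.N₁ ![v 0, v 1] 0 * lin d.N₂ ![v 2, v 3] 1 =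
      lin d.N₁ ![v 0, v 1] 1 * lin d.N₂ ![v 2, v 3] 0) :
    ∃ w : Fin 5 → k, paramMap d.M₁ d.M₂ w = v ∧ ![w 1, w 2] ≠ 0 ∧ w 4 ≠ 0 ∧ ![w 3, w 0] ≠ 0 := by
  have i₁ : d.M₁ * d.N₁ = 1 := mul_eq_one_comm.1 d.inv₁
  have i₂ : d.M₂ * d.N₂ = 1 := mul_eq_one_comm.1 d.inv₂
  set u := lin d.N₁ ![v 0, v 1]
  have hu0 : u ≠ 0 := lin_ne_zero i₁ hv.left
  have hu' : lin d.N₂ ![v 2, v 3] ≠ 0 := lin_ne_zero i₂ hv.right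
  obtain ⟨b, hb⟩ := exists_smul_of_cross hu0 h
  have hb0 : b ≠ 0 := by
    rintro rfl
    exact hu' (by rw [hb, zero_smul])
  have e₁ : lin d.M₁ u = ![v 0, v 1] := lin_lin i₁ _
  have e₂ : b • lin d.M₂ u = ![v 2, v 3] := by
    rw [← lin_smul, ← hb, lin_lin i₂]
  have eu : ![u 0, u 1] = u := by ext i; fin_cases i <;> rfl
  refine ⟨![v 5, u 0, u 1, v 4 / b ^ 2, b], ?_, ?_, hb0, ?_⟩
  · ext i
    fin_cases i
    · simpa [paramMap, eu] using congrFun e₁ 0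
    · simpa [paramMap, eu] using congrFun e₁ 1
    · simpa [paramMap, eu] using congrFun e₂ 0
    · simpa [paramMap, eu] using congrFun e₂ 1
    · simp [paramMap]
      field_simp
    · simp [paramMap]
  · simpa [eu] using hu0
  · intro h0
    refine hv.fibre (funext fun i => ?_)
    have := congrFun h0 i
    fin_cases i
    · simpa [hb0] using this
    · simpa using this

end LineParam

theorem mk_mem_range_R {k : Type*} [Field k] {l₁ l₂ : k} {u v : Fin 2 → k} (hu : u ≠ 0)
    (hv : v ≠ 0) :
    (Projectivization.mk k u hu, Projectivization.mk k v hv) ∈ Set.range (R l₁ l₂) ↔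
      quartic l₁ (u 0) (u 1) = 0 ∧ quartic l₂ (v 0) (v 1) = 0 := by
  rw [← mk_mem_range_branchPoint l₁ u hu, ← mk_mem_range_branchPoint l₂ v hv]
  constructor
  · rintro ⟨⟨i, j⟩, h⟩
    exact ⟨⟨i, congrArg Prod.fst h⟩, ⟨j, congrArg Prod.snd h⟩⟩
  · rintro ⟨⟨i, hi⟩, ⟨j, hj⟩⟩
    exact ⟨(i, j), Prod.ext hi hj⟩

theorem vec_eta {k : Type*} (u : Fin 2 → k) : ![u 0, u 1] = u := by
  ext i; fin_cases i <;> rfl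

namespace LineParam

variable {k : Type*} [Field k] {l₁ l₂ : k} {L : Set (ℙ k (Fin 2 → k) × ℙ k (Fin 2 → k))}
  (d : LineParam l₁ l₂ L)

theorem mk_mem_preimage_iff {v : Fin 6 → k} (hv : IsCoord l₁ l₂ v) :
    KummerSurface.mk v hv ∈ doubleCover l₁ l₂ ⁻¹' (L \ Set.range (R l₁ l₂)) ↔
      lin d.N₁ ![v 0, v 1] 0 * lin d.N₂ ![v 2, v 3] 1 =
        lin d.N₁ ![v 0, v 1] 1 * lin d.N₂ ![v 2, v 3] 0 ∧
      ¬ (quartic l₁ (v 0) (v 1) = 0 ∧ quartic l₂ (v 2) (v 3) = 0) := by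
  change (Projectivization.mk k ![v 0, v 1] hv.left,
      Projectivization.mk k ![v 2, v 3] hv.right) ∈ L ∧
    ¬ (Projectivization.mk k ![v 0, v 1] hv.left, Projectivization.mk k ![v 2, v 3] hv.right) ∈
      Set.range (R l₁ l₂) ↔ _
  rw [d.mem_iff, mk_mem_range_R]
  rfl

theorem quartic_mul_eq (w : Fin 5 → k) :
    quartic l₁ (paramMap d.M₁ d.M₂ w 0) (paramMap d.M₁ d.M₂ w 1) * paramMap d.M₁ d.M₂ w 4 ^ 2 -
      quartic l₂ (paramMap d.M₁ d.M₂ w 2) (paramMap d.M₁ d.M₂ w 3) * paramMap d.M₁ d.M₂ w 5 ^ 2 =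
      d.G ![w 1, w 2] * w 4 ^ 4 * eval w (curvePoly d.A d.B) := by
  rw [eval_curvePoly]
  simp only [paramMap, Matrix.cons_val, quartic_mul]
  rw [d.quartic₁, d.quartic₂]
  ring

theorem lin_paramMap₁ {S : Type*} [CommRing S] [Algebra k S] (w : Fin 5 → S) :
    lin d.N₁ ![paramMap d.M₁ d.M₂ w 0, paramMap d.M₁ d.M₂ w 1] = ![w 1, w 2] := by
  have : ![paramMap d.M₁ d.M₂ w 0, paramMap d.M₁ d.M₂ w 1] = lin d.M₁ ![w 1, w 2] := by
    ext i; fin_cases i <;> rfl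
  rw [this, lin_lin d.inv₁]

theorem lin_paramMap₂ {S : Type*} [CommRing S] [Algebra k S] (w : Fin 5 → S) :
    lin d.N₂ ![paramMap d.M₁ d.M₂ w 2, paramMap d.M₁ d.M₂ w 3] = w 4 • ![w 1, w 2] := by
  have : ![paramMap d.M₁ d.M₂ w 2, paramMap d.M₁ d.M₂ w 3] = w 4 • lin d.M₂ ![w 1, w 2] := by
    ext i; fin_cases i <;> rfl
  rw [this, lin_smul, lin_lin d.inv₂]

/-- The points of the open part of the strict transform come from the surface
`A(u) T² = B(u) s²` of parameters. -/
theorem exists_of_mem_cone {v : Fin 6 → k}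
    (hv : v ∈ cone (doubleCover l₁ l₂ ⁻¹' (L \ Set.range (R l₁ l₂)))) :
    ∃ w, paramMap d.M₁ d.M₂ w = v ∧ eval w (curvePoly d.A d.B) = 0 := by
  obtain ⟨hv, h⟩ := hv
  rw [d.mk_mem_preimage_iff] at h
  obtain ⟨hcross, hR⟩ := h
  obtain ⟨w, rfl, -, hb, -⟩ := d.exists_paramMap_eq hv hcross
  refine ⟨w, rfl, ?_⟩
  have e := d.quartic_mul_eq w
  rw [hv.eq, sub_self] at e
  refine (mul_eq_zero.1 e.symm).resolve_left (mul_ne_zero (fun hG => hR ?_) (pow_ne_zero 4 hb))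
  simp only [paramMap, Matrix.cons_val, quartic_mul]
  rw [d.quartic₁, d.quartic₂, hG]
  simp

theorem paramMap_mem_cone {w : Fin 5 → k} (hh : eval w (curvePoly d.A d.B) = 0)
    (hb : w 4 ≠ 0) (hs : w 0 ≠ 0)
    (hq : quartic l₁ (paramMap d.M₁ d.M₂ w 0) (paramMap d.M₁ d.M₂ w 1) ≠ 0) :
    paramMap d.M₁ d.M₂ w ∈ cone (doubleCover l₁ l₂ ⁻¹' (L \ Set.range (R l₁ l₂))) := by
  have hu : ![w 1, w 2] ≠ 0 := by
    intro h
    apply hq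
    change quartic l₁ (lin d.M₁ ![w 1, w 2] 0) (lin d.M₁ ![w 1, w 2] 1) = 0
    rw [h]
    simp [lin, quartic]
  have hv : IsCoord l₁ l₂ (paramMap d.M₁ d.M₂ w) := by
    refine ⟨?_, ?_, ?_, ?_⟩
    · intro h
      apply hu
      rw [← d.lin_paramMap₁, h]
      ext i
      simp [lin]
    · intro h
      apply smul_ne_zero hb hu
      rw [← d.lin_paramMap₂, h]
      ext i
      simp [lin]
    · intro h
      exact hs (congrFun h 1)
    · rw [← sub_eq_zero, d.quartic_mul_eq, hh, mul_zero]
  refine ⟨hv, (d.mk_mem_preimage_iff hv).2 ⟨?_, fun h => hq h.1⟩⟩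
  rw [d.lin_paramMap₁, d.lin_paramMap₂]
  simp
  ring

/-- Some point of the surface of parameters lies outside of all the loci that are left out. -/
theorem exists_generic [IsAlgClosed k] : ∃ w : Fin 5 → k,
    eval w (curvePoly d.A d.B) = 0 ∧ w 4 ≠ 0 ∧ w 0 ≠ 0 ∧
      quartic l₁ (paramMap d.M₁ d.M₂ w 0) (paramMap d.M₁ d.M₂ w 1) ≠ 0 := by
  classical
  have : Infinite k := IsAlgClosed.instInfinite
  obtain ⟨x, hx⟩ := Infinite.exists_notMem_finset ({0, 1, l₁} : Finset k)
  simp only [Finset.mem_insert, Finset.mem_singleton, not_or] at hx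
  have i₁ : d.M₁ * d.N₁ = 1 := mul_eq_one_comm.1 d.inv₁
  have hq : quartic l₁ x 1 ≠ 0 := by
    rw [Ne, quartic_eq_zero_iff]
    simp [hx]
  set u := lin d.N₁ ![x, 1]
  have e : lin d.M₁ u = ![x, 1] := lin_lin i₁ _
  have hA : eval u d.A ≠ 0 := by
    intro h
    have := d.quartic₁ u
    rw [e, h, mul_zero] at this
    exact hq this
  obtain ⟨T, hT⟩ := IsAlgClosed.exists_pow_nat_eq (eval u d.B / eval u d.A) two_pos
  refine ⟨![1, u 0, u 1, T, 1], ?_, ?_, ?_, ?_⟩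
  · rw [eval_curvePoly]
    simp [vec_eta, hT]
    field_simp
    ring
  · simp
  · simp
  · simpa [paramMap, vec_eta, e] using hq

/-- The strict transform is the image of the surface of parameters `A(u) T² = B(u) s²`: its ideal is
the preimage of the ideal of that surface. -/
theorem mem_idealOf_iff [IsAlgClosed k] {f : MvPolynomial (Fin 6) k} :
    f ∈ idealOf (doubleCover l₁ l₂ ⁻¹' (L \ Set.range (R l₁ l₂))) ↔
      curvePoly d.A d.B ∣ paramHom d.M₁ d.M₂ f := by
  constructor
  · intro hf
    have hp : (Ideal.span {curvePoly d.A d.B}).IsPrime :=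
      (Ideal.span_singleton_prime d.prime.ne_zero).2 d.prime
    set g : MvPolynomial (Fin 5) k := X 0 * X 4 *
      paramHom d.M₁ d.M₂ (X 0 * X 1 * (X 0 - X 1) * (X 0 - C l₁ * X 1)) with hg
    have hgw : ∀ w, eval w g = w 0 * w 4 *
        quartic l₁ (paramMap d.M₁ d.M₂ w 0) (paramMap d.M₁ d.M₂ w 1) := by
      intro w
      rw [hg, map_mul, eval_paramHom]
      simp [quartic]
    have hmem : g * paramHom d.M₁ d.M₂ f ∈ Ideal.span {curvePoly d.A d.B} := by
      rw [← MvPolynomial.IsPrime.vanishingIdeal_zeroLocus (K := k)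
        (Ideal.span {curvePoly d.A d.B})]
      intro w hw
      change eval w _ = 0
      rw [map_mul]
      by_cases h0 : eval w g = 0
      · rw [h0, zero_mul]
      · have hw' : eval w (curvePoly d.A d.B) = 0 :=
          hw _ (Ideal.mem_span_singleton_self _)
        rw [hgw, mul_eq_zero, mul_eq_zero, not_or, not_or] at h0
        rw [eval_paramHom]
        have := hf _ (d.paramMap_mem_cone hw' h0.1.2 h0.1.1 h0.2)
        rw [show eval (paramMap d.M₁ d.M₂ w) f = 0 from this, mul_zero]
    rw [Ideal.mem_span_singleton] at hmem
    refine (d.prime.dvd_or_dvd hmem).resolve_left ?_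
    rintro ⟨q, hq⟩
    obtain ⟨w, hw, h4, h0, hQ⟩ := d.exists_generic
    have := hgw w
    rw [hq, map_mul, hw, zero_mul] at this
    exact mul_ne_zero (mul_ne_zero h0 h4) hQ this.symm
  · rintro ⟨q, hq⟩ v hv
    obtain ⟨w, rfl, hw⟩ := d.exists_of_mem_cone hv
    change eval _ f = 0
    rw [← eval_paramHom, hq, map_mul, hw, zero_mul]

theorem isPrime_idealOf [IsAlgClosed k] (d : LineParam l₁ l₂ L) :
    (idealOf (doubleCover l₁ l₂ ⁻¹' (L \ Set.range (R l₁ l₂)))).IsPrime := by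
  have hp : (Ideal.span {curvePoly d.A d.B}).IsPrime :=
    (Ideal.span_singleton_prime d.prime.ne_zero).2 d.prime
  have : idealOf (doubleCover l₁ l₂ ⁻¹' (L \ Set.range (R l₁ l₂))) =
      (Ideal.span {curvePoly d.A d.B}).comap (paramHom d.M₁ d.M₂) := by
    ext f
    rw [d.mem_idealOf_iff, Ideal.mem_comap, Ideal.mem_span_singleton]
  rw [this]
  exact Ideal.IsPrime.comap _

end LineParam

/-! ### Nonsingularity of the strict transform -/

theorem pderiv_aeval {σ τ R : Type*} [Fintype σ] [CommRing R]
    (g : σ → MvPolynomial τ R) (j : τ) (f : MvPolynomial σ R) :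
    pderiv j (aeval g f) = ∑ i, aeval g (pderiv i f) * pderiv j (g i) := by
  classical
  induction f using MvPolynomial.induction_on with
  | C a => simp [algebraMap_eq]
  | add p q hp hq =>
    rw [map_add, map_add, hp, hq, ← Finset.sum_add_distrib]
    exact Finset.sum_congr rfl fun i _ => by rw [map_add, map_add, add_mul]
  | mul_X p i hp =>
    have h : ∀ x, aeval g (pderiv x (p * X i)) * pderiv j (g x) =
        aeval g p * (aeval g (pderiv x (X i)) * pderiv j (g x)) +
          g i * (aeval g (pderiv x p) * pderiv j (g x)) := fun x => by
      rw [Derivation.leibniz, smul_eq_mul, smul_eq_mul, map_add, map_mul, map_mul, aeval_X]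
      ring
    rw [Finset.sum_congr rfl fun x _ => h x, Finset.sum_add_distrib, ← Finset.mul_sum,
      ← Finset.mul_sum, ← hp, map_mul, aeval_X, Derivation.leibniz, smul_eq_mul, smul_eq_mul,
      Finset.sum_eq_single i]
    · rw [pderiv_X_self, map_one, one_mul]
    · intro x _ hx
      rw [pderiv_X_of_ne hx.symm, map_zero, zero_mul]
    · exact fun h => absurd (Finset.mem_univ i) h

theorem rename_eq_aeval_X {σ τ R : Type*} [CommRing R] (g : σ → τ) :
    (rename g : MvPolynomial σ R →ₐ[R] MvPolynomial τ R) = aeval fun i => X (g i) :=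
  algHom_ext fun i => by rw [rename_X, aeval_X]

theorem pderiv_rename_eq {σ τ R : Type*} [Fintype σ] [CommRing R]
    (g : σ → τ) (j : τ) (f : MvPolynomial σ R) :
    pderiv j (rename g f) = ∑ i, rename g (pderiv i f) * pderiv j (X (g i)) := by
  rw [rename_eq_aeval_X]
  exact pderiv_aeval (fun i => X (g i)) j f

/-- If a linear map `φ` takes `V` into a line, takes a vector of `V` to a nonzero element of the
line, and its kernel is a line contained in `V`, then `V` has dimension two. -/
theorem finrank_eq_two_of_map {k E F : Type*} [Field k] [AddCommGroup E] [Module k E]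
    [AddCommGroup F] [Module k F] (φ : E →ₗ[k] F) (V : Submodule k E) {g₁ g₂ : E} {n : F} {c : k}
    (h₁ : g₁ ∈ V) (h₂ : g₂ ∈ V) (hg₁ : g₁ ≠ 0) (hφ₁ : φ g₁ = 0) (hφ₂ : φ g₂ = c • n) (hc : c ≠ 0)
    (hn : n ≠ 0) (hV : ∀ g ∈ V, ∃ t : k, φ g = t • n) (hker : ∀ g, φ g = 0 → ∃ t : k, g = t • g₁) :
    Module.finrank k V = 2 := by
  have hli : LinearIndependent k ![g₁, g₂] := by
    rw [LinearIndependent.pair_iff]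
    intro s t hst
    have ht : t = 0 := by
      have := congrArg φ hst
      rw [map_add, map_smul, map_smul, hφ₁, smul_zero, zero_add, hφ₂, map_zero, smul_smul] at this
      exact ((mul_eq_zero.1 ((smul_eq_zero.1 this).resolve_right hn))).resolve_right hc
    rw [ht, zero_smul, add_zero] at hst
    exact ⟨(smul_eq_zero.1 hst).resolve_right hg₁, ht⟩
  have hspan : V = Submodule.span k (Set.range ![g₁, g₂]) := by
    refine le_antisymm (fun g hg => ?_) (Submodule.span_le.2 ?_)
    · obtain ⟨t, ht⟩ := hV g hg
      obtain ⟨r, hr⟩ := hker (g - (t / c) • g₂) (by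
        rw [map_sub, map_smul, hφ₂, ht, smul_smul, div_mul_cancel₀ _ hc, sub_self])
      have : g = r • g₁ + (t / c) • g₂ := by rw [← hr, sub_add_cancel]
      rw [this]
      exact Submodule.add_mem _ (Submodule.smul_mem _ _ (Submodule.subset_span ⟨0, rfl⟩))
        (Submodule.smul_mem _ _ (Submodule.subset_span ⟨1, rfl⟩))
    · rintro _ ⟨i, rfl⟩
      fin_cases i
      · exact h₁
      · exact h₂
  rw [hspan, finrank_span_eq_card hli, Fintype.card_fin]

namespace LineParam

variable {k : Type*} [Field k] {l₁ l₂ : k} {L : Set (ℙ k (Fin 2 → k) × ℙ k (Fin 2 → k))}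
  (d : LineParam l₁ l₂ L)

/-- The equation of `L` as a polynomial in the homogeneous coordinates. -/
def linePoly : MvPolynomial (Fin 6) k :=
  lin d.N₁ ![X 0, X 1] 0 * lin d.N₂ ![X 2, X 3] 1 -
    lin d.N₁ ![X 0, X 1] 1 * lin d.N₂ ![X 2, X 3] 0

/-- The equation `A(u) t² b⁻⁴ = B(u) s²` of the strict transform, multiplied by `(b uᵢ)⁴`. -/
def transformPoly (i : Fin 2) : MvPolynomial (Fin 6) k :=
  aeval (lin d.N₁ ![X 0, X 1]) d.A * X 4 ^ 2 * lin d.N₁ ![X 0, X 1] i ^ 4 -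
    aeval (lin d.N₁ ![X 0, X 1]) d.B * X 5 ^ 2 * lin d.N₂ ![X 2, X 3] i ^ 4

theorem paramHom_lin₁ :
    (fun i => paramHom d.M₁ d.M₂ (lin d.N₁ ![X 0, X 1] i)) = ![X 1, X 2] := by
  rw [← d.lin_paramMap₁ (S := MvPolynomial (Fin 5) k) X]
  ext1 i
  rw [map_lin]
  congr 1
  ext1 j
  fin_cases j <;> simp [paramHom]

theorem paramHom_lin₂ :
    (fun i => paramHom d.M₁ d.M₂ (lin d.N₂ ![X 2, X 3] i)) =
      (X 4 : MvPolynomial (Fin 5) k) • ![X 1, X 2] := by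
  rw [← d.lin_paramMap₂ (S := MvPolynomial (Fin 5) k) X]
  ext1 i
  rw [map_lin]
  congr 1
  ext1 j
  fin_cases j <;> simp [paramHom]

theorem paramHom_linePoly : paramHom d.M₁ d.M₂ d.linePoly = 0 := by
  have h₁ := congrFun d.paramHom_lin₁
  have h₂ := congrFun d.paramHom_lin₂
  rw [linePoly, map_sub, map_mul, map_mul, h₁, h₁, h₂, h₂]
  simp
  ring

theorem paramHom_transformPoly (i : Fin 2) : paramHom d.M₁ d.M₂ (d.transformPoly i) =
    curvePoly d.A d.B * (X 4 ^ 4 * (![X 1, X 2] : Fin 2 → MvPolynomial (Fin 5) k) i ^ 4) := by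
  have h₁ := congrFun d.paramHom_lin₁ i
  have h₂ := congrFun d.paramHom_lin₂ i
  have hA : ∀ A : MvPolynomial (Fin 2) k,
      paramHom d.M₁ d.M₂ (aeval (lin d.N₁ ![X 0, X 1]) A) = rename ![1, 2] A := by
    intro A
    have e : rename ![1, 2] A = aeval (![X 1, X 2] : Fin 2 → MvPolynomial (Fin 5) k) A := by
      rw [rename_eq_aeval_X]
      congr 2
      ext1 j
      fin_cases j <;> rfl
    rw [e, ← d.paramHom_lin₁, ← AlgHom.comp_apply]
    congr 1
    ext1 j
    simp
  have h4 : paramHom d.M₁ d.M₂ (X 4) = X 4 ^ 2 * X 3 := by simp [paramHom, paramMap]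
  have h5 : paramHom d.M₁ d.M₂ (X 5) = X 0 := by simp [paramHom, paramMap]
  rw [transformPoly]
  simp only [map_sub, map_mul, map_pow, hA, h₁, h₂, h4, h5, curvePoly, Pi.smul_apply, smul_eq_mul]
  ring

variable [IsAlgClosed k]

theorem linePoly_mem :
    d.linePoly ∈ idealOf (doubleCover l₁ l₂ ⁻¹' (L \ Set.range (R l₁ l₂))) := by
  rw [d.mem_idealOf_iff, d.paramHom_linePoly]
  exact dvd_zero _

theorem transformPoly_mem (i : Fin 2) :
    d.transformPoly i ∈ idealOf (doubleCover l₁ l₂ ⁻¹' (L \ Set.range (R l₁ l₂))) := by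
  rw [d.mem_idealOf_iff, d.paramHom_transformPoly]
  exact dvd_mul_right _ _

/-- Also the points of the strict transform on the exceptional curves come from the surface of
parameters. -/
theorem exists_of_mem_cone_pullbackCurve {v : Fin 6 → k} (hv : v ∈ cone (pullbackCurve l₁ l₂ L)) :
    ∃ w : Fin 5 → k, paramMap d.M₁ d.M₂ w = v ∧ ![w 1, w 2] ≠ 0 ∧ w 4 ≠ 0 ∧ ![w 3, w 0] ≠ 0 ∧
      eval w (curvePoly d.A d.B) = 0 := by
  obtain ⟨hv, h⟩ := hv
  have hmem := fun f hf => eval_eq_zero_of_mk_mem_zariskiClosure (f := f) h hf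
  have hcross := hmem _ d.linePoly_mem
  have hN : ∀ (N : Matrix (Fin 2) (Fin 2) k) (a b : Fin 6) (i : Fin 2),
      eval v (lin N ![X a, X b] i) = lin N ![v a, v b] i := by
    intro N a b i
    simp [lin]
  rw [linePoly, map_sub, map_mul, map_mul, hN, hN, hN, hN, sub_eq_zero] at hcross
  obtain ⟨w, rfl, hu, hb, hs⟩ := d.exists_paramMap_eq hv hcross
  refine ⟨w, rfl, hu, hb, hs, ?_⟩
  obtain ⟨i, hi⟩ := Function.ne_iff.1 hu
  have := hmem _ (d.transformPoly_mem i)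
  rw [← eval_paramHom, d.paramHom_transformPoly, map_mul] at this
  refine (mul_eq_zero.1 this).resolve_right ?_
  rw [map_mul, map_pow, map_pow, eval_X]
  refine mul_ne_zero (pow_ne_zero 4 hb) (pow_ne_zero 4 ?_)
  fin_cases i
  · simpa using hi
  · simpa using hi

end LineParam

/-- The transpose of the derivative of `paramMap`. -/
def paramJacobian {k : Type*} [Field k] (M₁ M₂ : Matrix (Fin 2) (Fin 2) k) (w : Fin 5 → k) :
    (Fin 6 → k) →ₗ[k] (Fin 5 → k) :=
  Matrix.mulVecLin (Matrix.of fun j i => eval w (pderiv j (paramMap M₁ M₂ X i)))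

theorem paramJacobian_gradient {k : Type*} [Field k] (M₁ M₂ : Matrix (Fin 2) (Fin 2) k)
    (w : Fin 5 → k) (f : MvPolynomial (Fin 6) k) :
    paramJacobian M₁ M₂ w (fun i => eval (paramMap M₁ M₂ w) (pderiv i f)) =
      fun j => eval w (pderiv j (paramHom M₁ M₂ f)) := by
  ext j
  rw [paramHom, pderiv_aeval, map_sum]
  simp only [paramJacobian, Matrix.mulVecLin_apply, Matrix.mulVec, dotProduct, Matrix.of_apply]
  refine Finset.sum_congr rfl fun i _ => ?_
  rw [map_mul, mul_comm]
  congr 1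
  exact (eval_paramHom M₁ M₂ w _).symm

theorem paramJacobian_eq {k : Type*} [Field k] (M₁ M₂ : Matrix (Fin 2) (Fin 2) k)
    (w : Fin 5 → k) (g : Fin 6 → k) : paramJacobian M₁ M₂ w g =
      ![g 5,
        M₁ 0 0 * g 0 + M₁ 1 0 * g 1 + w 4 * (M₂ 0 0 * g 2 + M₂ 1 0 * g 3),
        M₁ 0 1 * g 0 + M₁ 1 1 * g 1 + w 4 * (M₂ 0 1 * g 2 + M₂ 1 1 * g 3),
        w 4 ^ 2 * g 4,
        lin M₂ ![w 1, w 2] 0 * g 2 + lin M₂ ![w 1, w 2] 1 * g 3 + 2 * w 4 * w 3 * g 4] := by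
  ext j
  simp only [paramJacobian, Matrix.mulVecLin_apply, Matrix.mulVec, dotProduct, Matrix.of_apply,
    Fin.sum_univ_six]
  fin_cases j <;>
  simp [paramMap, lin, pderiv_X, Derivation.leibniz, Derivation.leibniz_pow, algebraMap_eq] <;>
  first | ring1 | (left; ring1)

/-- The surface of parameters is nonsingular at the points with `u ≠ 0` and `(T, s) ≠ 0`. -/
theorem LineParam.gradient_curvePoly_ne_zero {k : Type*} [Field k] (h2 : (2 : k) ≠ 0) {l₁ l₂ : k}
    {L : Set (ℙ k (Fin 2 → k) × ℙ k (Fin 2 → k))} (d : LineParam l₁ l₂ L) {w : Fin 5 → k}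
    (hu : ![w 1, w 2] ≠ 0) (hs : ![w 3, w 0] ≠ 0) :
    (fun j => eval w (pderiv j (curvePoly d.A d.B))) ≠ 0 := by
  intro h
  have hw : w ∘ ![1, 2] = ![w 1, w 2] := by
    ext i; fin_cases i <;> rfl
  have h0 := congrFun h 0
  have h1 := congrFun h 1
  have h2' := congrFun h 2
  have h3 := congrFun h 3
  simp [curvePoly, pderiv_rename_eq, pderiv_X, Derivation.leibniz, Derivation.leibniz_pow,
    eval_rename, hw, h2] at h0 h1 h2' h3
  by_cases hz : w 0 = 0
  · have hT : w 3 ≠ 0 := fun hT => hs (by ext i; fin_cases i <;> simp [hz, hT])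
    obtain ⟨i, hi⟩ := d.simple₁ _ hu (h3.resolve_right hT)
    fin_cases i
    · simp [hz, hT] at h1
      exact hi h1
    · simp [hz, hT] at h2'
      exact hi h2'
  · have h0 := h0.resolve_right hz
    have hA : eval ![w 1, w 2] d.A ≠ 0 := fun hA => hu (d.coprime _ hA h0)
    have hT : w 3 = 0 := h3.resolve_left hA
    obtain ⟨i, hi⟩ := d.simple₂ _ hu h0
    fin_cases i
    · simp [hz, hT] at h1
      exact hi h1
    · simp [hz, hT] at h2'
      exact hi h2'

namespace LineParam

variable {k : Type*} [Field k] {l₁ l₂ : k} {L : Set (ℙ k (Fin 2 → k) × ℙ k (Fin 2 → k))}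
  (d : LineParam l₁ l₂ L)

theorem eq_zero_of_lin_transpose {M N : Matrix (Fin 2) (Fin 2) k} (h : N * M = 1) {a b : k}
    (h0 : M 0 0 * a + M 1 0 * b = 0) (h1 : M 0 1 * a + M 1 1 * b = 0) : a = 0 ∧ b = 0 := by
  have hM : M * N = 1 := mul_eq_one_comm.1 h
  have e : ∀ i j, M i 0 * N 0 j + M i 1 * N 1 j = (1 : Matrix (Fin 2) (Fin 2) k) i j :=
    fun i j => by rw [← hM, Matrix.mul_apply, Fin.sum_univ_two]
  have e00 := e 0 0
  have e01 := e 0 1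
  have e10 := e 1 0
  have e11 := e 1 1
  simp at e00 e01 e10 e11
  exact ⟨by linear_combination N 0 0 * h0 + N 1 0 * h1 - a * e00 - b * e10,
    by linear_combination N 0 1 * h0 + N 1 1 * h1 - a * e01 - b * e11⟩

/-- The components along `x₂` and `z₂` determine a vector in the kernel of `paramJacobian`. -/
theorem eq_zero_of_paramJacobian_eq_zero {w : Fin 5 → k} (hb : w 4 ≠ 0) {g : Fin 6 → k}
    (hg : paramJacobian d.M₁ d.M₂ w g = 0) (h2 : g 2 = 0) (h3 : g 3 = 0) : g = 0 := by
  rw [paramJacobian_eq] at hg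
  have e0 := congrFun hg 0
  have e1 := congrFun hg 1
  have e2 := congrFun hg 2
  have e3 := congrFun hg 3
  simp [h2, h3, hb] at e0 e1 e2 e3
  obtain ⟨g0, g1⟩ := eq_zero_of_lin_transpose d.inv₁ e1 e2
  ext i
  fin_cases i <;> simp [*]

theorem exists_smul_of_paramJacobian_eq_zero {w : Fin 5 → k} (hu : ![w 1, w 2] ≠ 0) (hb : w 4 ≠ 0)
    {g g₁ : Fin 6 → k} (hg : paramJacobian d.M₁ d.M₂ w g = 0)
    (hg₁ : paramJacobian d.M₁ d.M₂ w g₁ = 0) (hg₁0 : g₁ ≠ 0) : ∃ t : k, g = t • g₁ := by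
  have hm : lin d.M₂ ![w 1, w 2] ≠ 0 := lin_ne_zero d.inv₂ hu
  -- the components along `x₂` and `z₂` are orthogonal to `M₂ u`
  have horth : ∀ g : Fin 6 → k, paramJacobian d.M₁ d.M₂ w g = 0 →
      lin d.M₂ ![w 1, w 2] 0 * g 2 + lin d.M₂ ![w 1, w 2] 1 * g 3 = 0 := by
    intro g hg
    rw [paramJacobian_eq] at hg
    have e3 := congrFun hg 3
    have e4 := congrFun hg 4
    simp only [Matrix.cons_val, Pi.zero_apply] at e3 e4
    have g4 : g 4 = 0 := (mul_eq_zero.1 e3).resolve_left (pow_ne_zero 2 hb)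
    rwa [g4, mul_zero, add_zero] at e4
  have hne : ![g₁ 2, g₁ 3] ≠ 0 := fun h => hg₁0
    (d.eq_zero_of_paramJacobian_eq_zero hb hg₁ (congrFun h 0) (congrFun h 1))
  obtain ⟨t, ht⟩ : ∃ t : k, ![g 2, g 3] = t • ![g₁ 2, g₁ 3] := by
    apply exists_smul_of_cross hne
    have o := horth g hg
    have o₁ := horth g₁ hg₁
    obtain ⟨i, hi⟩ := Function.ne_iff.1 hm
    simp only [Matrix.cons_val_zero, Matrix.cons_val_one]
    apply mul_left_cancel₀ hi
    fin_cases i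
    · simp only [Fin.zero_eta]
      linear_combination g 3 * o₁ - g₁ 3 * o
    · simp only [Fin.mk_one]
      linear_combination g₁ 2 * o - g 2 * o₁
  refine ⟨t, sub_eq_zero.1 (d.eq_zero_of_paramJacobian_eq_zero hb ?_ ?_ ?_)⟩
  · rw [map_sub, map_smul, hg, hg₁, smul_zero, sub_zero]
  · have := congrFun ht 0
    simpa [sub_eq_zero] using this
  · have := congrFun ht 1
    simpa [sub_eq_zero] using this

theorem gradient_linePoly_ne_zero {v : Fin 6 → k} (hv : IsCoord l₁ l₂ v) :
    (fun i => eval v (pderiv i d.linePoly)) ≠ 0 := by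
  intro h
  have h2 := congrFun h 2
  have h3 := congrFun h 3
  simp [linePoly, lin, pderiv_X, Derivation.leibniz, algebraMap_eq] at h2 h3
  have hu := lin_ne_zero (mul_eq_one_comm.1 d.inv₁) hv.left
  -- the derivatives along `x₂` and `z₂` are the components of the transpose of `N₂` at `(-u₁, u₀)`
  obtain ⟨e0, e1⟩ := eq_zero_of_lin_transpose (M := d.N₂) (mul_eq_one_comm.1 d.inv₂)
    (a := -lin d.N₁ ![v 0, v 1] 1) (b := lin d.N₁ ![v 0, v 1] 0)
    (by simp [lin]; linear_combination h2) (by simp [lin]; linear_combination h3)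
  refine hu (funext fun i => ?_)
  fin_cases i
  · exact e1
  · exact neg_eq_zero.1 e0

/-- The Jacobian criterion for the strict transform. -/
theorem finrank_span_gradient [IsAlgClosed k] (d : LineParam l₁ l₂ L) (h2 : (2 : k) ≠ 0)
    {v : Fin 6 → k} (hv : v ∈ cone (pullbackCurve l₁ l₂ L)) : Module.finrank k (Submodule.span k
      ((fun p : MvPolynomial (Fin 6) k => fun i => eval v (pderiv i p)) ''
        (idealOf (pullbackCurve l₁ l₂ L) : Set (MvPolynomial (Fin 6) k)))) = 2 := by
  rw [pullbackCurve, idealOf_zariskiClosure]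
  obtain ⟨w, rfl, hu, hb, hs, hw⟩ := d.exists_of_mem_cone_pullbackCurve hv
  have hgrad : ∀ {f q : MvPolynomial (Fin _) k}, paramHom d.M₁ d.M₂ f = curvePoly d.A d.B * q →
      paramJacobian d.M₁ d.M₂ w (fun i => eval (paramMap d.M₁ d.M₂ w) (pderiv i f)) =
        eval w q • fun j => eval w (pderiv j (curvePoly d.A d.B)) := by
    intro f q h
    rw [paramJacobian_gradient, h]
    ext j
    rw [Derivation.leibniz, map_add, smul_eq_mul, smul_eq_mul, map_mul, map_mul, hw, zero_mul,
      zero_add, Pi.smul_apply, smul_eq_mul]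
  have hg₁ : paramJacobian d.M₁ d.M₂ w
      (fun i => eval (paramMap d.M₁ d.M₂ w) (pderiv i d.linePoly)) = 0 := by
    rw [hgrad (q := 0) (by rw [d.paramHom_linePoly, mul_zero]), map_zero, zero_smul]
  have hg₁0 := d.gradient_linePoly_ne_zero hv.1
  obtain ⟨i, hi⟩ := Function.ne_iff.1 hu
  refine finrank_eq_two_of_map (paramJacobian d.M₁ d.M₂ w) _
    (Submodule.subset_span ⟨_, d.linePoly_mem, rfl⟩)
    (Submodule.subset_span ⟨_, d.transformPoly_mem i, rfl⟩) hg₁0 hg₁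
    (hgrad (d.paramHom_transformPoly i)) ?_ (d.gradient_curvePoly_ne_zero h2 hu hs) ?_
    fun g hg => d.exists_smul_of_paramJacobian_eq_zero hu hb hg hg₁ hg₁0
  · rw [map_mul, map_pow, map_pow, eval_X]
    refine mul_ne_zero (pow_ne_zero 4 hb) (pow_ne_zero 4 ?_)
    fin_cases i
    · simpa using hi
    · simpa using hi
  · intro g hg
    induction hg using Submodule.span_induction with
    | mem g hg =>
      obtain ⟨f, hf, rfl⟩ := hg
      obtain ⟨q, hq⟩ := d.mem_idealOf_iff.1 hf
      exact ⟨_, hgrad hq⟩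
    | zero => exact ⟨0, by rw [map_zero, zero_smul]⟩
    | add x y _ _ hx hy =>
      obtain ⟨a, ha⟩ := hx
      obtain ⟨b, hb⟩ := hy
      exact ⟨a + b, by rw [map_add, ha, hb, add_smul]⟩
    | smul c x _ hx =>
      obtain ⟨a, ha⟩ := hx
      exact ⟨c * a, by rw [map_smul, ha, smul_smul]⟩

end LineParam

/-! ### The function field of the strict transform -/

/-- Multihomogeneous polynomials are semi-invariant under the torus. -/
theorem aeval_mul_of_isWeightedHomogeneous {k S σ ι : Type*} [Field k] [CommRing S] [Algebra k S]
    [Fintype σ] [Fintype ι] {ω : σ → ι → ℕ} {n : ι → ℕ} {f : MvPolynomial σ k}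
    (hf : f.IsWeightedHomogeneous ω n) (τ : ι → S) (v : σ → S) :
    aeval (fun i => (∏ j, τ j ^ ω i j) * v i) f = (∏ j, τ j ^ n j) * aeval v f := by
  rw [aeval_def, aeval_def, eval₂_eq', eval₂_eq', Finset.mul_sum]
  refine Finset.sum_congr rfl fun m hm => ?_
  have hw := hf (mem_support_iff.1 hm)
  have hw' : ∀ j, ∑ i, m i * ω i j = n j := fun j => by
    rw [← hw, Finsupp.weight_apply, Finsupp.sum_fintype _ _ (by simp)]
    simp
  simp only [mul_pow, Finset.prod_mul_distrib]
  have h : ∏ i, (∏ j, τ j ^ ω i j) ^ m i = ∏ j, τ j ^ n j := by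
    simp only [← Finset.prod_pow, ← pow_mul]
    rw [Finset.prod_comm]
    refine Finset.prod_congr rfl fun j _ => ?_
    rw [Finset.prod_pow_eq_pow_sum, ← hw' j]
    simp only [mul_comm]
  rw [h]
  ring

theorem aeval_mem_intermediateField {k K σ : Type*} [Field k] [Field K] [Algebra k K]
    (F : IntermediateField k K) {v : σ → K} (hv : ∀ i, v i ∈ F) (f : MvPolynomial σ k) :
    aeval v f ∈ F := by
  induction f using MvPolynomial.induction_on with
  | C a => rw [aeval_C]; exact F.algebraMap_mem a
  | add p q hp hq => rw [map_add]; exact F.add_mem hp hq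
  | mul_X p i hp => rw [map_mul, aeval_X]; exact F.mul_mem hp (hv i)

theorem isWeightedHomogeneous_lin {k : Type*} [Field k] (N : Matrix (Fin 2) (Fin 2) k)
    {a b : Fin 6} {n : Fin 3 → ℕ} (ha : weight a = n) (hb : weight b = n) (i : Fin 2) :
    (lin N ![(X a : MvPolynomial (Fin 6) k), X b] i).IsWeightedHomogeneous weight n := by
  have hX : ∀ (c : k) (a : Fin 6), weight a = n →
      (C c * X a : MvPolynomial (Fin 6) k).IsWeightedHomogeneous weight n := by
    intro c a ha
    have := (isWeightedHomogeneous_C weight c).mul (isWeightedHomogeneous_X k weight a)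
    rwa [zero_add, ha] at this
  exact (hX _ a ha).add (hX _ b hb)

namespace LineParam

variable {k : Type*} [Field k] {l₁ l₂ : k} {L : Set (ℙ k (Fin 2 → k) × ℙ k (Fin 2 → k))}
  (d : LineParam l₁ l₂ L)

/-- The function field of the strict transform is generated by the coordinate `x = u₀ / u₁` on `L`
and by the square root `w = t u₁² / (s (b u₁)²)` of `B / A`. -/
theorem exists_generators_of_algHom [IsAlgClosed k] {E : Type*} [Field E] [Algebra k E]
    (φ : MvPolynomial (Fin 6) k →ₐ[k] E)
    (hφ : ∀ f, φ f = 0 ↔ curvePoly d.A d.B ∣ paramHom d.M₁ d.M₂ f) (F : IntermediateField k E)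
    (hF : ∀ r, r ∈ F ↔ ∃ (n : Fin 3 → ℕ) (f g : MvPolynomial (Fin 6) k),
      f.IsWeightedHomogeneous weight n ∧ g.IsWeightedHomogeneous weight n ∧ φ g ≠ 0 ∧
        r = φ f / φ g) :
    ∃ x w : F, Transcendental k x ∧ IntermediateField.adjoin k {x, w} = ⊤ ∧
      ∃ a : E, a ≠ 0 ∧ aeval (a • ![(x : E), 1]) d.A * (w : E) ^ 2 =
        aeval (a • ![(x : E), 1]) d.B := by
  have hnot : ∀ f w, eval w (curvePoly d.A d.B) = 0 → eval w (paramHom d.M₁ d.M₂ f) ≠ 0 →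
      φ f ≠ 0 := by
    rintro f w hw hf h
    obtain ⟨q, hq⟩ := (hφ f).1 h
    rw [hq, map_mul, hw, zero_mul] at hf
    exact hf rfl
  have hpt : ∀ c : k, eval ![0, c, 1, 0, 1] (curvePoly d.A d.B) = 0 := fun c => by
    simp [eval_curvePoly]
  -- homogeneous coordinates on `L`, in terms of `(x₁, z₁)` and of `(x₂, z₂)`
  set u : Fin 2 → MvPolynomial (Fin 6) k := lin d.N₁ ![X 0, X 1] with hu
  set u' : Fin 2 → MvPolynomial (Fin 6) k := lin d.N₂ ![X 2, X 3] with hu'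
  have pu : ∀ i, paramHom d.M₁ d.M₂ (u i) = (![X 1, X 2] : Fin 2 → MvPolynomial (Fin 5) k) i :=
    congrFun d.paramHom_lin₁
  have pu' : ∀ i, paramHom d.M₁ d.M₂ (u' i) =
      X 4 * (![X 1, X 2] : Fin 2 → MvPolynomial (Fin 5) k) i := fun i => by
    rw [← smul_eq_mul, ← Pi.smul_apply, ← d.paramHom_lin₂]
  have hdu : ∀ i, (u i).IsWeightedHomogeneous weight ![1, 0, 0] :=
    isWeightedHomogeneous_lin d.N₁ (a := 0) (b := 1) (by simp [weight]) (by simp [weight])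
  have hdu' : ∀ i, (u' i).IsWeightedHomogeneous weight ![0, 1, 0] :=
    isWeightedHomogeneous_lin d.N₂ (a := 2) (b := 3) (by simp [weight]) (by simp [weight])
  have hα : φ (u 1) ≠ 0 := hnot _ _ (hpt 0) (by rw [pu]; simp)
  have hβ : φ (u' 1) ≠ 0 := hnot _ _ (hpt 0) (by rw [pu']; simp)
  have hσ : φ (X 5) ≠ 0 := by
    obtain ⟨w, hw, -, h0, -⟩ := d.exists_generic
    exact hnot _ w hw (by rw [eval_paramHom]; simpa [paramMap] using h0)
  have hd4 : (X 4 : MvPolynomial (Fin 6) k).IsWeightedHomogeneous weight ![0, 2, 1] :=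
    isWeightedHomogeneous_X _ _ _
  have hd5 : (X 5 : MvPolynomial (Fin 6) k).IsWeightedHomogeneous weight ![2, 0, 1] :=
    isWeightedHomogeneous_X _ _ _
  obtain ⟨x, hx⟩ : ∃ x : F, (x : E) = φ (u 0) / φ (u 1) :=
    ⟨⟨_, (hF _).2 ⟨_, _, _, hdu 0, hdu 1, hα, rfl⟩⟩, rfl⟩
  obtain ⟨w, hw⟩ : ∃ w : F, (w : E) = φ (X 4) * φ (u 1) ^ 2 / (φ (X 5) * φ (u' 1) ^ 2) := by
    refine ⟨⟨_, (hF _).2 ⟨![2, 2, 1], X 4 * u 1 ^ 2, X 5 * u' 1 ^ 2, ?_, ?_, ?_, ?_⟩⟩, rfl⟩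
    · convert hd4.mul ((hdu 1).pow 2) using 1
      ext j; fin_cases j <;> simp
    · convert hd5.mul ((hdu' 1).pow 2) using 1
      ext j; fin_cases j <;> simp
    · rw [map_mul, map_pow]
      exact mul_ne_zero hσ (pow_ne_zero 2 hβ)
    · simp only [map_mul, map_pow]
  have hux : (fun i => φ (u i)) = φ (u 1) • ![(x : E), 1] := by
    ext i
    fin_cases i
    · simp [hx]
      field_simp
    · simp
  have hux' : (fun i => φ (u' i)) = φ (u' 1) • ![(x : E), 1] := by
    have hline : φ d.linePoly = 0 := by
      rw [hφ, d.paramHom_linePoly]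
      exact dvd_zero _
    rw [linePoly, map_sub, map_mul, map_mul, ← hu, ← hu'] at hline
    ext i
    fin_cases i
    · simp [hx]
      field_simp
      linear_combination -hline
    · simp
  refine ⟨x, w, ?_, ?_, φ (u 1), hα, ?_⟩
  · intro hxa
    obtain ⟨c, hc⟩ := minpoly.mem_range_of_degree_eq_one k x
      (IsAlgClosed.degree_eq_one_of_irreducible k (minpoly.irreducible hxa.isIntegral))
    have hc' : algebraMap k E c = φ (u 0) / φ (u 1) := (congrArg Subtype.val hc).trans hx
    refine hnot (u 0 - C c * u 1) ![0, c + 1, 1, 0, 1] (hpt _) ?_ ?_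
    · rw [map_sub, map_mul, pu, pu, ← algebraMap_eq, AlgHom.commutes]
      simp [algebraMap_eq]
    · rw [map_sub, map_mul, ← algebraMap_eq, AlgHom.commutes, hc']
      field_simp
      ring
  · rw [eq_top_iff]
    rintro ⟨r, hr⟩ -
    obtain ⟨n, f, g, hf, hg, hgP, rfl⟩ := (hF r).1 hr
    -- the point of the curve with coordinates in the function field
    set v : Fin 6 → F := paramMap d.M₁ d.M₂ ![1, x, 1, w, 1] with hv
    set τ : Fin 3 → E := ![φ (u 1), φ (u' 1), φ (X 5) / φ (u 1) ^ 2] with hτ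
    have hX : (fun i => φ (X i)) = fun i => (∏ j, τ j ^ weight i j) * (v i : E) := by
      have i₁ : d.M₁ * d.N₁ = 1 := mul_eq_one_comm.1 d.inv₁
      have i₂ : d.M₂ * d.N₂ = 1 := mul_eq_one_comm.1 d.inv₂
      have h₁ : ∀ i, φ ((![X 0, X 1] : Fin 2 → MvPolynomial (Fin 6) k) i) =
          φ (u 1) * lin d.M₁ ![(x : E), 1] i := by
        intro i
        rw [← lin_lin i₁ (![X 0, X 1] : Fin 2 → MvPolynomial (Fin 6) k), ← hu, map_lin, hux,
          lin_smul]
        rfl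
      have h₂ : ∀ i, φ ((![X 2, X 3] : Fin 2 → MvPolynomial (Fin 6) k) i) =
          φ (u' 1) * lin d.M₂ ![(x : E), 1] i := by
        intro i
        rw [← lin_lin i₂ (![X 2, X 3] : Fin 2 → MvPolynomial (Fin 6) k), ← hu', map_lin, hux',
          lin_smul]
        rfl
      have hl : ∀ (M : Matrix (Fin 2) (Fin 2) k) (i : Fin 2),
          ((lin M ![x, 1] i : F) : E) =
            lin M ![(x : E), 1] i := by
        intro M i
        simp [lin]
      ext i
      fin_cases i
      · simpa [Fin.prod_univ_three, weight, hτ, hv, paramMap, hl] using h₁ 0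
      · simpa [Fin.prod_univ_three, weight, hτ, hv, paramMap, hl] using h₁ 1
      · simpa [Fin.prod_univ_three, weight, hτ, hv, paramMap, hl] using h₂ 0
      · simpa [Fin.prod_univ_three, weight, hτ, hv, paramMap, hl] using h₂ 1
      · simp [Fin.prod_univ_three, weight, hτ, hv, paramMap, hw]
        field_simp
      · simp [Fin.prod_univ_three, weight, hτ, hv, paramMap]
        field_simp
    have hτ0 : ∏ j, τ j ^ n j ≠ 0 := by
      rw [Fin.prod_univ_three]
      simp [hτ, hα, hβ, hσ]
    have hφe : ∀ f : MvPolynomial (Fin 6) k, f.IsWeightedHomogeneous weight n →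
        φ f =
          (∏ j, τ j ^ n j) * ((aeval v f : F) : E) := by
      intro f hf
      have e : φ = aeval (fun i => φ (X i)) := by
        ext i
        simp
      have e' : ((aeval v f : F) : E) =
          aeval (fun i => (v i : E)) f := by
        change F.val (aeval v f) = _
        rw [← AlgHom.comp_apply]
        congr 1
        ext i
        simp
      nth_rewrite 1 [e]
      rw [hX, aeval_mul_of_isWeightedHomogeneous hf, e']
    have hmem : ∀ f : MvPolynomial (Fin 6) k, aeval v f ∈ IntermediateField.adjoin k {x, w} := by
      have hxm : x ∈ IntermediateField.adjoin k {x, w} :=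
        IntermediateField.subset_adjoin _ _ (by simp)
      have hwm : w ∈ IntermediateField.adjoin k {x, w} :=
        IntermediateField.subset_adjoin _ _ (by simp)
      have hl : ∀ (M : Matrix (Fin 2) (Fin 2) k) (i : Fin 2),
          lin M ![x, 1] i ∈ IntermediateField.adjoin k {x, w} := by
        intro M i
        exact add_mem (mul_mem (IntermediateField.algebraMap_mem _ _) hxm)
          (mul_mem (IntermediateField.algebraMap_mem _ _) (one_mem _))
      refine fun f => aeval_mem_intermediateField _ (fun i => ?_) f
      fin_cases i
      · exact hl d.M₁ 0
      · exact hl d.M₁ 1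
      · exact mul_mem (one_mem _) (hl d.M₂ 0)
      · exact mul_mem (one_mem _) (hl d.M₂ 1)
      · exact mul_mem (pow_mem (one_mem _) 2) hwm
      · exact one_mem _
    convert div_mem (hmem f) (hmem g) using 1
    apply Subtype.ext
    change φ f / φ g = _
    rw [hφe f hf, hφe g hg, mul_div_mul_left _ _ hτ0]
    rfl
  · have htr : φ (d.transformPoly 1) = 0 := by
      rw [hφ, d.paramHom_transformPoly]
      exact dvd_mul_right _ _
    have hA : ∀ A : MvPolynomial (Fin 2) k, φ (aeval u A) =
        aeval (φ (u 1) • ![(x : E), 1]) A := by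
      intro A
      rw [← hux, ← AlgHom.comp_apply]
      congr 1
      ext i
      simp
    rw [transformPoly, ← hu, ← hu'] at htr
    simp only [map_sub, map_mul, map_pow, hA] at htr
    rw [hw]
    field_simp
    linear_combination htr

end LineParam

namespace LineParam

variable {k : Type*} [Field k] [IsAlgClosed k] {l₁ l₂ : k}
  {L : Set (ℙ k (Fin 2 → k) × ℙ k (Fin 2 → k))}

/-- The part of the claim that does not depend on `A` and `B`; the genus is left to the function
field of `A(x, 1) w² = B(x, 1)`. -/
theorem isCurveOfGenus (d : LineParam l₁ l₂ L) (h2 : (2 : k) ≠ 0) {n : ℕ}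
    (hn : ∀ (P : Ideal (MvPolynomial (Fin 6) k)) [P.IsPrime] (x w : functionField P),
      Transcendental k x → IntermediateField.adjoin k {x, w} = ⊤ →
      (∃ a : P.ResidueField, a ≠ 0 ∧
        aeval (a • ![(x : P.ResidueField), 1]) d.A * (w : P.ResidueField) ^ 2 =
          aeval (a • ![(x : P.ResidueField), 1]) d.B) →
      Algebra.trdeg k (functionField P) = 1 ∧ genus k (functionField P) = n) :
    IsCurveOfGenus (pullbackCurve l₁ l₂ L) n where
  closed := zariskiClosure_zariskiClosure _
  nonsingular _ hv := d.finrank_span_gradient h2 hv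
  curve_of_genus := by
    have hI := idealOf_zariskiClosure (doubleCover l₁ l₂ ⁻¹' (L \ Set.range (R l₁ l₂)))
    have hp : (idealOf (pullbackCurve l₁ l₂ L)).IsPrime := by
      rw [pullbackCurve, hI]
      exact d.isPrime_idealOf
    refine ⟨hp, ?_⟩
    have hP : ∀ f, f ∈ idealOf (pullbackCurve l₁ l₂ L) ↔
        curvePoly d.A d.B ∣ paramHom d.M₁ d.M₂ f := fun f => by
      rw [pullbackCurve, hI]
      exact d.mem_idealOf_iff
    generalize idealOf (pullbackCurve l₁ l₂ L) = P at hp hP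
    have h0 : ∀ f, algebraMap _ P.ResidueField f = 0 ↔ f ∈ P := fun f => by simp
    obtain ⟨x, w, hx, htop, ha⟩ := d.exists_generators_of_algHom
      (IsScalarTower.toAlgHom k (MvPolynomial (Fin 6) k) P.ResidueField)
      (fun f => (h0 f).trans (hP f)) (functionField P) (fun r => by
        constructor
        · rintro ⟨n, f, g, hf, hg, hgP, rfl⟩
          exact ⟨n, f, g, hf, hg, fun h => hgP ((h0 g).1 h), rfl⟩
        · rintro ⟨n, f, g, hf, hg, hgP, rfl⟩
          exact ⟨n, f, g, hf, hg, fun h => hgP ((h0 g).2 h), rfl⟩)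
    exact hn P x w hx htop ha

/-- The curve `u₁ w² = u₀` is rational, with coordinate `w`. -/
theorem isCurveOfGenus_zero (d : LineParam l₁ l₂ L) (h2 : (2 : k) ≠ 0) (hA : d.A = X 1)
    (hB : d.B = X 0) : IsCurveOfGenus (pullbackCurve l₁ l₂ L) 0 := by
  refine d.isCurveOfGenus h2 fun P _ x w hx htop h => ?_
  have hxw : x = w ^ 2 := by
    obtain ⟨a, ha, h⟩ := h
    rw [hA, hB] at h
    simp [ha] at h
    exact Subtype.ext h.symm
  refine genus_eq_zero_of_adjoin_singleton h2 (w := w) (fun hw => hx (hxw ▸ hw.pow 2)) ?_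
  rw [eq_top_iff, ← htop, IntermediateField.adjoin_le_iff]
  have hw : w ∈ IntermediateField.adjoin k {w} := IntermediateField.mem_adjoin_simple_self k w
  exact Set.insert_subset (hxw ▸ pow_mem hw 2) (Set.singleton_subset_iff.2 hw)

/-- The curve `x w² = x² - e x + 1` is elliptic: with `y = x w`, its equation is
`y² = x (x² - e x + 1)`. -/
theorem isCurveOfGenus_one (d : LineParam l₁ l₂ L) (h2 : (2 : k) ≠ 0) {e : k} (he : e ^ 2 ≠ 4)
    (hA : d.A = X 0 * X 1) (hB : d.B = X 0 ^ 2 - C e * X 0 * X 1 + X 1 ^ 2) :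
    IsCurveOfGenus (pullbackCurve l₁ l₂ L) 1 := by
  refine d.isCurveOfGenus h2 fun P _ x w hx htop h => ?_
  have hx0 : x ≠ 0 := fun h => hx (h ▸ isAlgebraic_zero)
  have hxw : x * w ^ 2 = x ^ 2 - algebraMap k _ e * x + 1 := by
    obtain ⟨a, ha, h⟩ := h
    rw [hA, hB] at h
    apply Subtype.ext
    apply mul_left_cancel₀ (pow_ne_zero 2 ha)
    simp at h
    push_cast
    linear_combination h
  refine genus_eq_one_of_adjoin_pair h2 he hx (y := x * w) ?_ ?_
  · linear_combination x * hxw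
  rw [eq_top_iff, ← htop, IntermediateField.adjoin_le_iff]
  have hxm : x ∈ IntermediateField.adjoin k {x, x * w} :=
    IntermediateField.subset_adjoin _ _ (by simp)
  have hym : x * w ∈ IntermediateField.adjoin k {x, x * w} :=
    IntermediateField.subset_adjoin _ _ (by simp)
  refine Set.insert_subset hxm (Set.singleton_subset_iff.2 ?_)
  have := mul_mem (inv_mem hxm) hym
  rwa [inv_mul_cancel_left₀ hx0] at this

end LineParam

/-! ### The two normal forms -/

section NormalForm

/-- Eisenstein's criterion for a quadratic polynomial without linear term, `p` dividing the constant
term exactly once. -/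
theorem irreducible_C_sub_C_mul_X_sq {R : Type*} [CommRing R] [IsDomain R] {p a b : R}
    (hp : Prime p) (ha : p ∣ a) (ha' : ¬ p ^ 2 ∣ a) (hb : ¬ p ∣ b) (hab : IsRelPrime a b) :
    Irreducible (Polynomial.C a - Polynomial.C b * Polynomial.X ^ 2 : Polynomial R) := by
  have hb0 : b ≠ 0 := fun h => hb (h ▸ dvd_zero p)
  have hdeg :
      (Polynomial.C a - Polynomial.C b * Polynomial.X ^ 2 : Polynomial R).natDegree = 2 := by
    compute_degree!
  have hne : (Polynomial.C a - Polynomial.C b * Polynomial.X ^ 2 : Polynomial R) ≠ 0 := by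
    intro h
    simp [h] at hdeg
  have hI : (Ideal.span {p}).IsPrime := (Ideal.span_singleton_prime hp.ne_zero).2 hp
  refine Polynomial.irreducible_of_eisenstein_criterion hI ?_ ?_ ?_ ?_ ?_
  · rw [Polynomial.leadingCoeff, hdeg, Ideal.mem_span_singleton]
    simpa [Polynomial.coeff_C] using hb
  · intro n hn
    rw [Polynomial.degree_eq_natDegree hne, hdeg] at hn
    have hn : n < 2 := by exact_mod_cast hn
    rw [Ideal.mem_span_singleton]
    interval_cases n <;> simp [Polynomial.coeff_C, ha]
  · rw [Polynomial.degree_eq_natDegree hne, hdeg]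
    norm_num
  · rw [Ideal.span_singleton_pow, Ideal.mem_span_singleton]
    simpa [Polynomial.coeff_C] using ha'
  · intro r hr
    rw [Polynomial.C_dvd_iff_dvd_coeff] at hr
    refine hab ?_ ?_
    · simpa [Polynomial.coeff_C] using hr 0
    · simpa [Polynomial.coeff_C] using hr 2

variable {k : Type*} [Field k]

theorem finSuccEquiv_curvePoly (A B : MvPolynomial (Fin 2) k) :
    finSuccEquiv k 4 (curvePoly A B) =
      Polynomial.C (rename ![(0 : Fin 4), 1] A * X 2 ^ 2) -
        Polynomial.C (rename ![(0 : Fin 4), 1] B) * Polynomial.X ^ 2 := by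
  have h : ∀ f : MvPolynomial (Fin 2) k,
      finSuccEquiv k 4 (rename ![1, 2] f) = Polynomial.C (rename ![(0 : Fin 4), 1] f) := fun f => by
    have e : (![1, 2] : Fin 2 → Fin 5) = Fin.succ ∘ ![0, 1] := by
      ext i; fin_cases i <;> rfl
    rw [e, ← rename_rename]
    generalize rename ![(0 : Fin 4), 1] f = g
    induction g using MvPolynomial.induction_on with
    | C a =>
      rw [rename_C]
      exact (finSuccEquiv k 4).commutes a
    | add p q hp hq => rw [map_add, map_add, map_add, hp, hq]
    | mul_X p i hp => rw [map_mul, map_mul, map_mul, hp, rename_X, finSuccEquiv_X_succ]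
  have h3 : finSuccEquiv k 4 (X 3) = Polynomial.C (X 2) := finSuccEquiv_X_succ (j := 2)
  rw [curvePoly, map_sub, map_mul, map_mul, h, h, map_pow, map_pow, h3, finSuccEquiv_X_zero]
  simp

/-- The equation of the surface of parameters is prime by Eisenstein's criterion, as a polynomial in
the parameter `s`. -/
theorem prime_curvePoly {A B : MvPolynomial (Fin 2) k} {p : MvPolynomial (Fin 4) k}
    (hp : Prime p) (ha : p ∣ rename ![(0 : Fin 4), 1] A * X 2 ^ 2)
    (ha' : ¬ p ^ 2 ∣ rename ![(0 : Fin 4), 1] A * X 2 ^ 2) (hb : ¬ p ∣ rename ![(0 : Fin 4), 1] B)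
    (hab : IsRelPrime (rename ![(0 : Fin 4), 1] A * X 2 ^ 2) (rename ![(0 : Fin 4), 1] B)) :
    Prime (curvePoly A B) := by
  rw [← irreducible_iff_prime, ← MulEquiv.irreducible_iff (finSuccEquiv k 4),
    finSuccEquiv_curvePoly]
  exact irreducible_C_sub_C_mul_X_sq hp ha ha' hb hab

theorem not_dvd_of_eval {σ : Type*} {f g : MvPolynomial σ k} (v : σ → k) (hf : eval v f = 0)
    (hg : eval v g ≠ 0) : ¬ f ∣ g := by
  rintro ⟨c, rfl⟩
  exact hg (by simp [hf])

theorem not_X_sq_dvd_X_mul {σ : Type*} {i : σ} {g : MvPolynomial σ k} (h : ¬ X i ∣ g) :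
    ¬ X i ^ 2 ∣ X i * g := by
  rw [pow_two, mul_dvd_mul_iff_left (X_ne_zero i)]
  exact h

theorem isRelPrime_X_left {σ : Type*} {i : σ} {g : MvPolynomial σ k} (h : ¬ X i ∣ g) :
    IsRelPrime (X i) g :=
  (Irreducible.isRelPrime_iff_not_dvd (X_prime (R := k) (i := i)).irreducible).2 h

theorem prime_curvePoly_linear : Prime (curvePoly (X 1) (X 0) : MvPolynomial (Fin 5) k) := by
  have e1 : rename ![(0 : Fin 4), 1] (X 1 : MvPolynomial (Fin 2) k) =
      (X 1 : MvPolynomial (Fin 4) k) := by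
    simp
  have e0 : rename ![(0 : Fin 4), 1] (X 0 : MvPolynomial (Fin 2) k) =
      (X 0 : MvPolynomial (Fin 4) k) := by
    simp
  refine prime_curvePoly (p := X 1) X_prime ?_ ?_ ?_ ?_
  · rw [e1]
    exact dvd_mul_right _ _
  · rw [e1]
    exact not_X_sq_dvd_X_mul (not_dvd_of_eval ![0, 0, 1, 0] (by simp) (by simp))
  · rw [e0]
    exact not_dvd_of_eval ![1, 0, 0, 0] (by simp) (by simp)
  · rw [e1, e0]
    exact (isRelPrime_X_left (not_dvd_of_eval ![1, 0, 0, 0] (by simp) (by simp))).mul_left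
      (isRelPrime_X_left (not_dvd_of_eval ![1, 0, 0, 0] (by simp) (by simp))).pow_left

theorem prime_curvePoly_quadratic (e : k) : Prime (curvePoly (X 0 * X 1)
    (X 0 ^ 2 - C e * X 0 * X 1 + X 1 ^ 2) : MvPolynomial (Fin 5) k) := by
  have e1 : rename ![(0 : Fin 4), 1] (X 0 * X 1 : MvPolynomial (Fin 2) k) * X 2 ^ 2 =
      (X 0 * (X 1 * X 2 ^ 2) : MvPolynomial (Fin 4) k) := by
    simp [mul_assoc]
  have e0 : rename ![(0 : Fin 4), 1]
      (X 0 ^ 2 - C e * X 0 * X 1 + X 1 ^ 2 : MvPolynomial (Fin 2) k) =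
      (X 0 ^ 2 - C e * X 0 * X 1 + X 1 ^ 2 : MvPolynomial (Fin 4) k) := by
    simp
  have hX : ¬ X 0 ∣ (X 0 ^ 2 - C e * X 0 * X 1 + X 1 ^ 2 : MvPolynomial (Fin 4) k) :=
    not_dvd_of_eval ![0, 1, 0, 0] (by simp) (by simp)
  refine prime_curvePoly (p := X 0) X_prime ?_ ?_ ?_ ?_
  · rw [e1]
    exact dvd_mul_right _ _
  · rw [e1]
    exact not_X_sq_dvd_X_mul (not_dvd_of_eval ![0, 1, 1, 0] (by simp) (by simp))
  · rwa [e0]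
  · rw [e1, e0]
    refine (isRelPrime_X_left hX).mul_left (IsRelPrime.mul_left ?_ (IsRelPrime.pow_left ?_))
    · exact isRelPrime_X_left (not_dvd_of_eval ![1, 0, 0, 0] (by simp) (by simp))
    · exact isRelPrime_X_left (not_dvd_of_eval ![1, 0, 0, 0] (by simp) (by simp))

theorem eq_zero_of_mul_eq_zero_of_quadratic_eq_zero {e : k} {u : Fin 2 → k}
    (h : eval u (X 0 * X 1 : MvPolynomial (Fin 2) k) = 0)
    (h' : eval u (X 0 ^ 2 - C e * X 0 * X 1 + X 1 ^ 2 : MvPolynomial (Fin 2) k) = 0) : u = 0 := by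
  simp only [map_mul, map_sub, map_add, map_pow, eval_X, eval_C] at h h'
  have h0 : u 0 = 0 := by
    rcases mul_eq_zero.1 h with h | h
    · exact h
    · simpa [h] using h'
  have h1 : u 1 = 0 := by simpa [h0] using h'
  ext i
  fin_cases i <;> assumption

theorem exists_pderiv_mul_ne_zero {u : Fin 2 → k} (hu : u ≠ 0) :
    ∃ i, eval u (pderiv i (X 0 * X 1 : MvPolynomial (Fin 2) k)) ≠ 0 := by
  by_contra! h
  apply hu
  have h0 := h 0
  have h1 := h 1
  simp [Derivation.leibniz, pderiv_X] at h0 h1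
  ext i
  fin_cases i <;> assumption

/-- The discriminant of the quadratic form `u₀² - e u₀ u₁ + u₁²` is `e² - 4`. -/
theorem exists_pderiv_quadratic_ne_zero {e : k} (he : e ^ 2 ≠ 4)
    {u : Fin 2 → k} (hu : u ≠ 0) :
    ∃ i, eval u (pderiv i (X 0 ^ 2 - C e * X 0 * X 1 + X 1 ^ 2 : MvPolynomial (Fin 2) k)) ≠ 0 := by
  by_contra! h
  apply hu
  have h0 := h 0
  have h1 := h 1
  simp [Derivation.leibniz, Derivation.leibniz_pow, pderiv_X] at h0 h1
  have hd : 4 - e ^ 2 ≠ 0 := sub_ne_zero.2 he.symm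
  ext i
  fin_cases i
  · refine (mul_eq_zero.1 (?_ : (4 - e ^ 2) * u 0 = 0)).resolve_left hd
    linear_combination 2 * h0 + e * h1
  · refine (mul_eq_zero.1 (?_ : (4 - e ^ 2) * u 1 = 0)).resolve_left hd
    linear_combination 2 * h1 + e * h0

end NormalForm

/-! ### Curves of bidegree `(1, 1)` and the points `R i j` -/

section OneOne

variable {k : Type*} [Field k]

/-- The determinant of two vectors; it vanishes if and only if they are proportional. -/
def cross (u v : Fin 2 → k) : k := u 0 * v 1 - u 1 * v 0

theorem quartic_eq_prod (l : k) (u : Fin 2 → k) :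
    quartic l (u 0) (u 1) = -∏ i, cross u (branchVec l i) := by
  simp [Fin.prod_univ_four, cross, quartic, branchVec]
  ring

theorem cross_branchVec_ne_zero {l : k} (hl : l ≠ 0 ∧ l ≠ 1) {i j : Fin 4} (h : i ≠ j) :
    cross (branchVec l i) (branchVec l j) ≠ 0 := by
  have h1 := sub_ne_zero.2 hl.2
  have h2 := sub_ne_zero.2 hl.2.symm
  fin_cases i <;> fin_cases j <;> simp [cross, branchVec, hl.1, h1, h2] at h ⊢

theorem lin_matrix (M : Matrix (Fin 2) (Fin 2) k) (u : Fin 2 → k) (i : Fin 2) :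
    lin M u i = M i 0 * u 0 + M i 1 * u 1 := rfl

theorem cross_lin_lin (M : Matrix (Fin 2) (Fin 2) k) (u v : Fin 2 → k) :
    cross (lin M u) (lin M v) = M.det * cross u v := by
  simp only [cross, lin_matrix, Matrix.det_fin_two]
  ring

theorem cross_lin (M : Matrix (Fin 2) (Fin 2) k) (u v : Fin 2 → k) :
    cross (lin M u) v = cross u (lin M.adjugate v) := by
  simp only [cross, lin_matrix, Matrix.adjugate_fin_two, Matrix.of_apply, Matrix.cons_val]
  ring

theorem lin_mul (M N : Matrix (Fin 2) (Fin 2) k) (u : Fin 2 → k) :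
    lin (M * N) u = lin M (lin N u) := by
  ext i
  simp only [lin_matrix, Matrix.mul_apply, Fin.sum_univ_two]
  ring

theorem exists_eq_smul_of_cross_eq_zero {u v : Fin 2 → k} (hu : u ≠ 0) (hv : v ≠ 0)
    (h : cross u v = 0) : ∃ c : k, c ≠ 0 ∧ v = c • u := by
  obtain ⟨c, hc⟩ := exists_smul_of_cross hu (sub_eq_zero.1 h)
  refine ⟨c, ?_, hc⟩
  rintro rfl
  exact hv (by rw [hc, zero_smul])

theorem cross_smul (c : k) (u v : Fin 2 → k) : cross u (c • v) = c * cross u v := by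
  simp [cross]
  ring

/-- The incidence correspondence of an isomorphism of projective lines as a parametrized curve: `N`
gives the parameter, and `m` the isomorphism. -/
theorem nonempty_lineParam {l₁ l₂ : k} {L : Set (ℙ k (Fin 2 → k) × ℙ k (Fin 2 → k))}
    {m N : Matrix (Fin 2) (Fin 2) k} (hm : m.det ≠ 0) (hN : N.det ≠ 0)
    (hL : ∀ (u v : Fin 2 → k) (hu : u ≠ 0) (hv : v ≠ 0),
      (Projectivization.mk k u hu, Projectivization.mk k v hv) ∈ L ↔ cross (lin m u) v = 0)
    (A B : MvPolynomial (Fin 2) k) (G : (Fin 2 → k) → k)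
    (h₁ : ∀ u, quartic l₁ (u 0) (u 1) = G u * eval (lin N u) A)
    (h₂ : ∀ u, quartic l₂ (lin m u 0) (lin m u 1) = G u * eval (lin N u) B)
    (coprime : ∀ u, eval u A = 0 → eval u B = 0 → u = 0)
    (simple₁ : ∀ u, u ≠ 0 → eval u A = 0 → ∃ i, eval u (pderiv i A) ≠ 0)
    (simple₂ : ∀ u, u ≠ 0 → eval u B = 0 → ∃ i, eval u (pderiv i B) ≠ 0)
    (prime : Prime (curvePoly A B)) :
    ∃ d : LineParam l₁ l₂ L, d.A = A ∧ d.B = B := by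
  have hm' : m⁻¹ * m = 1 := Matrix.nonsing_inv_mul _ hm.isUnit
  have hN' : N * N⁻¹ = 1 := Matrix.mul_nonsing_inv _ hN.isUnit
  refine ⟨⟨N⁻¹, m * N⁻¹, N, N * m⁻¹, A, B, fun u => G (lin N⁻¹ u), hN', ?_, ?_, ?_, ?_,
    coprime, simple₁, simple₂, prime⟩, rfl, rfl⟩
  · rw [Matrix.mul_assoc, ← Matrix.mul_assoc m⁻¹, hm', Matrix.one_mul, hN']
  · intro u v hu hv
    have hmd : m⁻¹.det ≠ 0 := by
      rw [Matrix.det_nonsing_inv, Ring.inverse_eq_inv']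
      exact inv_ne_zero hm
    have e : cross (lin N u) (lin (N * m⁻¹) v) = N.det * m⁻¹.det * cross (lin m u) v := by
      rw [mul_assoc, ← cross_lin_lin, ← cross_lin_lin, lin_lin hm', lin_mul]
    rw [hL, ← sub_eq_zero (a := lin N u 0 * _)]
    change _ ↔ cross (lin N u) (lin (N * m⁻¹) v) = 0
    rw [e, mul_eq_zero, or_iff_right (mul_ne_zero hN hmd)]
  · intro u
    rw [h₁, lin_lin hN']
  · intro u
    rw [lin_mul, h₂, lin_lin hN']

variable {l₁ l₂ : k} {L : Set (ℙ k (Fin 2 → k) × ℙ k (Fin 2 → k))}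

/-- An irreducible conic of bidegree `(1, 1)` is the graph of an isomorphism between the two lines.
The reducible ones contain a horizontal or a vertical line, with four points `R i j`, through each
of the points `R i j` on them. -/
theorem IsOneOneCurve.exists_matrix (hL : IsOneOneCurve L)
    (hne : {ij : Fin 4 × Fin 4 | R l₁ l₂ ij ∈ L}.ncard ≠ 0)
    (hlt : {ij : Fin 4 × Fin 4 | R l₁ l₂ ij ∈ L}.ncard < 4) :
    ∃ m : Matrix (Fin 2) (Fin 2) k, m.det ≠ 0 ∧ ∀ (u v : Fin 2 → k) (hu : u ≠ 0) (hv : v ≠ 0),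
      (Projectivization.mk k u hu, Projectivization.mk k v hv) ∈ L ↔ cross (lin m u) v = 0 := by
  obtain ⟨a, b, c, d, -, hL⟩ := hL
  by_cases hdet : a * d - b * c = 0
  · exfalso
    let E : Fin 4 → Fin 4 → k := fun i j =>
      a * branchVec l₁ i 0 * branchVec l₂ j 0 + b * branchVec l₁ i 0 * branchVec l₂ j 1 +
        c * branchVec l₁ i 1 * branchVec l₂ j 0 + d * branchVec l₁ i 1 * branchVec l₂ j 1
    have hE : ∀ i j, R l₁ l₂ (i, j) ∈ L ↔ E i j = 0 := fun i j => hL _ _ _ _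
    have hEE : ∀ i j i' j', E i j * E i' j' = E i j' * E i' j := fun i j i' j' => by
      simp only [E]
      linear_combination (branchVec l₁ i 0 * branchVec l₁ i' 1 - branchVec l₁ i 1 *
        branchVec l₁ i' 0) * (branchVec l₂ j 0 * branchVec l₂ j' 1 - branchVec l₂ j 1 *
        branchVec l₂ j' 0) * hdet
    have key : ∀ f : Fin 4 → Fin 4 × Fin 4, f.Injective → ¬ ∀ n, R l₁ l₂ (f n) ∈ L := by
      intro f hf h
      have hsub : Set.range f ⊆ {ij : Fin 4 × Fin 4 | R l₁ l₂ ij ∈ L} := by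
        rintro _ ⟨n, rfl⟩
        exact h n
      have := Set.ncard_le_ncard hsub (Set.toFinite _)
      rw [Set.ncard_range_of_injective hf, Nat.card_eq_fintype_card, Fintype.card_fin] at this
      omega
    obtain ⟨⟨i, j⟩, hij⟩ := Set.nonempty_of_ncard_ne_zero hne
    have hij : E i j = 0 := (hE i j).1 hij
    by_cases hrow : ∀ j', E i j' = 0
    · exact key (fun n => (i, n)) (Prod.mk_right_injective i) fun n => (hE _ _).2 (hrow n)
    · push Not at hrow
      obtain ⟨j', hj'⟩ := hrow
      refine key (fun n => (n, j)) (Prod.mk_left_injective j) fun n => (hE _ _).2 ?_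
      have := hEE i j n j'
      rw [hij, zero_mul] at this
      exact (mul_eq_zero.1 this.symm).resolve_left hj'
  · refine ⟨!![-b, -d; a, c], ?_, fun u v hu hv => ?_⟩
    · rw [Matrix.det_fin_two_of]
      intro h
      exact hdet (by linear_combination h)
    · rw [hL, ← neg_eq_zero]
      simp only [cross, lin_matrix, Matrix.of_apply, Matrix.cons_val]
      ring_nf

end OneOne

section Existence

variable {k : Type*} [Field k]

/-- Plücker's relation. -/
theorem cross_mul_cross (u v x y : Fin 2 → k) :
    cross u v * cross x y = cross u x * cross v y - cross u y * cross v x := by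
  simp only [cross]
  ring

theorem exists_fourth {i j n : Fin 4} (h₁ : i ≠ j) (h₂ : i ≠ n) (h₃ : j ≠ n) :
    ∃ r, r ≠ i ∧ r ≠ j ∧ r ≠ n := by
  decide +revert

theorem exists_third {i j : Fin 4} : ∃ r, r ≠ i ∧ r ≠ j := by
  decide +revert

theorem prod_eq_of_four_ne {i j n r : Fin 4} (h₁ : i ≠ j) (h₂ : i ≠ n) (h₃ : j ≠ n) (hi : r ≠ i)
    (hj : r ≠ j) (hn : r ≠ n) (f : Fin 4 → k) : ∏ a, f a = f i * f j * f n * f r := by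
  have h : (Finset.univ : Finset (Fin 4)) = {i, j, n, r} := by decide +revert
  rw [h, Finset.prod_insert (by simp [h₁, h₂, hi.symm]),
    Finset.prod_insert (by simp [h₃, hj.symm]), Finset.prod_insert (by simp [hn.symm]),
    Finset.prod_singleton]
  ring

/-- Over an algebraically closed field, the coordinates and the scale factor can be chosen so that
a quadratic form prime to `x y` has outer coefficients `1`.  Then `e² ≠ 4` as its two linear factors
are not proportional. -/
theorem exists_quadratic_normalForm [IsAlgClosed k] {c p q r s : k} (hc : c ≠ 0) (hp : p ≠ 0)
    (hq : q ≠ 0) (hr : r ≠ 0) (hs : s ≠ 0) (h : p * s - q * r ≠ 0) :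
    ∃ μ κ e : k, μ ≠ 0 ∧ κ ≠ 0 ∧ e ^ 2 ≠ 4 ∧ ∀ x y,
      κ ^ 4 * (c * ((p * x + q * y) * (r * x + s * y))) =
        (μ * x) ^ 2 - e * (μ * x) * (μ⁻¹ * y) + (μ⁻¹ * y) ^ 2 := by
  -- `μ` makes the outer coefficients equal, and `κ` makes them `1`
  obtain ⟨μ, hμ⟩ := IsAlgClosed.exists_pow_nat_eq (p * r / (q * s)) (n := 4) (by norm_num)
  have hμ0 : μ ≠ 0 := by
    rintro rfl
    have : p * r / (q * s) ≠ 0 := by positivity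
    exact this (by rw [← hμ]; ring)
  obtain ⟨κ, hκ⟩ := IsAlgClosed.exists_pow_nat_eq (μ ^ 2 / (c * (p * r))) (n := 4) (by norm_num)
  have hκ0 : κ ≠ 0 := by
    rintro rfl
    have : μ ^ 2 / (c * (p * r)) ≠ 0 := by positivity
    exact this (by rw [← hκ]; ring)
  have hμ' : μ ^ 4 * (q * s) = p * r := by
    rw [hμ]
    field_simp
  have hκ' : κ ^ 4 * c * (p * r) = μ ^ 2 := by
    rw [hκ]
    field_simp
  have hκ'' : κ ^ 4 * c * (q * s) * μ ^ 2 = 1 := by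
    refine mul_left_cancel₀ (pow_ne_zero 2 hμ0) ?_
    linear_combination hκ' + κ ^ 4 * c * hμ'
  refine ⟨μ, κ, -(κ ^ 4 * c * (p * s + q * r)), hμ0, hκ0, ?_, fun x y => ?_⟩
  · intro he
    have h4 : (κ ^ 4 * c * (p * s - q * r)) ^ 2 = 0 := by
      have : (κ ^ 4 * c * (p * r)) * (κ ^ 4 * c * (q * s)) = 1 := by
        rw [hκ']
        linear_combination hκ''
      linear_combination he - 4 * this
    refine h ((mul_eq_zero.1 (pow_eq_zero_iff two_ne_zero |>.1 h4)).resolve_left ?_)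
    exact mul_ne_zero (pow_ne_zero _ hκ0) hc
  · have e1 : μ * μ⁻¹ = 1 := mul_inv_cancel₀ hμ0
    linear_combination x ^ 2 * hκ' + y ^ 2 * (μ⁻¹ ^ 2 * hκ'' - κ ^ 4 * c * (q * s) *
      (μ * μ⁻¹ + 1) * e1) - κ ^ 4 * c * (p * s + q * r) * x * y * e1

variable {l₁ l₂ : k} {L : Set (ℙ k (Fin 2 → k) × ℙ k (Fin 2 → k))}

/-- If `L` is the graph of the isomorphism `m`, then `β j` are the inverse images of the branch
points of the second line, and `R i j` lies on `L` if the `i`-th branch point equals `β j`. -/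
theorem exists_preimages {m : Matrix (Fin 2) (Fin 2) k} (hm : m.det ≠ 0)
    (hl₂ : l₂ ≠ 0 ∧ l₂ ≠ 1)
    (hL : ∀ (u v : Fin 2 → k) (hu : u ≠ 0) (hv : v ≠ 0),
      (Projectivization.mk k u hu, Projectivization.mk k v hv) ∈ L ↔ cross (lin m u) v = 0) :
    ∃ β : Fin 4 → Fin 2 → k, (∀ j, β j ≠ 0) ∧ (∀ j j', j ≠ j' → cross (β j) (β j') ≠ 0) ∧
      (∀ i j, R l₁ l₂ (i, j) ∈ L ↔ cross (branchVec l₁ i) (β j) = 0) ∧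
      ∀ u, quartic l₂ (lin m u 0) (lin m u 1) = -∏ j, cross u (β j) := by
  have hne : ∀ j j', j ≠ j' → cross (lin m.adjugate (branchVec l₂ j))
      (lin m.adjugate (branchVec l₂ j')) ≠ 0 := fun j j' h => by
    rw [cross_lin_lin, Matrix.det_adjugate]
    exact mul_ne_zero (pow_ne_zero _ hm) (cross_branchVec_ne_zero hl₂ h)
  refine ⟨fun j => lin m.adjugate (branchVec l₂ j), fun j h => ?_, hne, fun i j => ?_, fun u => ?_⟩
  · obtain ⟨j', hj', -⟩ := exists_third (i := j) (j := j)
    refine hne j j' hj'.symm ?_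
    rw [show lin m.adjugate (branchVec l₂ j) = 0 from h]
    simp [cross]
  · rw [← cross_lin]
    exact hL _ _ _ _
  · rw [quartic_eq_prod]
    simp only [cross_lin]

theorem cross_eq_zero_trans {u v w : Fin 2 → k} (hu : u ≠ 0) (hv : cross u v = 0)
    (hw : cross u w = 0) : cross v w = 0 := by
  obtain ⟨a, rfl⟩ := exists_smul_of_cross hu (sub_eq_zero.1 hv)
  obtain ⟨b, rfl⟩ := exists_smul_of_cross hu (sub_eq_zero.1 hw)
  simp [cross]
  ring

theorem cross_swap (u v : Fin 2 → k) : cross u v = -cross v u := by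
  simp only [cross]
  ring

/-- A nondegenerate `L` contains at most one of the points `R i j` in each row and each column. -/
theorem ne_of_cross {β : Fin 4 → Fin 2 → k} (hl₁ : l₁ ≠ 0 ∧ l₁ ≠ 1) (h0 : ∀ j, β j ≠ 0)
    (hβ : ∀ j j', j ≠ j' → cross (β j) (β j') ≠ 0) {x y : Fin 4 × Fin 4} (h : x ≠ y)
    (hx : cross (branchVec l₁ x.1) (β x.2) = 0) (hy : cross (branchVec l₁ y.1) (β y.2) = 0) :
    x.1 ≠ y.1 ∧ x.2 ≠ y.2 := by
  have h1 : x.2 = y.2 → x.1 = y.1 := fun e => by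
    by_contra hne
    refine cross_branchVec_ne_zero hl₁ hne (cross_eq_zero_trans (h0 x.2) ?_ ?_)
    · rw [cross_swap, hx, neg_zero]
    · rw [cross_swap, e, hy, neg_zero]
  have h2 : x.1 = y.1 → x.2 = y.2 := fun e => by
    by_contra hne
    exact hβ _ _ hne (cross_eq_zero_trans (branchVec_ne_zero l₁ x.1) hx (e ▸ hy))
  exact ⟨fun e => h (Prod.ext e (h2 e)), fun e => h (Prod.ext (h1 e) e)⟩

/-- One branch point on either line remains unmatched, and the two are distinct as points of `L`:
the two linear forms that vanish there are coordinates on `L`. -/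
theorem IsOneOneCurve.exists_lineParam_of_ncard_eq_three (hL : IsOneOneCurve L)
    (hl₁ : l₁ ≠ 0 ∧ l₁ ≠ 1) (hl₂ : l₂ ≠ 0 ∧ l₂ ≠ 1)
    (h : {ij : Fin 4 × Fin 4 | R l₁ l₂ ij ∈ L}.ncard = 3) :
    ∃ d : LineParam l₁ l₂ L, d.A = X 1 ∧ d.B = X 0 := by
  obtain ⟨m, hm, hmL⟩ := hL.exists_matrix (l₁ := l₁) (l₂ := l₂) (by omega) (by omega)
  obtain ⟨β, hβ0, hβ, hR, hq⟩ := exists_preimages (l₁ := l₁) hm hl₂ hmL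
  obtain ⟨x, y, z, hxy, hxz, hyz, hS⟩ := Set.ncard_eq_three.1 h
  have hmem : ∀ w : Fin 4 × Fin 4,
      cross (branchVec l₁ w.1) (β w.2) = 0 ↔ w = x ∨ w = y ∨ w = z := fun w => by
    rw [← hR]
    exact Set.ext_iff.1 hS w
  have hx := (hmem x).2 (by simp)
  have hy := (hmem y).2 (by simp)
  have hz := (hmem z).2 (by simp)
  obtain ⟨xy₁, xy₂⟩ := ne_of_cross hl₁ hβ0 hβ hxy hx hy
  obtain ⟨xz₁, xz₂⟩ := ne_of_cross hl₁ hβ0 hβ hxz hx hz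
  obtain ⟨yz₁, yz₂⟩ := ne_of_cross hl₁ hβ0 hβ hyz hy hz
  obtain ⟨i, hix, hiy, hiz⟩ := exists_fourth xy₁ xz₁ yz₁
  obtain ⟨j, hjx, hjy, hjz⟩ := exists_fourth xy₂ xz₂ yz₂
  have hij : cross (branchVec l₁ i) (β j) ≠ 0 := fun h => by
    rcases (hmem (i, j)).1 h with rfl | rfl | rfl
    · exact hix rfl
    · exact hiy rfl
    · exact hiz rfl
  obtain ⟨a, ha, hxa⟩ := exists_eq_smul_of_cross_eq_zero (branchVec_ne_zero _ _) (hβ0 _) hx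
  obtain ⟨b, hb, hyb⟩ := exists_eq_smul_of_cross_eq_zero (branchVec_ne_zero _ _) (hβ0 _) hy
  obtain ⟨c, hc, hzc⟩ := exists_eq_smul_of_cross_eq_zero (branchVec_ne_zero _ _) (hβ0 _) hz
  -- the parameters are the linear forms that vanish at the remaining branch points
  have hN : ∀ u, lin !![a * b * c * β j 1, -(a * b * c * β j 0);
      branchVec l₁ i 1, -branchVec l₁ i 0] u =
        ![a * b * c * cross u (β j), cross u (branchVec l₁ i)] := fun u => by
    ext n
    fin_cases n <;> simp [lin_matrix, cross] <;> ring
  refine nonempty_lineParam hm (N := !![a * b * c * β j 1, -(a * b * c * β j 0);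
      branchVec l₁ i 1, -branchVec l₁ i 0]) ?_ hmL _ _
    (fun u => -(cross u (branchVec l₁ x.1) * cross u (branchVec l₁ y.1) *
      cross u (branchVec l₁ z.1))) (fun u => ?_) (fun u => ?_) ?_ ?_ ?_ prime_curvePoly_linear
  · have e : a * b * c * cross (branchVec l₁ i) (β j) ≠ 0 :=
      mul_ne_zero (mul_ne_zero (mul_ne_zero ha hb) hc) hij
    intro h
    rw [Matrix.det_fin_two_of] at h
    refine e ?_
    simp only [cross]
    linear_combination -h
  · rw [hN, quartic_eq_prod, prod_eq_of_four_ne xy₁ xz₁ yz₁ hix hiy hiz]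
    simp
  · rw [hN, hq, prod_eq_of_four_ne xy₂ xz₂ yz₂ hjx hjy hjz, hxa, hyb, hzc]
    simp [cross_smul]
    ring
  · intro u h1 h0
    ext n
    fin_cases n
    · simpa using h0
    · simpa using h1
  · exact fun u _ _ => ⟨1, by simp⟩
  · exact fun u _ _ => ⟨0, by simp⟩

/-- Two branch points on either line remain unmatched. The coordinates on `L` are chosen to vanish
at those of the first line, and they and the matrix of the isomorphism are scaled to normalize the
quadratic form of the second line. -/
theorem IsOneOneCurve.exists_lineParam_of_ncard_eq_two [IsAlgClosed k] (hL : IsOneOneCurve L)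
    (hl₁ : l₁ ≠ 0 ∧ l₁ ≠ 1) (hl₂ : l₂ ≠ 0 ∧ l₂ ≠ 1)
    (h : {ij : Fin 4 × Fin 4 | R l₁ l₂ ij ∈ L}.ncard = 2) :
    ∃ (e : k) (d : LineParam l₁ l₂ L), e ^ 2 ≠ 4 ∧ d.A = X 0 * X 1 ∧
      d.B = X 0 ^ 2 - C e * X 0 * X 1 + X 1 ^ 2 := by
  obtain ⟨m, hm, hmL⟩ := hL.exists_matrix (l₁ := l₁) (l₂ := l₂) (by omega) (by omega)
  obtain ⟨β, hβ0, hβ, hR, hq⟩ := exists_preimages (l₁ := l₁) hm hl₂ hmL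
  obtain ⟨x, y, hxy, hS⟩ := Set.ncard_eq_two.1 h
  have hmem : ∀ w : Fin 4 × Fin 4,
      cross (branchVec l₁ w.1) (β w.2) = 0 ↔ w = x ∨ w = y := fun w => by
    rw [← hR]
    exact Set.ext_iff.1 hS w
  have hx := (hmem x).2 (by simp)
  have hy := (hmem y).2 (by simp)
  obtain ⟨xy₁, xy₂⟩ := ne_of_cross hl₁ hβ0 hβ hxy hx hy
  obtain ⟨i, hix, hiy⟩ := exists_third (i := x.1) (j := y.1)
  obtain ⟨j, hjx, hjy⟩ := exists_third (i := x.2) (j := y.2)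
  obtain ⟨i', hi'x, hi'y, hi'⟩ := exists_fourth xy₁ hix.symm hiy.symm
  obtain ⟨j', hj'x, hj'y, hj'⟩ := exists_fourth xy₂ hjx.symm hjy.symm
  have hne : ∀ i j, i ≠ x.1 → i ≠ y.1 → cross (β j) (branchVec l₁ i) ≠ 0 := fun i j h h' hc => by
    rw [cross_swap, neg_eq_zero] at hc
    rcases (hmem (i, j)).1 hc with rfl | rfl
    · exact h rfl
    · exact h' rfl
  obtain ⟨a, ha, hxa⟩ := exists_eq_smul_of_cross_eq_zero (branchVec_ne_zero _ _) (hβ0 _) hx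
  obtain ⟨b, hb, hyb⟩ := exists_eq_smul_of_cross_eq_zero (branchVec_ne_zero _ _) (hβ0 _) hy
  have hD : cross (branchVec l₁ i) (branchVec l₁ i') ≠ 0 := cross_branchVec_ne_zero hl₁ hi'.symm
  -- Plücker's relation expresses the forms of the second quartic in those of the first
  obtain ⟨μ, κ, e, hμ, hκ, he, hform⟩ := exists_quadratic_normalForm
    (c := a * b / cross (branchVec l₁ i) (branchVec l₁ i') ^ 2)
    (div_ne_zero (mul_ne_zero ha hb) (pow_ne_zero 2 hD))
    (hne i' j hi'x hi'y) (neg_ne_zero.2 (hne i j hix hiy)) (hne i' j' hi'x hi'y)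
    (neg_ne_zero.2 (hne i j' hix hiy)) (fun h0 => mul_ne_zero (hβ _ _ hj'.symm) hD
      ((cross_mul_cross _ _ _ _).trans (by linear_combination h0)))
  have hN : ∀ u, lin !![μ * branchVec l₁ i 1, -(μ * branchVec l₁ i 0);
      μ⁻¹ * branchVec l₁ i' 1, -(μ⁻¹ * branchVec l₁ i' 0)] u =
        ![μ * cross u (branchVec l₁ i), μ⁻¹ * cross u (branchVec l₁ i')] := fun u => by
    ext n
    fin_cases n <;> simp [lin_matrix, cross] <;> ring
  have hκm : ∀ u : Fin 2 → k, lin (κ • m) u = κ • lin m u := fun u => by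
    ext n
    simp only [lin_matrix, Matrix.smul_apply, Pi.smul_apply, smul_eq_mul]
    ring
  refine (nonempty_lineParam (m := κ • m) (N := !![μ * branchVec l₁ i 1, -(μ * branchVec l₁ i 0);
      μ⁻¹ * branchVec l₁ i' 1, -(μ⁻¹ * branchVec l₁ i' 0)]) ?_ ?_ (fun u v hu hv => ?_) _ _
    (fun u => -(cross u (branchVec l₁ x.1) * cross u (branchVec l₁ y.1)))
    (fun u => ?_) (fun u => ?_) ?_ ?_ ?_ (prime_curvePoly_quadratic e)).elim
    fun d hd => ⟨e, d, he, hd⟩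
  · rw [Matrix.det_smul]
    exact mul_ne_zero (pow_ne_zero _ hκ) hm
  · intro h
    rw [Matrix.det_fin_two_of] at h
    have e1 : μ * μ⁻¹ = 1 := mul_inv_cancel₀ hμ
    refine hD ?_
    simp only [cross]
    linear_combination h - (branchVec l₁ i 0 * branchVec l₁ i' 1 -
      branchVec l₁ i 1 * branchVec l₁ i' 0) * e1
  · rw [hmL, hκm, cross_swap, cross_swap (κ • _), cross_smul]
    simp [hκ]
  · rw [hN, quartic_eq_prod, prod_eq_of_four_ne xy₁ hix.symm hiy.symm hi'x hi'y hi']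
    simp
    field_simp
  · have hu := hform (cross u (branchVec l₁ i)) (cross u (branchVec l₁ i'))
    have hj1 := cross_mul_cross u (β j) (branchVec l₁ i) (branchVec l₁ i')
    have hj2 := cross_mul_cross u (β j') (branchVec l₁ i) (branchVec l₁ i')
    rw [hN, hκm]
    simp only [Pi.smul_apply, smul_eq_mul]
    rw [quartic_mul, hq, prod_eq_of_four_ne xy₂ hjx.symm hjy.symm hj'x hj'y hj', hxa, hyb]
    simp only [map_add, map_sub, map_mul, map_pow, eval_C, eval_X, Matrix.cons_val_zero,
      Matrix.cons_val_one, cross_smul, ← hu]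
    rw [show cross (β j) (branchVec l₁ i') * cross u (branchVec l₁ i) +
        -cross (β j) (branchVec l₁ i) * cross u (branchVec l₁ i') =
          cross u (β j) * cross (branchVec l₁ i) (branchVec l₁ i') by linear_combination -hj1,
      show cross (β j') (branchVec l₁ i') * cross u (branchVec l₁ i) +
        -cross (β j') (branchVec l₁ i) * cross u (branchVec l₁ i') =
          cross u (β j') * cross (branchVec l₁ i) (branchVec l₁ i') by linear_combination -hj2]
    field_simp
  · exact fun u => eq_zero_of_mul_eq_zero_of_quadratic_eq_zero
  · exact fun u hu _ => exists_pderiv_mul_ne_zero hu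
  · exact fun u hu _ => exists_pderiv_quadratic_ne_zero he hu

end Existence

end

end KummerPencil

theorem mainTheorem9 {k : Type*} [Field k] [IsAlgClosed k] (h2 : (2 : k) ≠ 0)
    (l₁ l₂ : k) (h₁ : l₁ ≠ 0 ∧ l₁ ≠ 1) (h₂ : l₂ ≠ 0 ∧ l₂ ≠ 1)
    (L : Set (Projectivization k (Fin 2 → k) × Projectivization k (Fin 2 → k)))
    (hL : KummerPencil.IsOneOneCurve L) :
    ({ij : Fin 4 × Fin 4 | KummerPencil.R l₁ l₂ ij ∈ L}.ncard = 3 →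
      KummerPencil.IsCurveOfGenus (KummerPencil.pullbackCurve l₁ l₂ L) 0) ∧
    ({ij : Fin 4 × Fin 4 | KummerPencil.R l₁ l₂ ij ∈ L}.ncard = 2 →
      KummerPencil.IsCurveOfGenus (KummerPencil.pullbackCurve l₁ l₂ L) 1) := by
  refine ⟨fun h => ?_, fun h => ?_⟩
  · obtain ⟨d, hA, hB⟩ := hL.exists_lineParam_of_ncard_eq_three h₁ h₂ h
    exact d.isCurveOfGenus_zero h2 hA hB
  · obtain ⟨e, d, he, hA, hB⟩ := hL.exists_lineParam_of_ncard_eq_two h₁ h₂ h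
    exact d.isCurveOfGenus_one h2 he hA hB
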